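/- **Skew monoidal categories.** A skew monoidal category is a category $\mathcal C$ with a functor $\otimes\colon\mathcal C\times\mathcal C\to\mathcal C$, an object $i$, and natural (not necessarily invertible) maps $\alpha\colon(a\otimes b)\otimes c\to a\otimes(b\otimes c)$, $\lambda\colon i\otimes a\to a$, $\rho\colon a\to a\otimes i$ satisfying $(1\otimes\alpha)\,\alpha\,(\alpha\otimes1)=\alpha\,\alpha$, $\ \lambda_{a\otimes b}\,\alpha=\lambda_a\otimes1$, $\ \alpha\,\rho_{a\otimes b}=1\otimes\rho_b$, $\ (1\otimes\lambda)\,\alpha\,(\rho\otimes1)=1$, $\ \lambda_i\,\rho_i=1$. With lax monoidal functors and monoidal natural transformations they form a 2-category $\mathbf{Skew}_\ell$. $\mathcal C$ is *closed* if for all $b,c$ there are an object $[b,c]$ and a map $e\colon[b,c]\otimes b\to c$ such that $f\mapsto e\circ(f\otimes1_b)$ is a bijection $\mathcal C(a,[b,c])\to\mathcal C(a\otimes b,c)$ for all $a$. Let $\mathbf{SkewMCl}_\ell$ be the full sub-2-category of $\mathbf{Skew}_\ell$ on the closed skew monoidal categories. **Skew multicategories.** Let $R_0=\{\ell\}$ and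 $R_n=\{t\to\ell\}$ for $n>0$, with operadic composition $x(x_1,\dots,x_n)=t$ if $x=x_1=t$, and $\ell$ otherwise. A skew multicategory $\mathbb A$ consists of a set of objects, sets $\mathbb A_x(a_1,\dots,a_n;b)$ for $x\in R_n$ (*tight* multimaps for $x=t$, *loose* ones for $x=\ell$), functions $j\colon\mathbb A_t(\bar a;b)\to\mathbb A_\ell(\bar a;b)$ for $n>0$, identities $1_a\in\mathbb A_t(a;a)$, and substitution maps $$\mathbb A_x(b_1,\dots,b_n;c)\times\prod_{k}\mathbb A_{x_k}(\bar a_k;b_k)\to\mathbb A_{x(x_1,\dots,x_n)}(\bar a_1,\dots,\bar a_n;c)$$ that are associative, unital, and natural in $x,x_1,\dots,x_n$. Write $g\circ_k f=g(1,\dots,1,f,1,\dots,1)$ with $f$ in place $k$. A morphism $F$ consists of maps on objects and on multimaps (of each kind) preserving $j$, identities and substitution; a 2-cell $\varphi\colon F\to G$ consists of tight unary maps $\varphi_a\colon Fa\to Ga$ with $\varphi_b(Ff)=(Gf)(\varphi_{a_1},\dots,\varphi_{a_n})$ for every multimap $f$. This gives the 2-category $\mathbf{R}\text{-}\mathbf{Mult}$.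 The underlying category of $\mathbb A$ has the same objects and the tight unary maps as morphisms. A multimap $\theta\in\mathbb A_x(\bar a;m)$ is *universal* if $-\circ_1\theta\colon\mathbb A_t(m;b)\to\mathbb A_x(\bar a;b)$ is a bijection for all $b$, and *left universal* if $-\circ_1\theta\colon\mathbb A_t(m,\bar b;c)\to\mathbb A_x(\bar a,\bar b;c)$ is a bijection for all $\bar b,c$. $\mathbb A$ is *left representable* if for all $n\ge 0$, $x\in R_n$ and $\bar a=(a_1,\dots,a_n)$ there is a universal $\theta\in\mathbb A_x(\bar a;m)$ for some $m$, and every universal multimap is left universal. $\mathbb A$ is *closed* if for all $b,c$ there are an object $[b,c]$ and $e\in\mathbb A_t([b,c],b;c)$ such that $e\circ_1-\colon\mathbb A_x(\bar a;[b,c])\to\mathbb A_x(\bar a,b;c)$ is a bijection for all $n\ge0$, $x\in R_n$ and $\bar a$ of length $n$. **Association.** A skew monoidal category $\mathcal C$ is *associated* with a left representable skew multicategory $\mathbb A$ if it is (identified with) the underlying category of $\mathbb A$ with structure determined by universal multimaps $\theta_0\in\mathbb A_\ell(\ ;i)$ and $\theta_{a,b}\in\mathbb A_t(a,b;a\otimes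 b)$ through $(f\otimes g)(\theta_{a,b})=\theta_{a',b'}(f,g)$ (for $f\colon a\to a'$, $g\colon b\to b'$), $\ \alpha\,(\theta_{a\otimes b,c}\circ_1\theta_{a,b})=\theta_{a,b\otimes c}\circ_2\theta_{b,c}$, $\ \lambda_a\,(\theta_{i,a}\circ_1\theta_0)=j(1_a)$, $\ \rho_a=\theta_{a,i}\circ_2\theta_0$. **Theorem.** There is a 2-functor $\Phi\colon\mathbf{Skew}_\ell\to\mathbf{R}\text{-}\mathbf{Mult}$ such that * $\Phi$ is the canonical correspondence: each $\mathcal C$ is associated with $\Phi\mathcal C$; for a lax monoidal functor $(F,F_0,F_2)$, the morphism $\Phi F$ acts as $F$ on objects and on tight unary maps and sends $\theta_0$ to $F_0\circ_1\theta_0$ and $\theta_{a,b}$ to $F_2\circ_1\theta_{Fa,Fb}$; and $\Phi\varphi$ has the same components as $\varphi$ for each monoidal transformation $\varphi$; * $\Phi$ takes values in left representable skew multicategories and is a 2-equivalence between $\mathbf{Skew}_\ell$ and the full sub-2-category of $\mathbf{R}\text{-}\mathbf{Mult}$ on these; * $\mathcal C$ is closed if and only if $\Phi\mathcal C$ is closed,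 and $\Phi$ restricts to a 2-equivalence between $\mathbf{SkewMCl}_\ell$ and the full sub-2-category of $\mathbf{R}\text{-}\mathbf{Mult}$ on the left representable closed skew multicategories. Moreover every left representable skew multicategory $\mathbb A$ has an associated skew monoidal category, and $\mathbb A$ is closed if and only if a (equivalently, any) skew monoidal category associated with it is closed. -/

import Mathlib

open CategoryTheory

universe v u w₁ w₂ v₁ v₂ u₁ u₂

/-! ### 2-functors, 2-equivalences, full sub-2-categories

A 2-category is a bicategory that is `Bicategory.Strict`, and a 2-functor is a
`StrictPseudofunctor`. -/

namespace TwoCat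

open Bicategory

variable {B : Type u₁} [Bicategory.{w₁, v₁} B] {C : Type u₂} [Bicategory.{w₂, v₂} C]

/-- An (invertible) 2-natural isomorphism between 2-functors: invertible 1-cells, strictly natural
with respect to 1-cells and to 2-cells. -/
structure TwoNatIso (F G : StrictPseudofunctor B C) where
  app (a : B) : F.obj a ⟶ G.obj a
  inv (a : B) : G.obj a ⟶ F.obj a
  app_inv (a : B) : app a ≫ inv a = 𝟙 (F.obj a)
  inv_app (a : B) : inv a ≫ app a = 𝟙 (G.obj a)
  naturality {a b : B} (f : a ⟶ b) : F.map f ≫ app b = app a ≫ G.map f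
  naturality₂ {a b : B} {f g : a ⟶ b} (η : f ⟶ g) :
    F.map₂ η ▷ app b ≫ eqToHom (naturality g) = eqToHom (naturality f) ≫ app a ◁ G.map₂ η

/-- A 2-functor is a 2-equivalence if it has an inverse up to 2-natural isomorphism. -/
def IsTwoEquivalence (F : StrictPseudofunctor B C) : Prop :=
  ∃ G : StrictPseudofunctor C B,
    Nonempty (TwoNatIso (F.comp G) (StrictPseudofunctor.id B)) ∧
      Nonempty (TwoNatIso (G.comp F) (StrictPseudofunctor.id C))

/-- The full sub-2-category on the objects satisfying `P`. -/
abbrev FullSub (C : Type u₂) [Bicategory.{w₂, v₂} C] (P : C → Prop) : Type u₂ :=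
  InducedBicategory C (Subtype.val : {c : C // P c} → C)

/-- The inclusion of a full sub-2-category. -/
abbrev incl (P : C → Prop) : StrictPseudofunctor (FullSub C P) C :=
  InducedBicategory.forget

theorem hom_conj {P : C → Prop} {X Y : FullSub C P} {f f' g g' : X ⟶ Y} (e : f = f')
    (θ : f' ⟶ g') (e' : g' = g) :
    (eqToHom e ≫ θ ≫ eqToHom e').hom =
      eqToHom (congrArg InducedBicategory.Hom.hom e) ≫ θ.hom ≫
        eqToHom (congrArg InducedBicategory.Hom.hom e') := by
  subst e e'
  simp

/-- A 2-functor whose values satisfy `P`, regarded as a 2-functor to the full sub-2-category. -/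
def corestrict [Strict B] [Strict C] (F : StrictPseudofunctor B C) (P : C → Prop)
    (h : ∀ b, P (F.obj b)) : StrictPseudofunctor B (FullSub C P) :=
  StrictPseudofunctor.mk''
    { obj := fun b => (⟨F.obj b, h b⟩ : {c : C // P c})
      map := fun f => InducedBicategory.mkHom (F.map f)
      map₂ := fun η => InducedBicategory.mkHom₂ (F.map₂ η)
      map₂_id := fun f => by
        apply InducedBicategory.hom₂_ext
        exact F.map₂_id f
      map₂_comp := fun η θ => by
        apply InducedBicategory.hom₂_ext
        exact F.map₂_comp η θ
      map_id := fun X => by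
        apply InducedBicategory.hom_ext
        exact F.map_id X
      map_comp := fun f g => by
        apply InducedBicategory.hom_ext
        exact F.map_comp f g
      map₂_whisker_left := fun {a b c} f {g g'} η => by
        apply InducedBicategory.hom₂_ext
        have := F.map₂_whisker_left f η
        simp only [F.mapComp_eq_eqToIso, eqToIso.hom, eqToIso.inv] at this
        exact this.trans (hom_conj (P := P)
          (X := (⟨F.obj a, h a⟩ : {c : C // P c})) (Y := (⟨F.obj c, h c⟩ : {c : C // P c}))
          (f := InducedBicategory.mkHom (F.map (f ≫ g)))
          (f' := InducedBicategory.mkHom (F.map f ≫ F.map g))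
          (g' := InducedBicategory.mkHom (F.map f ≫ F.map g'))
          (g := InducedBicategory.mkHom (F.map (f ≫ g')))
          (InducedBicategory.hom_ext (F.map_comp _ _))
          (InducedBicategory.mkHom₂ (F.map f ◁ F.map₂ η))
          (InducedBicategory.hom_ext (F.map_comp _ _).symm)).symm
      map₂_whisker_right := fun {a b c} {f f'} η g => by
        apply InducedBicategory.hom₂_ext
        have := F.map₂_whisker_right η g
        simp only [F.mapComp_eq_eqToIso, eqToIso.hom, eqToIso.inv] at this
        exact this.trans (hom_conj (P := P)
          (X := (⟨F.obj a, h a⟩ : {c : C // P c})) (Y := (⟨F.obj c, h c⟩ : {c : C // P c}))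
          (f := InducedBicategory.mkHom (F.map (f ≫ g)))
          (f' := InducedBicategory.mkHom (F.map f ≫ F.map g))
          (g' := InducedBicategory.mkHom (F.map f' ≫ F.map g))
          (g := InducedBicategory.mkHom (F.map (f' ≫ g)))
          (InducedBicategory.hom_ext (F.map_comp _ _))
          (InducedBicategory.mkHom₂ (F.map₂ η ▷ F.map g))
          (InducedBicategory.hom_ext (F.map_comp _ _).symm)).symm }

end TwoCat

/-! ### Skew monoidal categories -/

set_option linter.checkUnivs false in
/-- A (left) skew monoidal category: a tensor product, a unit object, and natural transformations
`α : (a ⊗ b) ⊗ c ⟶ a ⊗ (b ⊗ c)`, `l : i ⊗ a ⟶ a` (the left unit map, usually denoted by a lambda)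
and `ρ : a ⟶ a ⊗ i`, not necessarily invertible, subject to five axioms. -/
structure SkewMonCat : Type (max (u + 1) (v + 1)) where
  Obj : Type u
  [cat : Category.{v} Obj]
  tensor : Obj → Obj → Obj
  tensorMap {a a' b b' : Obj} (f : a ⟶ a') (g : b ⟶ b') : tensor a b ⟶ tensor a' b'
  tensorMap_id (a b : Obj) : tensorMap (𝟙 a) (𝟙 b) = 𝟙 (tensor a b)
  tensorMap_comp {a a' a'' b b' b'' : Obj} (f : a ⟶ a') (f' : a' ⟶ a'') (g : b ⟶ b')
    (g' : b' ⟶ b'') : tensorMap (f ≫ f') (g ≫ g') = tensorMap f g ≫ tensorMap f' g'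
  unit : Obj
  α (a b c : Obj) : tensor (tensor a b) c ⟶ tensor a (tensor b c)
  l (a : Obj) : tensor unit a ⟶ a
  ρ (a : Obj) : a ⟶ tensor a unit
  α_natural {a a' b b' c c' : Obj} (f : a ⟶ a') (g : b ⟶ b') (h : c ⟶ c') :
    tensorMap (tensorMap f g) h ≫ α a' b' c' = α a b c ≫ tensorMap f (tensorMap g h)
  l_natural {a a' : Obj} (f : a ⟶ a') : tensorMap (𝟙 unit) f ≫ l a' = l a ≫ f
  ρ_natural {a a' : Obj} (f : a ⟶ a') : f ≫ ρ a' = ρ a ≫ tensorMap f (𝟙 unit)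
  pentagon (a b c d : Obj) :
    tensorMap (α a b c) (𝟙 d) ≫ α a (tensor b c) d ≫ tensorMap (𝟙 a) (α b c d) =
      α (tensor a b) c d ≫ α a b (tensor c d)
  α_l (a b : Obj) : α unit a b ≫ l (tensor a b) = tensorMap (l a) (𝟙 b)
  ρ_α (a b : Obj) : ρ (tensor a b) ≫ α a b unit = tensorMap (𝟙 a) (ρ b)
  ρ_α_l (a b : Obj) :
    tensorMap (ρ a) (𝟙 b) ≫ α a unit b ≫ tensorMap (𝟙 a) (l b) = 𝟙 (tensor a b)
  ρ_l : ρ unit ≫ l unit = 𝟙 unit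

namespace SkewMonCat

attribute [instance] SkewMonCat.cat

/-- Closedness: every `b, c` admit an object `[b, c]` and an evaluation `[b, c] ⊗ b ⟶ c` that
induces bijections `C(a, [b, c]) ≅ C(a ⊗ b, c)`. -/
def IsClosed (C : SkewMonCat.{v, u}) : Prop :=
  ∀ b c : C.Obj, ∃ (h : C.Obj) (e : C.tensor h b ⟶ c), ∀ a : C.Obj,
    Function.Bijective (fun f : a ⟶ h => C.tensorMap f (𝟙 b) ≫ e)

/-- (Lax) monoidal functors. -/
@[ext]
structure LaxFunctor (C D : SkewMonCat.{v, u}) extends C.Obj ⥤ D.Obj where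
  ε : D.unit ⟶ obj C.unit
  μ (a b : C.Obj) : D.tensor (obj a) (obj b) ⟶ obj (C.tensor a b)
  μ_natural {a a' b b' : C.Obj} (f : a ⟶ a') (g : b ⟶ b') :
    D.tensorMap (map f) (map g) ≫ μ a' b' = μ a b ≫ map (C.tensorMap f g)
  associativity (a b c : C.Obj) :
    D.tensorMap (μ a b) (𝟙 (obj c)) ≫ μ (C.tensor a b) c ≫ map (C.α a b c) =
      D.α (obj a) (obj b) (obj c) ≫ D.tensorMap (𝟙 (obj a)) (μ b c) ≫ μ a (C.tensor b c)
  left_unit (a : C.Obj) :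
    D.tensorMap ε (𝟙 (obj a)) ≫ μ C.unit a ≫ map (C.l a) = D.l (obj a)
  right_unit (a : C.Obj) :
    D.ρ (obj a) ≫ D.tensorMap (𝟙 (obj a)) ε ≫ μ a C.unit = map (C.ρ a)

/-- Monoidal natural transformations. -/
@[ext]
structure MonTrans {C D : SkewMonCat.{v, u}} (F G : LaxFunctor C D) where
  app (a : C.Obj) : F.obj a ⟶ G.obj a
  naturality {a b : C.Obj} (f : a ⟶ b) : F.map f ≫ app b = app a ≫ G.map f
  unit : F.ε ≫ app C.unit = G.ε
  tensor (a b : C.Obj) :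
    F.μ a b ≫ app (C.tensor a b) = D.tensorMap (app a) (app b) ≫ G.μ a b

/-- The identity monoidal functor. -/
@[simps! obj map ε μ]
def LaxFunctor.id (C : SkewMonCat.{v, u}) : LaxFunctor C C where
  toFunctor := 𝟭 C.Obj
  ε := 𝟙 _
  μ _ _ := 𝟙 _
  μ_natural f g := by simp
  associativity a b c := by simp [C.tensorMap_id]
  left_unit a := by simp [C.tensorMap_id]
  right_unit a := by simp [C.tensorMap_id]

theorem tensorMap_comp_id (C : SkewMonCat.{v, u}) {a a' a'' : C.Obj} (f : a ⟶ a')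
    (f' : a' ⟶ a'') (b : C.Obj) :
    C.tensorMap (f ≫ f') (𝟙 b) = C.tensorMap f (𝟙 b) ≫ C.tensorMap f' (𝟙 b) := by
  rw [← C.tensorMap_comp, Category.comp_id]

theorem tensorMap_id_comp (C : SkewMonCat.{v, u}) {a a' a'' : C.Obj} (f : a ⟶ a')
    (f' : a' ⟶ a'') (b : C.Obj) :
    C.tensorMap (𝟙 b) (f ≫ f') = C.tensorMap (𝟙 b) f ≫ C.tensorMap (𝟙 b) f' := by
  rw [← C.tensorMap_comp, Category.comp_id]

/-- Composition of monoidal functors. -/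
@[simps! obj map ε μ]
def LaxFunctor.comp {C D E : SkewMonCat.{v, u}} (F : LaxFunctor C D) (G : LaxFunctor D E) :
    LaxFunctor C E where
  toFunctor := F.toFunctor ⋙ G.toFunctor
  ε := G.ε ≫ G.map F.ε
  μ a b := G.μ (F.obj a) (F.obj b) ≫ G.map (F.μ a b)
  μ_natural f g := by
    have h := G.μ_natural (F.map f) (F.map g)
    dsimp
    rw [← Category.assoc, h, Category.assoc, Category.assoc, ← G.map_comp, ← G.map_comp,
      F.μ_natural]
  associativity a b c := by
    have h1 := G.μ_natural (F.μ a b) (𝟙 (F.obj c))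
    have h2 := G.μ_natural (𝟙 (F.obj a)) (F.μ b c)
    have h3 := G.associativity (F.obj a) (F.obj b) (F.obj c)
    rw [G.map_id] at h1 h2
    dsimp
    rw [tensorMap_comp_id, tensorMap_id_comp]
    simp only [Category.assoc]
    rw [reassoc_of% h1, reassoc_of% h2, ← G.map_comp, ← G.map_comp, ← G.map_comp,
      F.associativity, G.map_comp, reassoc_of% h3]
  left_unit a := by
    have h1 := G.μ_natural F.ε (𝟙 (F.obj a))
    rw [G.map_id] at h1
    dsimp
    rw [tensorMap_comp_id]
    simp only [Category.assoc]
    rw [reassoc_of% h1, ← G.map_comp, ← G.map_comp, F.left_unit, G.left_unit]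
  right_unit a := by
    have h1 := G.μ_natural (𝟙 (F.obj a)) F.ε
    rw [G.map_id] at h1
    dsimp
    rw [tensorMap_id_comp]
    simp only [Category.assoc]
    rw [reassoc_of% h1, ← G.map_comp, reassoc_of% (G.right_unit (F.obj a)), ← G.map_comp,
      F.right_unit]

/-- The identity monoidal transformation. -/
@[simps]
def MonTrans.id {C D : SkewMonCat.{v, u}} (F : LaxFunctor C D) : MonTrans F F where
  app a := 𝟙 (F.obj a)
  naturality f := by simp
  unit := by simp
  tensor a b := by simp [D.tensorMap_id]

/-- Vertical composition of monoidal transformations. -/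
@[simps]
def MonTrans.vcomp {C D : SkewMonCat.{v, u}} {F G H : LaxFunctor C D} (φ : MonTrans F G)
    (ψ : MonTrans G H) : MonTrans F H where
  app a := φ.app a ≫ ψ.app a
  naturality f := by
    rw [← Category.assoc, φ.naturality, Category.assoc, ψ.naturality, Category.assoc]
  unit := by rw [← Category.assoc, φ.unit, ψ.unit]
  tensor a b := by
    rw [D.tensorMap_comp, ← Category.assoc, φ.tensor, Category.assoc, ψ.tensor, Category.assoc]

/-- Whiskering of a monoidal transformation, with components `ψ (F a)`. -/
@[simps]
def MonTrans.whiskerLeft {C D E : SkewMonCat.{v, u}} (F : LaxFunctor C D) {G H : LaxFunctor D E}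
    (ψ : MonTrans G H) : MonTrans (F.comp G) (F.comp H) where
  app a := ψ.app (F.obj a)
  naturality f := ψ.naturality (F.map f)
  unit := by
    change (G.ε ≫ G.map F.ε) ≫ ψ.app (F.obj C.unit) = H.ε ≫ H.map F.ε
    rw [Category.assoc, ψ.naturality, ← Category.assoc, ψ.unit]
  tensor a b := by
    change (G.μ (F.obj a) (F.obj b) ≫ G.map (F.μ a b)) ≫ ψ.app (F.obj (C.tensor a b)) =
      E.tensorMap (ψ.app (F.obj a)) (ψ.app (F.obj b)) ≫ H.μ (F.obj a) (F.obj b) ≫ H.map (F.μ a b)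
    rw [Category.assoc, ψ.naturality, ← Category.assoc, ψ.tensor, Category.assoc]

/-- Whiskering of a monoidal transformation, with components `H (φ a)`. -/
@[simps]
def MonTrans.whiskerRight {C D E : SkewMonCat.{v, u}} {F G : LaxFunctor C D} (φ : MonTrans F G)
    (H : LaxFunctor D E) : MonTrans (F.comp H) (G.comp H) where
  app a := H.map (φ.app a)
  naturality {a b} f := by
    change H.map (F.map f) ≫ H.map (φ.app b) = H.map (φ.app a) ≫ H.map (G.map f)
    rw [← H.map_comp, ← H.map_comp, φ.naturality]
  unit := by
    change (H.ε ≫ H.map F.ε) ≫ H.map (φ.app C.unit) = H.ε ≫ H.map G.ε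
    rw [Category.assoc, ← H.map_comp, φ.unit]
  tensor a b := by
    change (H.μ (F.obj a) (F.obj b) ≫ H.map (F.μ a b)) ≫ H.map (φ.app (C.tensor a b)) =
      E.tensorMap (H.map (φ.app a)) (H.map (φ.app b)) ≫ H.μ (G.obj a) (G.obj b) ≫ H.map (G.μ a b)
    rw [Category.assoc, ← H.map_comp, φ.tensor, H.map_comp, ← Category.assoc, ← Category.assoc,
      H.μ_natural]

/-- The monoidal transformation given by an equality of monoidal functors. -/
def MonTrans.ofEq {C D : SkewMonCat.{v, u}} {F G : LaxFunctor C D} (h : F = G) :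
    MonTrans F G where
  app a := eqToHom (by rw [h])
  naturality f := by
    subst h
    simp
  unit := by
    subst h
    simp
  tensor a b := by
    subst h
    simp [D.tensorMap_id]

theorem LaxFunctor.ext' {C D : SkewMonCat.{v, u}} {F G : LaxFunctor C D}
    (h : F.toFunctor = G.toFunctor) (hε : HEq F.ε G.ε) (hμ : HEq F.μ G.μ) : F = G := by
  cases F
  cases G
  cases h
  cases hε
  cases hμ
  rfl

theorem LaxFunctor.id_comp {C D : SkewMonCat.{v, u}} (F : LaxFunctor C D) :
    (LaxFunctor.id C).comp F = F := by
  refine LaxFunctor.ext' rfl (heq_of_eq ?_) (heq_of_eq ?_)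
  · change F.ε ≫ F.map (𝟙 _) = F.ε
    simp
  · funext a b
    change F.μ a b ≫ F.map (𝟙 _) = F.μ a b
    simp

theorem LaxFunctor.comp_id {C D : SkewMonCat.{v, u}} (F : LaxFunctor C D) :
    F.comp (LaxFunctor.id D) = F := by
  refine LaxFunctor.ext' rfl (heq_of_eq ?_) (heq_of_eq ?_)
  · change 𝟙 _ ≫ F.ε = F.ε
    simp
  · funext a b
    change 𝟙 _ ≫ F.μ a b = F.μ a b
    simp

theorem LaxFunctor.comp_assoc {C D E E' : SkewMonCat.{v, u}} (F : LaxFunctor C D)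
    (G : LaxFunctor D E) (H : LaxFunctor E E') : (F.comp G).comp H = F.comp (G.comp H) := by
  refine LaxFunctor.ext' rfl (heq_of_eq ?_) (heq_of_eq ?_)
  · change H.ε ≫ H.map (G.ε ≫ G.map F.ε) = (H.ε ≫ H.map G.ε) ≫ H.map (G.map F.ε)
    simp
  · funext a b
    change H.μ _ _ ≫ H.map (G.μ _ _ ≫ G.map (F.μ a b)) =
      (H.μ _ _ ≫ H.map (G.μ _ _)) ≫ H.map (G.map (F.μ a b))
    simp

instance : CategoryStruct SkewMonCat.{v, u} where
  Hom C D := LaxFunctor C D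
  id C := LaxFunctor.id C
  comp F G := LaxFunctor.comp F G

instance homCat (C D : SkewMonCat.{v, u}) : Category (C ⟶ D) where
  Hom F G := MonTrans F G
  id F := MonTrans.id F
  comp φ ψ := MonTrans.vcomp φ ψ
  id_comp φ := by
    apply MonTrans.ext
    funext a
    exact Category.id_comp _
  comp_id φ := by
    apply MonTrans.ext
    funext a
    exact Category.comp_id _
  assoc φ ψ χ := by
    apply MonTrans.ext
    funext a
    exact Category.assoc _ _ _

/-- The invertible monoidal transformation given by an equality of monoidal functors. -/
def isoOfEq {C D : SkewMonCat.{v, u}} {F G : C ⟶ D} (h : F = G) : F ≅ G where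
  hom := MonTrans.ofEq h
  inv := MonTrans.ofEq h.symm
  hom_inv_id := by
    subst h
    apply MonTrans.ext
    funext a
    exact Category.id_comp _
  inv_hom_id := by
    subst h
    apply MonTrans.ext
    funext a
    exact Category.id_comp _

theorem isoOfEq_eq {C D : SkewMonCat.{v, u}} {F G : C ⟶ D} (h : F = G) :
    isoOfEq h = eqToIso h := by
  subst h
  rfl

/-- The 2-category of skew monoidal categories, (lax) monoidal functors and monoidal natural
transformations. -/
instance : Bicategory SkewMonCat.{v, u} where
  homCategory := homCat
  whiskerLeft F _ _ ψ := MonTrans.whiskerLeft F ψ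
  whiskerRight φ H := MonTrans.whiskerRight φ H
  associator F G H := isoOfEq (LaxFunctor.comp_assoc F G H)
  leftUnitor F := isoOfEq (LaxFunctor.id_comp F)
  rightUnitor F := isoOfEq (LaxFunctor.comp_id F)
  whiskerLeft_id _ _ := rfl
  whiskerLeft_comp _ _ _ _ _ _ := rfl
  id_whiskerLeft φ := by
    apply MonTrans.ext
    funext a
    exact (by simp : φ.app a = 𝟙 _ ≫ φ.app a ≫ 𝟙 _)
  comp_whiskerLeft F G _ _ φ := by
    apply MonTrans.ext
    funext a
    exact (by simp : φ.app (G.obj (F.obj a)) = 𝟙 _ ≫ φ.app (G.obj (F.obj a)) ≫ 𝟙 _)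
  id_whiskerRight F G := by
    apply MonTrans.ext
    funext a
    exact G.map_id _
  comp_whiskerRight φ ψ H := by
    apply MonTrans.ext
    funext a
    exact H.map_comp _ _
  whiskerRight_id φ := by
    apply MonTrans.ext
    funext a
    exact (by simp : φ.app a = 𝟙 _ ≫ φ.app a ≫ 𝟙 _)
  whiskerRight_comp φ G H := by
    apply MonTrans.ext
    funext a
    exact (by simp : H.map (G.map (φ.app a)) = 𝟙 _ ≫ H.map (G.map (φ.app a)) ≫ 𝟙 _)
  whisker_assoc F _ _ φ H := by
    apply MonTrans.ext
    funext a
    exact (by simp : H.map (φ.app (F.obj a)) = 𝟙 _ ≫ H.map (φ.app (F.obj a)) ≫ 𝟙 _)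
  whisker_exchange φ ψ := by
    apply MonTrans.ext
    funext a
    exact (ψ.naturality (φ.app a)).symm
  pentagon F G H K := by
    apply MonTrans.ext
    funext a
    have h : K.map (𝟙 (H.obj (G.obj (F.obj a)))) ≫ 𝟙 (K.obj (H.obj (G.obj (F.obj a)))) ≫ 𝟙 _ =
      𝟙 _ ≫ 𝟙 _ := by simp
    exact h
  triangle F G := by
    apply MonTrans.ext
    funext a
    have h : 𝟙 (G.obj (F.obj a)) ≫ 𝟙 (G.obj (F.obj a)) = G.map (𝟙 (F.obj a)) := by simp
    exact h

instance : Bicategory.Strict SkewMonCat.{v, u} where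
  id_comp := LaxFunctor.id_comp
  comp_id := LaxFunctor.comp_id
  assoc := LaxFunctor.comp_assoc
  leftUnitor_eqToIso _ := isoOfEq_eq _
  rightUnitor_eqToIso _ := isoOfEq_eq _
  associator_eqToIso _ _ _ := isoOfEq_eq _

end SkewMonCat

/-! ### Skew multicategories -/

/-- The objects `t` (tight) and `ℓ` (loose) of the categories `R n` of the operad of skew
multicategories. `R 0` only contains `ℓ`, and for `n > 0` the category `R n` is `t ⟶ ℓ`. -/
inductive SkewKind
  | tight
  | loose

/-- Operadic composition `x (x₁, …, xₙ)`: it is `t` if `x = x₁ = t`, and `ℓ` otherwise. -/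
def SkewKind.comp : SkewKind → List SkewKind → SkewKind
  | .tight, .tight :: _ => .tight
  | _, _ => .loose

/-- A multimap of unspecified kind, source and target. -/
@[ext]
structure Multimap {Obj : Type u} (Hom : SkewKind → List Obj → Obj → Type v) where
  kind : SkewKind
  src : List Obj
  tgt : Obj
  map : Hom kind src tgt

namespace Multimap

variable {Obj : Type u} {Hom : SkewKind → List Obj → Obj → Type v}

/-- A multimap, bundled with its kind, source and target. -/
abbrev of {x : SkewKind} {Γ : List Obj} {b : Obj} (f : Hom x Γ b) : Multimap Hom := ⟨x, Γ, b, f⟩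

theorem of_inj {x : SkewKind} {Γ : List Obj} {b : Obj} {f g : Hom x Γ b} (h : of f = of g) :
    f = g := by
  simpa [of] using h

/-- The action of the unique morphism `x ⟶ ℓ` of `R n` on a multimap of kind `x`. -/
def loosen (j : ∀ {Γ : List Obj} {b : Obj}, Hom .tight Γ b → Hom .loose Γ b) :
    Multimap Hom → Multimap Hom
  | ⟨.tight, _, _, f⟩ => of (j f)
  | ⟨.loose, _, _, f⟩ => of f

@[simp]
theorem loosen_src (j : ∀ {Γ : List Obj} {b : Obj}, Hom .tight Γ b → Hom .loose Γ b)
    (f : Multimap Hom) : (f.loosen j).src = f.src := by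
  rcases f with ⟨_ | _, _, _, _⟩ <;> rfl

@[simp]
theorem loosen_tgt (j : ∀ {Γ : List Obj} {b : Obj}, Hom .tight Γ b → Hom .loose Γ b)
    (f : Multimap Hom) : (f.loosen j).tgt = f.tgt := by
  rcases f with ⟨_ | _, _, _, _⟩ <;> rfl

end Multimap

set_option linter.checkUnivs false in
/-- The data of a skew multicategory: multihoms `Hom x (a₁, …, aₙ) b` for `x` in `R n`
(the value at `t` is empty if `n = 0`, since `R 0` only contains `ℓ`), the comparison functions `j`
induced by `t ⟶ ℓ`, identities, and substitution
`(g, f₁, …, fₙ) ↦ g (f₁, …, fₙ)`. -/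
structure SkewMulticatData where
  Obj : Type u
  Hom : SkewKind → List Obj → Obj → Type v
  tight_nil (b : Obj) : IsEmpty (Hom .tight [] b)
  j {Γ : List Obj} {b : Obj} : Hom .tight Γ b → Hom .loose Γ b
  one (a : Obj) : Hom .tight [a] a
  subst {x : SkewKind} {Δ : List Obj} {c : Obj} (g : Hom x Δ c) (fs : List (Multimap Hom))
    (h : fs.map Multimap.tgt = Δ) :
    Hom (x.comp (fs.map Multimap.kind)) (fs.flatMap Multimap.src) c

namespace SkewMulticatData

variable (A : SkewMulticatData.{v, u})

/-- The type of all multimaps. -/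
abbrev Map : Type (max u v) := Multimap A.Hom

/-- Identities, as bundled multimaps. -/
abbrev oneM (a : A.Obj) : A.Map := Multimap.of (A.one a)

/-- Substitution, for bundled multimaps. -/
abbrev substM (g : A.Map) (fs : List A.Map) (h : fs.map Multimap.tgt = g.src) : A.Map :=
  Multimap.of (A.subst g.map fs h)

/-- The loose multimap associated with any multimap. -/
abbrev loosen (f : A.Map) : A.Map := f.loosen A.j

end SkewMulticatData

set_option linter.checkUnivs false in
/-- A skew multicategory. Equations are stated between bundled multimaps, so that the (provable)
equalities between their kinds and between their sources are part of the statements. -/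
structure SkewMulticat extends SkewMulticatData.{v, u} where
  one_subst (f : toSkewMulticatData.Map) :
    toSkewMulticatData.substM (toSkewMulticatData.oneM f.tgt) [f] rfl = f
  subst_one (g : toSkewMulticatData.Map) (h : (g.src.map toSkewMulticatData.oneM).map
      Multimap.tgt = g.src) :
    toSkewMulticatData.substM g (g.src.map toSkewMulticatData.oneM) h = g
  /-- Associativity: `k (g₁, …, gₙ) (f₁₁, …, fₙₘ) = k (g₁ (f₁₁, …), …, gₙ (…, fₙₘ))`, where `ps`
  is the list of the pairs consisting of `gᵢ` and of the list `(fᵢ₁, …)`. -/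
  assoc (k : toSkewMulticatData.Map)
    (ps : List ((g : toSkewMulticatData.Map) ×
      {fs : List toSkewMulticatData.Map // fs.map Multimap.tgt = g.src}))
    (h₁ : (ps.map fun p => p.1).map Multimap.tgt = k.src)
    (h₂ : (ps.flatMap fun p => p.2.1).map Multimap.tgt =
      (ps.map fun p => p.1).flatMap Multimap.src)
    (h₃ : (ps.map fun p => toSkewMulticatData.substM p.1 p.2.1 p.2.2).map Multimap.tgt = k.src) :
    toSkewMulticatData.substM (toSkewMulticatData.substM k (ps.map fun p => p.1) h₁)
        (ps.flatMap fun p => p.2.1) h₂ =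
      toSkewMulticatData.substM k (ps.map fun p => toSkewMulticatData.substM p.1 p.2.1 p.2.2) h₃
  /-- Naturality of `g (f₁, …, fₙ)` in the kind of `g`. -/
  loosen_subst (g : toSkewMulticatData.Map) (fs : List toSkewMulticatData.Map)
    (h : fs.map Multimap.tgt = g.src) (h' : fs.map Multimap.tgt =
      (toSkewMulticatData.loosen g).src) :
    toSkewMulticatData.substM (toSkewMulticatData.loosen g) fs h' =
      toSkewMulticatData.loosen (toSkewMulticatData.substM g fs h)
  /-- Naturality of `g (f₁, …, fₙ)` in the kind of `f₁`. -/
  subst_loosen_head (g f : toSkewMulticatData.Map) (fs : List toSkewMulticatData.Map)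
    (h : (f :: fs).map Multimap.tgt = g.src)
    (h' : (toSkewMulticatData.loosen f :: fs).map Multimap.tgt = g.src) :
    toSkewMulticatData.substM g (toSkewMulticatData.loosen f :: fs) h' =
      toSkewMulticatData.loosen (toSkewMulticatData.substM g (f :: fs) h)
  /-- Naturality of `g (f₁, …, fₙ)` in the kind of `fᵢ` for `i > 1`; this kind has no influence on
  the kind of the composite. -/
  subst_loosen_tail (g f₁ f : toSkewMulticatData.Map) (fs fs' : List toSkewMulticatData.Map)
    (h : (f₁ :: (fs ++ f :: fs')).map Multimap.tgt = g.src)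
    (h' : (f₁ :: (fs ++ toSkewMulticatData.loosen f :: fs')).map Multimap.tgt = g.src) :
    toSkewMulticatData.substM g (f₁ :: (fs ++ toSkewMulticatData.loosen f :: fs')) h' =
      toSkewMulticatData.substM g (f₁ :: (fs ++ f :: fs')) h

namespace SkewMulticat

/-- A morphism of skew multicategories: an assignment on objects and a compatible assignment on
multimaps, preserving kinds, comparison functions, identities and substitution. -/
structure Functor (A B : SkewMulticat.{v, u}) where
  obj : A.Obj → B.Obj
  map : A.Map → B.Map
  map_kind (f : A.Map) : (map f).kind = f.kind
  map_src (f : A.Map) : (map f).src = f.src.map obj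
  map_tgt (f : A.Map) : (map f).tgt = obj f.tgt
  map_loosen (f : A.Map) : map (A.loosen f) = B.loosen (map f)
  map_one (a : A.Obj) : map (A.oneM a) = B.oneM (obj a)
  map_subst (g : A.Map) (fs : List A.Map) (h : fs.map Multimap.tgt = g.src)
    (h' : (fs.map map).map Multimap.tgt = (map g).src) :
    map (A.substM g fs h) = B.substM (map g) (fs.map map) h'

/-- The action of a morphism of skew multicategories on tight unary maps, that is, on the
morphisms of the underlying category. -/
def Functor.mapUnary {A B : SkewMulticat.{v, u}} (F : Functor A B) {a b : A.Obj}
    (f : A.Hom .tight [a] b) : B.Hom .tight [F.obj a] (F.obj b) :=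
  cast (by rw [F.map_kind, F.map_src, F.map_tgt]; rfl) (F.map (Multimap.of f)).map

/-- Composition in the underlying category. -/
def unaryComp (A : SkewMulticat.{v, u}) {a b c : A.Obj} (f : A.Hom .tight [a] b)
    (g : A.Hom .tight [b] c) : A.Hom .tight [a] c :=
  A.subst g [Multimap.of f] rfl

theorem of_unaryComp (A : SkewMulticat.{v, u}) {a b c : A.Obj} (f : A.Hom .tight [a] b)
    (g : A.Hom .tight [b] c) :
    Multimap.of (A.unaryComp f g) = A.substM (Multimap.of g) [Multimap.of f] rfl := rfl

theorem of_cast {A : SkewMulticat.{v, u}} (m : A.Map) {x : SkewKind} {Γ : List A.Obj} {b : A.Obj}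
    (hx : m.kind = x) (hΓ : m.src = Γ) (hb : m.tgt = b) (h : A.Hom m.kind m.src m.tgt =
      A.Hom x Γ b) : Multimap.of (cast h m.map) = m := by
  subst hx hΓ hb
  rfl

theorem Functor.of_mapUnary {A B : SkewMulticat.{v, u}} (F : Functor A B) {a b : A.Obj}
    (f : A.Hom .tight [a] b) : Multimap.of (F.mapUnary f) = F.map (Multimap.of f) :=
  of_cast _ (F.map_kind _) (F.map_src _) (F.map_tgt _) _

/-- A 2-cell between morphisms of skew multicategories: tight unary maps `φ_a : F a ⟶ G a`,
natural with respect to all multimaps: `φ_b (F f) = (G f) (φ_{a₁}, …, φ_{aₙ})`. -/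
@[ext]
structure Trans {A B : SkewMulticat.{v, u}} (F G : Functor A B) where
  app (a : A.Obj) : B.Hom .tight [F.obj a] (G.obj a)
  naturality (f : A.Map) (h : [F.map f].map Multimap.tgt = [F.obj f.tgt])
    (h' : (f.src.map fun a => (Multimap.of (app a) : B.Map)).map Multimap.tgt = (G.map f).src) :
    B.substM (Multimap.of (app f.tgt)) [F.map f] h =
      B.substM (G.map f) (f.src.map fun a => Multimap.of (app a)) h'

theorem substM_congr (A : SkewMulticat.{v, u}) {g g' : A.Map} {fs fs' : List A.Map}
    (hg : g = g') (hf : fs = fs') (h : fs.map Multimap.tgt = g.src)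
    (h' : fs'.map Multimap.tgt = g'.src) : A.substM g fs h = A.substM g' fs' h' := by
  subst hg hf
  rfl

theorem unaryComp_one (A : SkewMulticat.{v, u}) {a b : A.Obj} (f : A.Hom .tight [a] b) :
    A.unaryComp f (A.one b) = f :=
  Multimap.of_inj (A.one_subst (Multimap.of f))

theorem one_unaryComp (A : SkewMulticat.{v, u}) {a b : A.Obj} (f : A.Hom .tight [a] b) :
    A.unaryComp (A.one a) f = f :=
  Multimap.of_inj (A.subst_one (Multimap.of f) rfl)

theorem substM_unary_substM (A : SkewMulticat.{v, u}) {b c : A.Obj} (f : A.Hom .tight [b] c)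
    (g : A.Map) (fs : List A.Map) (h : fs.map Multimap.tgt = g.src)
    (h₁ : [A.substM g fs h].map Multimap.tgt = [b]) (h₂ : [g].map Multimap.tgt = [b])
    (h₃ : fs.map Multimap.tgt = (A.substM (Multimap.of f) [g] h₂).src) :
    A.substM (Multimap.of f) [A.substM g fs h] h₁ =
      A.substM (A.substM (Multimap.of f) [g] h₂) fs h₃ := by
  have := A.assoc (Multimap.of f) [⟨g, fs, h⟩] h₂ (by simpa using h) h₁
  refine Eq.trans this.symm ?_
  exact A.substM_congr rfl (by simp) _ _

theorem unaryComp_assoc (A : SkewMulticat.{v, u}) {a b c d : A.Obj} (f : A.Hom .tight [a] b)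
    (g : A.Hom .tight [b] c) (h : A.Hom .tight [c] d) :
    A.unaryComp (A.unaryComp f g) h = A.unaryComp f (A.unaryComp g h) :=
  Multimap.of_inj (A.substM_unary_substM h (Multimap.of g) [Multimap.of f] rfl rfl rfl rfl)

/-- Substituting unary maps twice. -/
theorem substM_unary_family (A : SkewMulticat.{v, u}) {X : Type u} (k : A.Map) (Γ : List X)
    (F G H : X → A.Obj) (φ : ∀ a, A.Hom .tight [F a] (G a)) (ψ : ∀ a, A.Hom .tight [G a] (H a))
    (h₁ : (Γ.map fun a => (Multimap.of (ψ a) : A.Map)).map Multimap.tgt = k.src)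
    (h₂ : (Γ.map fun a => (Multimap.of (φ a) : A.Map)).map Multimap.tgt =
      (A.substM k (Γ.map fun a => Multimap.of (ψ a)) h₁).src)
    (h₃ : (Γ.map fun a => (Multimap.of (A.unaryComp (φ a) (ψ a)) : A.Map)).map Multimap.tgt =
      k.src) :
    A.substM (A.substM k (Γ.map fun a => Multimap.of (ψ a)) h₁)
        (Γ.map fun a => Multimap.of (φ a)) h₂ =
      A.substM k (Γ.map fun a => Multimap.of (A.unaryComp (φ a) (ψ a))) h₃ := by
  have e : ∀ Δ : List X, (Δ.map fun a => (⟨Multimap.of (ψ a), [Multimap.of (φ a)], rfl⟩ :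
      (g : A.Map) × {fs : List A.Map // fs.map Multimap.tgt = g.src})).flatMap
        (fun p => p.2.1) = Δ.map fun a => Multimap.of (φ a) := by
    intro Δ
    induction Δ with
    | nil => rfl
    | cons a Δ ih => simp only [List.map_cons, List.flatMap_cons, ih]; rfl
  have e' : (Γ.map fun a => (⟨Multimap.of (ψ a), [Multimap.of (φ a)], rfl⟩ :
      (g : A.Map) × {fs : List A.Map // fs.map Multimap.tgt = g.src})).map (fun p => p.1) =
        Γ.map fun a => Multimap.of (ψ a) := by
    rw [List.map_map]
    rfl
  have e'' : (Γ.map fun a => (⟨Multimap.of (ψ a), [Multimap.of (φ a)], rfl⟩ :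
      (g : A.Map) × {fs : List A.Map // fs.map Multimap.tgt = g.src})).map
        (fun p => A.substM p.1 p.2.1 p.2.2) =
        Γ.map fun a => Multimap.of (A.unaryComp (φ a) (ψ a)) := by
    rw [List.map_map]
    rfl
  have := A.assoc k (Γ.map fun a => ⟨Multimap.of (ψ a), [Multimap.of (φ a)], rfl⟩)
    (by rw [e']; exact h₁) (by rw [e, e']; exact h₂) (by rw [e'']; exact h₃)
  rw [A.substM_congr rfl e''.symm h₃ (by rw [e'']; exact h₃), ← this]
  exact A.substM_congr (A.substM_congr rfl e'.symm _ _) (e Γ).symm _ _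

/-- The identity morphism. -/
@[simps]
def Functor.id (A : SkewMulticat.{v, u}) : Functor A A where
  obj a := a
  map f := f
  map_kind _ := rfl
  map_src _ := (List.map_id _).symm
  map_tgt _ := rfl
  map_loosen _ := rfl
  map_one _ := rfl
  map_subst _ _ _ _ := A.substM_congr rfl (List.map_id _).symm _ _

theorem Functor.map_tgt_list {A B : SkewMulticat.{v, u}} (F : Functor A B) {g : A.Map}
    {fs : List A.Map} (h : fs.map Multimap.tgt = g.src) :
    (fs.map F.map).map Multimap.tgt = (F.map g).src := by
  rw [F.map_src, ← h, List.map_map, List.map_map]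
  congr 1
  funext f
  exact F.map_tgt f

/-- Composition of morphisms. -/
@[simps]
def Functor.comp {A B C : SkewMulticat.{v, u}} (F : Functor A B) (G : Functor B C) :
    Functor A C where
  obj a := G.obj (F.obj a)
  map f := G.map (F.map f)
  map_kind f := by rw [G.map_kind, F.map_kind]
  map_src f := by rw [G.map_src, F.map_src, List.map_map]; rfl
  map_tgt f := by rw [G.map_tgt, F.map_tgt]
  map_loosen f := by rw [F.map_loosen, G.map_loosen]
  map_one a := by rw [F.map_one, G.map_one]
  map_subst g fs h h' := by
    rw [F.map_subst g fs h (F.map_tgt_list h),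
      G.map_subst _ _ _ (G.map_tgt_list (F.map_tgt_list h))]
    exact C.substM_congr rfl (by rw [List.map_map]; rfl) _ _

theorem Functor.mapUnary_one {A B : SkewMulticat.{v, u}} (F : Functor A B) (a : A.Obj) :
    F.mapUnary (A.one a) = B.one (F.obj a) :=
  Multimap.of_inj ((F.of_mapUnary _).trans (F.map_one a))

theorem Functor.mapUnary_comp {A B : SkewMulticat.{v, u}} (F : Functor A B) {a b c : A.Obj}
    (f : A.Hom .tight [a] b) (g : A.Hom .tight [b] c) :
    F.mapUnary (A.unaryComp f g) = B.unaryComp (F.mapUnary f) (F.mapUnary g) := by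
  apply Multimap.of_inj
  rw [F.of_mapUnary, of_unaryComp, of_unaryComp, F.map_subst _ _ _ (F.map_tgt_list rfl)]
  exact B.substM_congr (F.of_mapUnary g).symm (by simp [F.of_mapUnary f]) _ _

theorem Functor.mapUnary_mapUnary {A B C : SkewMulticat.{v, u}} (F : Functor A B)
    (G : Functor B C) {a b : A.Obj} (f : A.Hom .tight [a] b) :
    (F.comp G).mapUnary f = G.mapUnary (F.mapUnary f) := by
  exact Multimap.of_inj (((F.comp G).of_mapUnary f).trans
    ((congrArg G.map (F.of_mapUnary f).symm).trans (G.of_mapUnary _).symm))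

/-- The identity 2-cell. -/
@[simps]
def Trans.id {A B : SkewMulticat.{v, u}} (F : Functor A B) : Trans F F where
  app a := B.one (F.obj a)
  naturality f h h' := by
    have e : (f.src.map fun a => (Multimap.of (B.one (F.obj a)) : B.Map)) =
        (F.map f).src.map B.oneM := by
      rw [F.map_src, List.map_map]
      rfl
    rw [B.substM_congr rfl e h' (by rw [← e]; exact h'), B.subst_one]
    exact (B.substM_congr (by rw [F.map_tgt]) rfl _ rfl).trans (B.one_subst (F.map f))

/-- Vertical composition of 2-cells. -/
@[simps]
def Trans.vcomp {A B : SkewMulticat.{v, u}} {F G H : Functor A B} (φ : Trans F G)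
    (ψ : Trans G H) : Trans F H where
  app a := B.unaryComp (φ.app a) (ψ.app a)
  naturality f h h' := by
    have hF : [F.map f].map Multimap.tgt = [F.obj f.tgt] := by simp [F.map_tgt]
    have hG : [G.map f].map Multimap.tgt = [G.obj f.tgt] := by simp [G.map_tgt]
    have hφ : (f.src.map fun a => (Multimap.of (φ.app a) : B.Map)).map Multimap.tgt =
        (G.map f).src := by
      rw [G.map_src, List.map_map]
      rfl
    have hψ : (f.src.map fun a => (Multimap.of (ψ.app a) : B.Map)).map Multimap.tgt =
        (H.map f).src := by
      rw [H.map_src, List.map_map]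
      rfl
    have hs : (f.src.map fun a => (Multimap.of (φ.app a) : B.Map)).map Multimap.tgt =
        (B.substM (Multimap.of (ψ.app f.tgt)) [G.map f] hG).src :=
      hφ.trans (by simp)
    have e₁ : B.substM (Multimap.of (B.unaryComp (φ.app f.tgt) (ψ.app f.tgt))) [F.map f] h =
        B.substM (Multimap.of (ψ.app f.tgt))
          [B.substM (Multimap.of (φ.app f.tgt)) [F.map f] hF] rfl :=
      (B.substM_unary_substM (ψ.app f.tgt) (Multimap.of (φ.app f.tgt)) [F.map f] hF rfl rfl
        hF).symm
    have e₂ := φ.naturality f hF hφ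
    have e₃ : B.substM (Multimap.of (ψ.app f.tgt))
        [B.substM (G.map f) (f.src.map fun a => Multimap.of (φ.app a)) hφ] hG =
        B.substM (B.substM (Multimap.of (ψ.app f.tgt)) [G.map f] hG)
          (f.src.map fun a => Multimap.of (φ.app a)) hs :=
      B.substM_unary_substM (ψ.app f.tgt) (G.map f) _ hφ hG hG hs
    have e₄ := ψ.naturality f hG hψ
    have hs' : (f.src.map fun a => (Multimap.of (φ.app a) : B.Map)).map Multimap.tgt =
        (B.substM (H.map f) (f.src.map fun a => Multimap.of (ψ.app a)) hψ).src := by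
      rw [← e₄]
      exact hs
    rw [e₁, B.substM_congr (g := Multimap.of (ψ.app f.tgt)) rfl
      (congrArg (fun m => [m]) e₂) rfl hG, e₃,
      B.substM_congr e₄ rfl hs hs']
    exact B.substM_unary_family (H.map f) f.src F.obj G.obj H.obj φ.app ψ.app hψ hs' h'

/-- Whiskering of a 2-cell, with components `ψ (F a)`. -/
@[simps]
def Trans.whiskerLeft {A B C : SkewMulticat.{v, u}} (F : Functor A B) {G H : Functor B C}
    (ψ : Trans G H) : Trans (F.comp G) (F.comp H) where
  app a := ψ.app (F.obj a)
  naturality f h h' := by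
    have e : ((F.map f).src.map fun b => (Multimap.of (ψ.app b) : C.Map)) =
        f.src.map fun a => Multimap.of (ψ.app (F.obj a)) := by
      rw [F.map_src, List.map_map]
      rfl
    have hG : [G.map (F.map f)].map Multimap.tgt = [G.obj (F.map f).tgt] := by
      simp [G.map_tgt]
    have hH : ((F.map f).src.map fun b => (Multimap.of (ψ.app b) : C.Map)).map Multimap.tgt =
        (H.map (F.map f)).src := by
      rw [e]
      exact h'
    have := ψ.naturality (F.map f) hG hH
    refine (C.substM_congr (by rw [F.map_tgt]; rfl) rfl h hG).trans (this.trans ?_)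
    exact C.substM_congr rfl e _ _

/-- Whiskering of a 2-cell, with components `H (φ a)`. -/
@[simps]
def Trans.whiskerRight {A B C : SkewMulticat.{v, u}} {F G : Functor A B} (φ : Trans F G)
    (H : Functor B C) : Trans (F.comp H) (G.comp H) where
  app a := H.mapUnary (φ.app a)
  naturality f h h' := by
    have hF : [F.map f].map Multimap.tgt = [F.obj f.tgt] := by simp [F.map_tgt]
    have hφ : (f.src.map fun a => (Multimap.of (φ.app a) : B.Map)).map Multimap.tgt =
        (G.map f).src := by
      rw [G.map_src, List.map_map]
      rfl
    have e := congrArg H.map (φ.naturality f hF hφ)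
    rw [H.map_subst _ _ _ (H.map_tgt_list hF), H.map_subst _ _ _ (H.map_tgt_list hφ)] at e
    refine (C.substM_congr (H.of_mapUnary _) rfl h _).trans (e.trans ?_)
    refine C.substM_congr rfl ?_ _ _
    rw [List.map_map]
    congr 1
    funext a
    exact (H.of_mapUnary _).symm

/-- The 2-cell given by an equality of morphisms. -/
def Trans.ofEq {A B : SkewMulticat.{v, u}} {F G : Functor A B} (h : F = G) : Trans F G where
  app a := cast (by rw [h]) (B.one (F.obj a))
  naturality := by
    subst h
    exact (Trans.id F).naturality

instance : CategoryStruct SkewMulticat.{v, u} where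
  Hom A B := Functor A B
  id A := Functor.id A
  comp F G := Functor.comp F G

instance homCat (A B : SkewMulticat.{v, u}) : Category (A ⟶ B) where
  Hom F G := Trans F G
  id F := Trans.id F
  comp φ ψ := Trans.vcomp φ ψ
  id_comp φ := by
    apply Trans.ext
    funext a
    exact B.one_unaryComp _
  comp_id φ := by
    apply Trans.ext
    funext a
    exact B.unaryComp_one _
  assoc φ ψ χ := by
    apply Trans.ext
    funext a
    exact B.unaryComp_assoc _ _ _

/-- The invertible 2-cell given by an equality of morphisms. -/
def isoOfEq {A B : SkewMulticat.{v, u}} {F G : A ⟶ B} (h : F = G) : F ≅ G where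
  hom := Trans.ofEq h
  inv := Trans.ofEq h.symm
  hom_inv_id := by
    subst h
    apply Trans.ext
    funext a
    exact B.one_unaryComp _
  inv_hom_id := by
    subst h
    apply Trans.ext
    funext a
    exact B.one_unaryComp _

theorem isoOfEq_eq {A B : SkewMulticat.{v, u}} {F G : A ⟶ B} (h : F = G) :
    isoOfEq h = eqToIso h := by
  subst h
  rfl

theorem one_conj (A : SkewMulticat.{v, u}) {a b : A.Obj} (f : A.Hom .tight [a] b) :
    f = A.unaryComp (A.one a) (A.unaryComp f (A.one b)) := by
  rw [A.unaryComp_one, A.one_unaryComp]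

/-- The 2-category of skew multicategories. -/
instance : Bicategory SkewMulticat.{v, u} where
  homCategory := homCat
  whiskerLeft F _ _ ψ := Trans.whiskerLeft F ψ
  whiskerRight φ H := Trans.whiskerRight φ H
  associator {A _ _ D} F G H := isoOfEq (F := (F ≫ G) ≫ H) (G := F ≫ G ≫ H) rfl
  leftUnitor {A _} F := isoOfEq (F := 𝟙 A ≫ F) (G := F) rfl
  rightUnitor {_ B} F := isoOfEq (F := F ≫ 𝟙 B) (G := F) rfl
  whiskerLeft_id _ _ := rfl
  whiskerLeft_comp _ _ _ _ _ _ := rfl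
  id_whiskerLeft {_ B} _ _ φ := by
    apply Trans.ext
    funext a
    exact B.one_conj (φ.app a)
  comp_whiskerLeft {_ _ _ D} F G _ _ φ := by
    apply Trans.ext
    funext a
    exact D.one_conj (φ.app (G.obj (F.obj a)))
  id_whiskerRight F G := by
    apply Trans.ext
    funext a
    exact G.mapUnary_one _
  comp_whiskerRight φ ψ H := by
    apply Trans.ext
    funext a
    exact H.mapUnary_comp _ _
  whiskerRight_id {_ B} _ _ φ := by
    apply Trans.ext
    funext a
    exact B.one_conj (φ.app a)
  whiskerRight_comp {_ _ _ D _ _} φ G H := by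
    apply Trans.ext
    funext a
    refine Eq.trans ?_ (D.one_conj (H.mapUnary (G.mapUnary (φ.app a))))
    exact Functor.mapUnary_mapUnary G H (φ.app a)
  whisker_assoc {_ _ _ D} F _ _ φ H := by
    apply Trans.ext
    funext a
    exact D.one_conj (H.mapUnary (φ.app (F.obj a)))
  whisker_exchange {_ _ C _ _ H K} φ ψ := by
    apply Trans.ext
    funext a
    apply Multimap.of_inj
    have h := ψ.naturality (Multimap.of (φ.app a)) (by simp [H.map_tgt]) (by simp [K.map_src])
    refine Eq.trans ?_ (h.symm.trans ?_)
    · exact C.substM_congr (K.of_mapUnary _) rfl _ _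
    · exact C.substM_congr rfl (by rw [← H.of_mapUnary]; rfl) _ _
  pentagon {_ _ _ D E} F G H K := by
    apply Trans.ext
    funext a
    have h : E.unaryComp (K.mapUnary (D.one _)) (E.unaryComp (E.one _) (E.one _)) =
        E.unaryComp (E.one (K.obj (H.obj (G.obj (F.obj a))))) (E.one _) := by
      rw [K.mapUnary_one, E.unaryComp_one, E.unaryComp_one]
    exact h
  triangle {_ B C} F G := by
    apply Trans.ext
    funext a
    have h : C.unaryComp (C.one _) (C.one (G.obj (F.obj a))) =
        G.mapUnary (B.one (F.obj a)) := by
      rw [G.mapUnary_one, C.unaryComp_one]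
    exact h

instance : Bicategory.Strict SkewMulticat.{v, u} where
  id_comp _ := rfl
  comp_id _ := rfl
  assoc _ _ _ := rfl
  leftUnitor_eqToIso _ := isoOfEq_eq _
  rightUnitor_eqToIso _ := isoOfEq_eq _
  associator_eqToIso _ _ _ := isoOfEq_eq _

/-- A universal multimap `θ ∈ A_x(a₁, …, aₙ; m)`: substitution induces bijections
`A_t(m; b) ≅ A_x(a₁, …, aₙ; b)`. -/
def IsUniversal (A : SkewMulticat.{v, u}) (θ : A.Map) : Prop :=
  ∀ k : A.Map, k.kind = θ.kind → k.src = θ.src →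
    ∃! f : A.Hom .tight [θ.tgt] k.tgt, A.substM (Multimap.of f) [θ] rfl = k

theorem tgt_cons_one (A : SkewMulticat.{v, u}) (θ : A.Map) (Δ : List A.Obj) :
    (θ :: Δ.map A.oneM).map Multimap.tgt = θ.tgt :: Δ := by
  rw [List.map_cons, List.map_map]
  exact congrArg _ (List.map_id _)

/-- A left universal multimap `θ ∈ A_x(a₁, …, aₙ; m)`: substitution in the first place induces
bijections `A_t(m, b₁, …, bₖ; c) ≅ A_x(a₁, …, aₙ, b₁, …, bₖ; c)`. -/
def IsLeftUniversal (A : SkewMulticat.{v, u}) (θ : A.Map) : Prop :=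
  ∀ (Δ : List A.Obj) (k : A.Map), k.kind = θ.kind → k.src = θ.src ++ Δ →
    ∃! f : A.Hom .tight (θ.tgt :: Δ) k.tgt,
      A.substM (Multimap.of f) (θ :: Δ.map A.oneM) (A.tgt_cons_one θ Δ) = k

/-- Weak representability: there are universal multimaps of each kind `x` in `R n` with each source
of length `n`. -/
def IsWeaklyRepresentable (A : SkewMulticat.{v, u}) : Prop :=
  ∀ (x : SkewKind) (Γ : List A.Obj), (x = .tight → Γ ≠ []) →
    ∃ (m : A.Obj) (θ : A.Hom x Γ m), A.IsUniversal (Multimap.of θ)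

/-- Left representability. -/
def IsLeftRepresentable (A : SkewMulticat.{v, u}) : Prop :=
  A.IsWeaklyRepresentable ∧ ∀ θ : A.Map, A.IsUniversal θ → A.IsLeftUniversal θ

/-- Closedness: every `b, c` admit an object `[b, c]` and a tight multimap
`e ∈ A_t([b, c], b; c)` such that substitution in the first place of `e` induces bijections
`A_x(a₁, …, aₙ; [b, c]) ≅ A_x(a₁, …, aₙ, b; c)` for all `x` in `R n`. -/
def IsClosed (A : SkewMulticat.{v, u}) : Prop :=
  ∀ b c : A.Obj, ∃ (h : A.Obj) (e : A.Hom .tight [h, b] c),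
    ∀ (x : SkewKind) (Γ : List A.Obj), (x = .tight → Γ ≠ []) → ∀ k : A.Hom x (Γ ++ [b]) c,
      ∃! f : A.Hom x Γ h,
        A.substM (Multimap.of e) [Multimap.of f, A.oneM b] rfl = Multimap.of k

end SkewMulticat

/-! ### The correspondence between skew monoidal categories and skew multicategories -/

/-- Data exhibiting a skew monoidal category `C` as the one associated with a (left representable)
skew multicategory `A`: the category `C` is the underlying category of `A`, the unit `i` is a
nullary map classifier with universal multimap `θ₀`, the tensor products `a ⊗ b` are tight binary
map classifiers with universal multimaps `θ a b`, and the remaining structure of `C` is the one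
induced by substitution in `A`. -/
structure Association (C : SkewMonCat.{v, u}) (A : SkewMulticat.{v, u}) where
  obj : C.Obj ≃ A.Obj
  hom {a b : C.Obj} : (a ⟶ b) ≃ A.Hom .tight [obj a] (obj b)
  hom_id (a : C.Obj) : hom (𝟙 a) = A.one (obj a)
  hom_comp {a b c : C.Obj} (f : a ⟶ b) (g : b ⟶ c) : hom (f ≫ g) = A.unaryComp (hom f) (hom g)
  θ₀ : A.Hom .loose [] (obj C.unit)
  θ₀_universal : A.IsUniversal (Multimap.of θ₀)
  θ (a b : C.Obj) : A.Hom .tight [obj a, obj b] (obj (C.tensor a b))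
  θ_universal (a b : C.Obj) : A.IsUniversal (Multimap.of (θ a b))
  /-- `(f ⊗ g) (θ a b) = θ a' b' (f, g)` -/
  hom_tensorMap {a a' b b' : C.Obj} (f : a ⟶ a') (g : b ⟶ b') :
    A.substM (Multimap.of (hom (C.tensorMap f g))) [Multimap.of (θ a b)] rfl =
      A.substM (Multimap.of (θ a' b')) [Multimap.of (hom f), Multimap.of (hom g)] rfl
  /-- `α (θ (a ⊗ b) c (θ a b, 1)) = θ a (b ⊗ c) (1, θ b c)` -/
  hom_α (a b c : C.Obj) :
    A.substM (Multimap.of (hom (C.α a b c)))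
        [A.substM (Multimap.of (θ (C.tensor a b) c))
          [Multimap.of (θ a b), A.oneM (obj c)] rfl] rfl =
      A.substM (Multimap.of (θ a (C.tensor b c))) [A.oneM (obj a), Multimap.of (θ b c)] rfl
  /-- `l (θ i a (θ₀, 1)) = j 1`, where `j` is the comparison from tight to loose maps -/
  hom_l (a : C.Obj) :
    A.substM (Multimap.of (hom (C.l a)))
        [A.substM (Multimap.of (θ C.unit a)) [Multimap.of θ₀, A.oneM (obj a)] rfl] rfl =
      A.loosen (A.oneM (obj a))
  /-- `ρ = θ a i (1, θ₀)` -/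
  hom_ρ (a : C.Obj) :
    Multimap.of (hom (C.ρ a)) =
      A.substM (Multimap.of (θ a C.unit)) [A.oneM (obj a), Multimap.of θ₀] rfl

/-- A 2-functor from skew monoidal categories to skew multicategories is canonical if it sends each
`C` to a skew multicategory with which `C` is associated, a monoidal functor `F` to the morphism
that acts as `F` on objects and on unary tight maps and whose action on the universal multimaps is
given by the monoidal structure of `F`, and a monoidal transformation to the 2-cell with the same
components. -/
def IsCanonical (Φ : StrictPseudofunctor SkewMonCat.{v, u} SkewMulticat.{v, u}) : Prop :=
  ∃ κ : ∀ C : SkewMonCat.{v, u}, Association C (Φ.obj C),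
    (∀ (C D : SkewMonCat.{v, u}) (F : C ⟶ D),
      (∀ a : C.Obj, (Φ.map F).obj ((κ C).obj a) = (κ D).obj (F.obj a)) ∧
      (∀ (a b : C.Obj) (f : a ⟶ b),
        (Φ.map F).map (Multimap.of ((κ C).hom f)) = Multimap.of ((κ D).hom (F.map f))) ∧
      (Φ.map F).map (Multimap.of (κ C).θ₀) =
        (Φ.obj D).substM (Multimap.of ((κ D).hom F.ε)) [Multimap.of (κ D).θ₀] rfl ∧
      (∀ a b : C.Obj, (Φ.map F).map (Multimap.of ((κ C).θ a b)) =
        (Φ.obj D).substM (Multimap.of ((κ D).hom (F.μ a b)))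
          [Multimap.of ((κ D).θ (F.obj a) (F.obj b))] rfl)) ∧
    ∀ (C D : SkewMonCat.{v, u}) (F G : C ⟶ D) (φ : F ⟶ G) (a : C.Obj),
      (Multimap.of ((Φ.map₂ φ).app ((κ C).obj a)) : (Φ.obj D).Map) =
        Multimap.of ((κ D).hom (φ.app a))

/-! A multimap of `C.multicat` with source `a₁, …, aₙ` is a morphism out of a left bracketed
product, `(a₁ ⊗ a₂) ⊗ ⋯ ⊗ aₙ` if it is tight and `(i ⊗ a₁) ⊗ ⋯ ⊗ aₙ` if it is loose; `l` on the
first factor turns tight maps into loose ones. Substitution in a place other than the first must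
rebracket `x ⊗ b₁ ⊗ ⋯ ⊗ bₘ` as `x ⊗ (b₁ ⊗ ⋯ ⊗ bₘ)`, which iterated `α` does, after an application of
`ρ` if the inserted multimap is loose. So the directions of `α`, `l`, `ρ` are the ones needed. The
axioms `pentagon` and `ρ_α` make the action of multimaps compatible with `α` (`act_α`), which yields
associativity (`act_msubst`, `mact_assoc`). The axioms `α_l`, `ρ_l` and `ρ_α_l` yield naturality in
the kinds (`pre_l`, `mact_lo`, `pre_lo`).

Every multimap of `C.multicat` is generated under substitution by morphisms and the universal
multimaps `θ₀`, `θ a b` (`SkewRep.map_induction`, `rep_map`). Hence morphisms and 2-cells out of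
`C.multicat` are determined on generators. Conversely, values on generators that satisfy the
equations of a `SkewRep` extend to all multimaps (`SkewRep.functor`). With values in `D.multicat`,
these equations are the axioms of a lax monoidal functor, and naturality on generators is the
definition of a monoidal transformation. The 2-functor is therefore strictly bijective on 1-cells
and on 2-cells.

A multimap of `C.multicat` is universal exactly when its underlying morphism is invertible, and
tensoring preserves invertibility, so universal multimaps are left universal. Conversely, in a left
representable `A` left universality makes composites of universal multimaps universal
(`IsUniversal.comp`), so maps out of the bracketed tensor products in the axioms can be constructed
and compared on universal multimaps; this gives an associated skew monoidal category. For every `C`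
associated with `A`, the extension `C.multicat ⟶ A` is bijective because the canonical multimaps
`univ` are universal. A 2-functor that is bijective on hom-categories and surjective up to
isomorphism has an inverse by conjugation (`EquivData`).

For closedness, the evaluations in `A` and in `C` correspond under the universal multimap `θ h b`.
Closedness of `C` is the case of a single tight argument, and a universal multimap reduces an
arbitrary list of arguments to that case. -/

namespace SkewMonCat

variable (C : SkewMonCat.{v, u})

/-! ### Left bracketed tensor products -/

/-- The left bracketed tensor product `((x ⊗ a₁) ⊗ a₂) ⊗ ⋯ ⊗ aₙ`. -/
@[reducible]
def fold : C.Obj → List C.Obj → C.Obj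
  | x, [] => x
  | x, a :: Γ => fold (C.tensor x a) Γ

/-- Functoriality of `fold` in its first argument. -/
def foldMap : {x y : C.Obj} → (x ⟶ y) → (Γ : List C.Obj) → (C.fold x Γ ⟶ C.fold y Γ)
  | _, _, p, [] => p
  | _, _, p, a :: Γ => foldMap (C.tensorMap p (𝟙 a)) Γ

variable {C}

@[simp]
theorem foldMap_id (x : C.Obj) (Γ : List C.Obj) : C.foldMap (𝟙 x) Γ = 𝟙 (C.fold x Γ) := by
  induction Γ generalizing x with
  | nil => rfl
  | cons a Γ ih =>
    rw [foldMap, C.tensorMap_id]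
    exact ih _

theorem foldMap_comp {x y z : C.Obj} (p : x ⟶ y) (q : y ⟶ z) (Γ : List C.Obj) :
    C.foldMap (p ≫ q) Γ = C.foldMap p Γ ≫ C.foldMap q Γ := by
  induction Γ generalizing x y z with
  | nil => rfl
  | cons a Γ ih =>
    rw [foldMap, C.tensorMap_comp_id]
    exact ih _ _

theorem tensorMap_split {a a' b b' : C.Obj} (f : a ⟶ a') (g : b ⟶ b') :
    C.tensorMap f (𝟙 b) ≫ C.tensorMap (𝟙 a') g = C.tensorMap f g := by
  simp [← C.tensorMap_comp]

theorem tensorMap_split' {a a' b b' : C.Obj} (f : a ⟶ a') (g : b ⟶ b') :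
    C.tensorMap (𝟙 a) g ≫ C.tensorMap f (𝟙 b') = C.tensorMap f g := by
  simp [← C.tensorMap_comp]

variable (C) in
/-- The canonical map `(x ⊗ y) ⊗ a₁ ⊗ ⋯ ⊗ aₙ ⟶ x ⊗ (y ⊗ a₁ ⊗ ⋯ ⊗ aₙ)`. -/
def lin : (x y : C.Obj) → (Γ : List C.Obj) →
    (C.fold (C.tensor x y) Γ ⟶ C.tensor x (C.fold y Γ))
  | _, _, [] => 𝟙 _
  | x, y, a :: Γ => C.foldMap (C.α x y a) Γ ≫ lin x (C.tensor y a) Γ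

theorem lin_natural {x x' y y' : C.Obj} (p : x ⟶ x') (q : y ⟶ y') (Γ : List C.Obj) :
    C.foldMap (C.tensorMap p q) Γ ≫ C.lin x' y' Γ =
      C.lin x y Γ ≫ C.tensorMap p (C.foldMap q Γ) := by
  induction Γ generalizing y y' with
  | nil => simp [foldMap, lin, fold]
  | cons a Γ ih =>
    simp only [foldMap, lin, fold, Category.assoc]
    rw [← ih, ← Category.assoc, ← Category.assoc, ← foldMap_comp, ← foldMap_comp, C.α_natural]

/-- This is `α_l` iterated: each associator in `lin` is absorbed by the left unit map that follows
it. -/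
theorem lin_l (y : C.Obj) (Γ : List C.Obj) :
    C.lin C.unit y Γ ≫ C.l (C.fold y Γ) = C.foldMap (C.l y) Γ := by
  induction Γ generalizing y with
  | nil => simp [foldMap, lin, fold]
  | cons a Γ ih =>
    simp only [foldMap, lin, fold, Category.assoc]
    rw [ih, ← foldMap_comp, C.α_l]

/-- The iterated pentagon: one use of `pentagon` for each entry of `Γ`. -/
theorem lin_α (x y z : C.Obj) (Γ : List C.Obj) :
    C.lin (C.tensor x y) z Γ ≫ C.α x y (C.fold z Γ) =
      C.foldMap (C.α x y z) Γ ≫ C.lin x (C.tensor y z) Γ ≫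
        C.tensorMap (𝟙 x) (C.lin y z Γ) := by
  induction Γ generalizing z with
  | nil => simp [foldMap, lin, fold, C.tensorMap_id]
  | cons a Γ ih =>
    simp only [foldMap, lin, fold, Category.assoc]
    rw [ih, C.tensorMap_id_comp, reassoc_of% (C.lin_natural (𝟙 x) (C.α y z a) Γ).symm]
    simp only [← Category.assoc, ← foldMap_comp]
    simp only [Category.assoc, C.pentagon]

variable (C) in
/-- The source, as an object, of multimaps of kind `k` and source `Γ`. -/
@[reducible]
def st : SkewKind → List C.Obj → C.Obj
  | .loose, Γ => C.fold C.unit Γ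
  -- No multimap has this kind and source. The value `unit` lets the lemmas on `pre` and `lo` hold
  -- without a side condition.
  | .tight, [] => C.unit
  | .tight, a :: Γ => C.fold a Γ

variable (C) in
/-- The canonical map `x ⊗ a₁ ⊗ ⋯ ⊗ aₙ ⟶ x ⊗ st k (a₁, …, aₙ)`. -/
def pre : (k : SkewKind) → (Γ : List C.Obj) → (x : C.Obj) →
    (C.fold x Γ ⟶ C.tensor x (C.st k Γ))
  | .loose, Γ, x => C.foldMap (C.ρ x) Γ ≫ C.lin x C.unit Γ
  | .tight, [], x => C.ρ x
  | .tight, a :: Γ, x => C.lin x a Γ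

theorem pre_natural (k : SkewKind) (Γ : List C.Obj) {x y : C.Obj} (p : x ⟶ y) :
    C.foldMap p Γ ≫ C.pre k Γ y = C.pre k Γ x ≫ C.tensorMap p (𝟙 _) := by
  rcases k with _ | _
  · rcases Γ with _ | ⟨a, Γ⟩
    · exact C.ρ_natural p
    · have := C.lin_natural p (𝟙 a) Γ
      rwa [foldMap_id] at this
  · have := C.lin_natural p (𝟙 C.unit) Γ
    rw [foldMap_id] at this
    simp only [pre, st, Category.assoc]
    rw [← this, ← Category.assoc, ← foldMap_comp, C.ρ_natural, foldMap_comp, Category.assoc]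

/-- For a nonempty tight block this is `lin_α`. A loose block also starts with a unit inserted by
`ρ`, and `ρ_α` moves that insertion inside the bracket. -/
theorem pre_α (k : SkewKind) (Γ : List C.Obj) (x y : C.Obj) :
    C.pre k Γ (C.tensor x y) ≫ C.α x y (C.st k Γ) =
      C.lin x y Γ ≫ C.tensorMap (𝟙 x) (C.pre k Γ y) := by
  rcases k with _ | _
  · rcases Γ with _ | ⟨a, Γ⟩
    · simpa [pre, lin, st, fold] using C.ρ_α x y
    · exact (C.lin_α x y a Γ).trans (Category.assoc _ _ _).symm
  · simp only [pre, st, Category.assoc, C.tensorMap_id_comp]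
    rw [C.lin_α, ← reassoc_of% (C.lin_natural (𝟙 x) (C.ρ y) Γ)]
    simp only [← Category.assoc, ← foldMap_comp, C.ρ_α]

variable (C) in
/-- The comparison between the sources of loose multimaps and of multimaps of kind `k`. -/
def lo : (k : SkewKind) → (Γ : List C.Obj) → (C.fold C.unit Γ ⟶ C.st k Γ)
  | .loose, _ => 𝟙 _
  | .tight, [] => 𝟙 _
  | .tight, a :: Γ => C.foldMap (C.l a) Γ

/-- The only place where `ρ_l` is needed: on a loose block, the unit that `ρ` inserts is removed
again by `l`. It expresses `lo` through `pre`, so that properties of `lo` follow from those of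
`pre`. -/
theorem pre_l (k : SkewKind) (Γ : List C.Obj) :
    C.pre k Γ C.unit ≫ C.l (C.st k Γ) = C.lo k Γ := by
  rcases k with _ | _
  · rcases Γ with _ | ⟨a, Γ⟩
    · exact C.ρ_l
    · exact C.lin_l a Γ
  · simp only [pre, lo, st, Category.assoc]
    rw [C.lin_l, ← foldMap_comp, C.ρ_l, foldMap_id]

/-- The triangle axiom `ρ_α_l` enters here: a unit inserted between `x` and the block and then
deleted leaves no trace. This is why loosening an argument in a place other than the first has no
effect. -/
theorem pre_lo (k : SkewKind) (Γ : List C.Obj) (x : C.Obj) :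
    C.pre .loose Γ x ≫ C.tensorMap (𝟙 x) (C.lo k Γ) = C.pre k Γ x := by
  rcases k with _ | _
  · rcases Γ with _ | ⟨a, Γ⟩
    · simp [pre, lo, lin, st, foldMap, fold, C.tensorMap_id]
    · simp only [pre, lo, st, fold, foldMap, lin, Category.assoc]
      rw [← C.lin_natural]
      simp only [← Category.assoc, ← foldMap_comp]
      simp only [Category.assoc, C.ρ_α_l, foldMap_id, Category.id_comp]
  · simp only [lo, st, C.tensorMap_id]
    exact Category.comp_id _

/-! ### Transport along equalities of lists -/

/-- For variable lists this equality of objects is not definitional, so equations involving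
concatenated sources are heterogeneous or carry an `eqToHom`. -/
theorem fold_append (x : C.Obj) (Γ Δ : List C.Obj) :
    C.fold x (Γ ++ Δ) = C.fold (C.fold x Γ) Δ := by
  induction Γ generalizing x with
  | nil => rfl
  | cons a Γ ih => exact ih _

theorem foldMap_append {x y : C.Obj} (p : x ⟶ y) (Γ Δ : List C.Obj) :
    C.foldMap p (Γ ++ Δ) ≍ C.foldMap (C.foldMap p Γ) Δ := by
  induction Γ generalizing x y with
  | nil => rfl
  | cons a Γ ih => exact ih _

theorem foldMap_heq {x y x' y' : C.Obj} {p : x ⟶ y} {p' : x' ⟶ y'} {Γ Γ' : List C.Obj}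
    (hx : x = x') (hy : y = y') (hp : p ≍ p') (hΓ : Γ = Γ') :
    C.foldMap p Γ ≍ C.foldMap p' Γ' := by
  subst hx hy hp hΓ
  rfl

theorem lin_append (x y : C.Obj) (Γ Δ : List C.Obj) :
    C.lin x y (Γ ++ Δ) ≍ C.foldMap (C.lin x y Γ) Δ ≫ C.lin x (C.fold y Γ) Δ := by
  induction Γ generalizing y with
  | nil => simp [lin, fold]
  | cons a Γ ih =>
    have e : C.foldMap (C.lin x y (a :: Γ)) Δ =
        C.foldMap (C.foldMap (C.α x y a) Γ) Δ ≫ C.foldMap (C.lin x (C.tensor y a) Γ) Δ :=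
      foldMap_comp _ _ _
    rw [e, Category.assoc]
    exact heq_comp (fold_append _ _ _) (fold_append _ _ _)
      (congrArg (C.tensor x) (fold_append (C.tensor y a) Γ Δ)) (foldMap_append _ _ _) (ih _)

end SkewMonCat

/-! ### Composition of kinds -/

theorem SkewKind.comp_loose (ks : List SkewKind) : SkewKind.comp .loose ks = .loose := rfl

theorem SkewKind.comp_tight_cons (k : SkewKind) (ks : List SkewKind) :
    SkewKind.comp .tight (k :: ks) = k := by
  cases k <;> rfl

/-- The hypothesis excludes tight nullary arguments. With one of them in the first place, the first
kind of the flattened list would come from a later argument and the two sides could differ. -/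
theorem SkewKind.comp_assoc (x : SkewKind) (ks : List (SkewKind × List SkewKind))
    (h : ∀ p ∈ ks, p.1 = .tight → p.2 ≠ []) :
    (x.comp (ks.map Prod.fst)).comp (ks.flatMap Prod.snd) =
      x.comp (ks.map fun p => p.1.comp p.2) := by
  rcases x with _ | _
  · rcases ks with _ | ⟨⟨k, l⟩, ks⟩
    · rfl
    · simp only [List.map_cons, comp_tight_cons, List.flatMap_cons]
      rcases k with _ | _
      · rcases l with _ | ⟨k', l⟩
        · exact absurd rfl (h _ (List.mem_cons_self ..) rfl)
        · simp [comp_tight_cons]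
      · rfl
  · rfl

/-! ### Action of multimaps on left bracketed tensor products -/

namespace SkewMonCat

variable (C : SkewMonCat.{v, u})

/-- Multimaps in a skew monoidal category. -/
abbrev MHom (k : SkewKind) (Γ : List C.Obj) (b : C.Obj) : Type v :=
  {_f : C.st k Γ ⟶ b // k = .tight → Γ ≠ []}

/-- Multimaps in a skew monoidal category, of unspecified kind, source and target. -/
abbrev MMap : Type (max u v) := Multimap C.MHom

variable {C}

/-- Reduces an equation of bundled multimaps to a heterogeneous equation of morphisms in `C`; the
exclusion of tight nullary maps is a proposition and plays no role. -/
theorem mmap_ext {f g : C.MMap} (hk : f.kind = g.kind) (hs : f.src = g.src) (ht : f.tgt = g.tgt)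
    (h : f.map.1 ≍ g.map.1) : f = g := by
  rcases f with ⟨k, Γ, b, f, hf⟩
  rcases g with ⟨k', Γ', b', g, hg⟩
  dsimp at hk hs ht
  subst hk hs ht
  have : f = g := eq_of_heq h
  subst this
  rfl

theorem st_append (k : SkewKind) (Γ Δ : List C.Obj) (h : k = .tight → Γ ≠ []) :
    C.st k (Γ ++ Δ) = C.fold (C.st k Γ) Δ := by
  rcases k with _ | _
  · rcases Γ with _ | ⟨a, Γ⟩
    · exact absurd rfl (h rfl)
    · exact fold_append _ _ _
  · exact fold_append _ _ _

@[simp]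
theorem tensorMap_eqToHom (x : C.Obj) {y z : C.Obj} (h : y = z) :
    C.tensorMap (𝟙 x) (eqToHom h) = eqToHom (congrArg (C.tensor x) h) := by
  subst h
  exact C.tensorMap_id _ _

theorem foldMap_append_comp {x y : C.Obj} (p : x ⟶ y) (Γ Δ : List C.Obj) :
    C.foldMap p (Γ ++ Δ) ≫ eqToHom (fold_append _ _ _) =
      eqToHom (fold_append _ _ _) ≫ C.foldMap (C.foldMap p Γ) Δ := by
  apply eq_of_heq
  rw [heq_eqToHom_comp_iff, comp_eqToHom_heq_iff]
  exact foldMap_append p Γ Δ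

theorem lin_append_comp (x y : C.Obj) (Γ Δ : List C.Obj) (h : C.fold y (Γ ++ Δ) = _) :
    C.lin x y (Γ ++ Δ) ≫ C.tensorMap (𝟙 x) (eqToHom h) =
      eqToHom (fold_append _ _ _) ≫ C.foldMap (C.lin x y Γ) Δ ≫ C.lin x (C.fold y Γ) Δ := by
  apply eq_of_heq
  rw [tensorMap_eqToHom, heq_eqToHom_comp_iff, comp_eqToHom_heq_iff]
  exact lin_append x y Γ Δ

theorem pre_append_comp (k : SkewKind) (Γ Δ : List C.Obj) (hk : k = .tight → Γ ≠ []) (x : C.Obj) :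
    C.pre k (Γ ++ Δ) x ≫ C.tensorMap (𝟙 x) (eqToHom (st_append k Γ Δ hk)) =
      eqToHom (fold_append _ _ _) ≫ C.foldMap (C.pre k Γ x) Δ ≫ C.lin x (C.st k Γ) Δ := by
  rcases k with _ | _
  · rcases Γ with _ | ⟨a, Γ⟩
    · exact absurd rfl (hk rfl)
    · exact lin_append_comp _ _ _ _ _
  · simp only [pre, Category.assoc]
    have e := C.lin_append_comp x C.unit Γ Δ (fold_append _ _ _)
    rw [e, reassoc_of% (foldMap_append_comp (C.ρ x) Γ Δ), foldMap_comp, Category.assoc]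

/-- The action of a multimap `a₁, …, aₙ ⟶ b` as a map `x ⊗ a₁ ⊗ ⋯ ⊗ aₙ ⟶ x ⊗ b`. -/
def act (f : C.MMap) (x : C.Obj) : C.fold x f.src ⟶ C.tensor x f.tgt :=
  C.pre f.kind f.src x ≫ C.tensorMap (𝟙 x) f.map.1

theorem act_natural (f : C.MMap) {x y : C.Obj} (p : x ⟶ y) :
    C.foldMap p f.src ≫ act f y = act f x ≫ C.tensorMap p (𝟙 _) := by
  rw [act, act, reassoc_of% (pre_natural f.kind f.src p), Category.assoc, tensorMap_split,
    tensorMap_split']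

/-- Together with `act_natural`, this says that `f` acts by a transformation that is natural in `x`
and commutes with tensoring on the left. These two facts are what `subs_natural` and `subs_lin`
extend to lists. -/
theorem act_α (f : C.MMap) (x y : C.Obj) :
    act f (C.tensor x y) ≫ C.α x y f.tgt = C.lin x y f.src ≫ C.tensorMap (𝟙 x) (act f y) := by
  have := C.α_natural (𝟙 x) (𝟙 y) f.map.1
  rw [C.tensorMap_id] at this
  rw [act, act, Category.assoc, this, reassoc_of% (pre_α f.kind f.src x y), C.tensorMap_id_comp]

/-- The simultaneous action of a list of multimaps. -/
def subs : (fs : List C.MMap) → (x : C.Obj) →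
    (C.fold x (fs.flatMap Multimap.src) ⟶ C.fold x (fs.map Multimap.tgt))
  | [], x => 𝟙 x
  | f :: fs, x => eqToHom (fold_append _ _ _) ≫
      C.foldMap (act f x) (fs.flatMap Multimap.src) ≫ subs fs (C.tensor x f.tgt)

theorem subs_natural (fs : List C.MMap) {x y : C.Obj} (p : x ⟶ y) :
    C.foldMap p (fs.flatMap Multimap.src) ≫ subs fs y =
      subs fs x ≫ C.foldMap p (fs.map Multimap.tgt) := by
  induction fs generalizing x y with
  | nil => exact (Category.comp_id p).trans (Category.id_comp p).symm
  | cons f fs ih =>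
    have e := ih (C.tensorMap p (𝟙 f.tgt))
    have e' := foldMap_append_comp p f.src (fs.flatMap Multimap.src)
    change C.foldMap p (f.src ++ fs.flatMap Multimap.src) ≫ eqToHom (fold_append _ _ _) ≫
        C.foldMap (act f y) (fs.flatMap Multimap.src) ≫ subs fs (C.tensor y f.tgt) =
      (eqToHom (fold_append _ _ _) ≫ C.foldMap (act f x) (fs.flatMap Multimap.src) ≫
        subs fs (C.tensor x f.tgt)) ≫ C.foldMap (C.tensorMap p (𝟙 f.tgt)) (fs.map Multimap.tgt)
    simp only [Category.assoc]
    rw [reassoc_of% e', ← e]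
    simp only [← Category.assoc]
    congr 1
    simp only [Category.assoc, ← foldMap_comp]
    rw [act_natural]

/-- In the inductive step the associator for the head is moved past the remaining arguments by
`subs_natural`, and then meets the action of the head, where `act_α` applies. -/
theorem subs_lin (fs : List C.MMap) (x y : C.Obj) :
    subs fs (C.tensor x y) ≫ C.lin x y (fs.map Multimap.tgt) =
      C.lin x y (fs.flatMap Multimap.src) ≫ C.tensorMap (𝟙 x) (subs fs y) := by
  induction fs generalizing y with
  | nil =>
    change 𝟙 _ ≫ 𝟙 _ = 𝟙 _ ≫ C.tensorMap (𝟙 x) (𝟙 y)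
    rw [C.tensorMap_id]
  | cons f fs ih =>
    change (eqToHom (fold_append _ _ _) ≫
        C.foldMap (act f (C.tensor x y)) (fs.flatMap Multimap.src) ≫
          subs fs (C.tensor (C.tensor x y) f.tgt)) ≫
        C.foldMap (C.α x y f.tgt) (fs.map Multimap.tgt) ≫
          C.lin x (C.tensor y f.tgt) (fs.map Multimap.tgt) =
      C.lin x y (f.src ++ fs.flatMap Multimap.src) ≫
        C.tensorMap (𝟙 x) (eqToHom (fold_append _ _ _) ≫
          C.foldMap (act f y) (fs.flatMap Multimap.src) ≫ subs fs (C.tensor y f.tgt))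
    simp only [Category.assoc, C.tensorMap_id_comp]
    rw [← reassoc_of% (subs_natural fs (C.α x y f.tgt)), ih,
      reassoc_of% (C.lin_append_comp x y f.src _ (fold_append _ _ _)),
      ← reassoc_of% (C.lin_natural (𝟙 x) (act f y) _)]
    congr 1
    simp only [← Category.assoc, ← foldMap_comp]
    rw [act_α]

variable (C) in
theorem st_comp (k : SkewKind) (ks : List SkewKind) (Γ Δ : List C.Obj)
    (h : k = .tight → Γ ≠ []) :
    C.st (SkewKind.comp .tight (k :: ks)) (Γ ++ Δ) = C.fold (C.st k Γ) Δ := by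
  rw [SkewKind.comp_tight_cons, st_append _ _ _ h]

/-- The action of a list of multimaps as arguments of a multimap of kind `k`. -/
def mact : (k : SkewKind) → (fs : List C.MMap) →
    (C.st (k.comp (fs.map Multimap.kind)) (fs.flatMap Multimap.src) ⟶
      C.st k (fs.map Multimap.tgt))
  | .loose, fs => subs fs C.unit
  | .tight, [] => 𝟙 _
  | .tight, f :: fs => eqToHom (C.st_comp f.kind _ f.src _ f.map.2) ≫
      C.foldMap f.map.1 (fs.flatMap Multimap.src) ≫ subs fs f.tgt

theorem pre_comp_append (k k' : SkewKind) (e : k' = k) (Γ Δ : List C.Obj)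
    (hk : k = .tight → Γ ≠ []) (x : C.Obj) (h : C.st k' (Γ ++ Δ) = C.fold (C.st k Γ) Δ) :
    C.pre k' (Γ ++ Δ) x ≫ C.tensorMap (𝟙 x) (eqToHom h) =
      eqToHom (fold_append _ _ _) ≫ C.foldMap (C.pre k Γ x) Δ ≫ C.lin x (C.st k Γ) Δ := by
  subst e
  exact pre_append_comp _ _ _ hk x

/-- Substituting inside the bracket after `pre` agrees with substituting before the block is
bracketed. Hence the action of a composite multimap is the composite of the actions, which is
`act_msubst`. -/
theorem mact_pre (k : SkewKind) (fs : List C.MMap) (x : C.Obj) :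
    C.pre (k.comp (fs.map Multimap.kind)) (fs.flatMap Multimap.src) x ≫
        C.tensorMap (𝟙 x) (mact k fs) = subs fs x ≫ C.pre k (fs.map Multimap.tgt) x := by
  rcases k with _ | _
  · rcases fs with _ | ⟨f, fs⟩
    · change (C.ρ x ≫ 𝟙 _) ≫ C.tensorMap (𝟙 x) (𝟙 _) = 𝟙 x ≫ C.ρ x
      simp [C.tensorMap_id]
    · have e := C.pre_comp_append f.kind _
        (SkewKind.comp_tight_cons f.kind (fs.map Multimap.kind)) f.src
        (fs.flatMap Multimap.src) f.map.2 x (C.st_comp f.kind _ f.src _ f.map.2)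
      change C.pre (SkewKind.comp .tight (f.kind :: fs.map Multimap.kind))
          (f.src ++ fs.flatMap Multimap.src) x ≫ C.tensorMap (𝟙 x)
            (eqToHom (C.st_comp f.kind _ f.src _ f.map.2) ≫
              C.foldMap f.map.1 (fs.flatMap Multimap.src) ≫ subs fs f.tgt) =
          (eqToHom (fold_append _ _ _) ≫ C.foldMap (act f x) (fs.flatMap Multimap.src) ≫
            subs fs (C.tensor x f.tgt)) ≫ C.lin x f.tgt (fs.map Multimap.tgt)
      simp only [Category.assoc, C.tensorMap_id_comp]
      rw [reassoc_of% e, ← reassoc_of% (C.lin_natural (𝟙 x) f.map.1 _), ← subs_lin]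
      simp only [act, foldMap_comp, Category.assoc]
  · simp only [mact, pre, SkewKind.comp_loose, Category.assoc]
    rw [← subs_lin, reassoc_of% (subs_natural fs (C.ρ x))]

theorem act_mact (k : SkewKind) (fs : List C.MMap) (x : C.Obj) {b : C.Obj}
    (g : C.st k (fs.map Multimap.tgt) ⟶ b) :
    C.pre (k.comp (fs.map Multimap.kind)) (fs.flatMap Multimap.src) x ≫
      C.tensorMap (𝟙 x) (mact k fs ≫ g) =
      subs fs x ≫ C.pre k (fs.map Multimap.tgt) x ≫ C.tensorMap (𝟙 x) g := by
  rw [C.tensorMap_id_comp, reassoc_of% (mact_pre k fs x)]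

end SkewMonCat

/-! ### Substitution of multimaps and its associativity -/

namespace SkewMonCat

variable {C : SkewMonCat.{v, u}}

/-- Substitution of multimaps. -/
def msubst {x : SkewKind} {Δ : List C.Obj} {c : C.Obj} (g : C.MHom x Δ c) (fs : List C.MMap)
    (h : fs.map Multimap.tgt = Δ) :
    C.MHom (x.comp (fs.map Multimap.kind)) (fs.flatMap Multimap.src) c :=
  ⟨mact x fs ≫ eqToHom (congrArg (C.st x) h) ≫ g.1, by
    intro e
    rcases x with _ | _
    · rcases fs with _ | ⟨f, fs⟩
      · exact absurd e (by simp [SkewKind.comp])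
      · rw [List.map_cons, SkewKind.comp_tight_cons] at e
        simpa using fun e' => absurd e' (f.map.2 e)
    · exact absurd e (by simp [SkewKind.comp])⟩

/-- The loose multimap underlying a tight one. -/
def mloosen {Γ : List C.Obj} {b : C.Obj} (f : C.MHom .tight Γ b) : C.MHom .loose Γ b :=
  ⟨C.lo .tight Γ ≫ f.1, by simp⟩

theorem act_msubst (g : C.MMap) (fs : List C.MMap) (h : fs.map Multimap.tgt = g.src) (x : C.Obj) :
    act (Multimap.of (msubst g.map fs h)) x =
      subs fs x ≫ eqToHom (congrArg (C.fold x) h) ≫ act g x := by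
  rcases g with ⟨k, Δ, c, g⟩
  dsimp at h
  subst h
  change C.pre _ _ x ≫ C.tensorMap (𝟙 x) (mact k fs ≫ 𝟙 _ ≫ g.1) = subs fs x ≫ 𝟙 _ ≫ _
  rw [Category.id_comp, Category.id_comp]
  exact act_mact k fs x g.1

theorem subs_cons (f : C.MMap) (fs : List C.MMap) (x : C.Obj) :
    subs (f :: fs) x ≍
      C.foldMap (act f x) (fs.flatMap Multimap.src) ≫ subs fs (C.tensor x f.tgt) :=
  eqToHom_comp_heq _ _

theorem subs_append (fs fs' : List C.MMap) (x : C.Obj) :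
    subs (fs ++ fs') x ≍ C.foldMap (subs fs x) (fs'.flatMap Multimap.src) ≫
      subs fs' (C.fold x (fs.map Multimap.tgt)) := by
  induction fs generalizing x with
  | nil =>
    refine heq_of_eq ?_
    change subs fs' x = C.foldMap (𝟙 x) _ ≫ subs fs' x
    rw [foldMap_id, Category.id_comp]
  | cons f fs ih =>
    refine (subs_cons f (fs ++ fs') x).trans ?_
    have e : C.foldMap (subs (f :: fs) x) (fs'.flatMap Multimap.src) ≍
        C.foldMap (C.foldMap (act f x) (fs.flatMap Multimap.src)) (fs'.flatMap Multimap.src) ≫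
          C.foldMap (subs fs (C.tensor x f.tgt)) (fs'.flatMap Multimap.src) := by
      rw [← foldMap_comp]
      exact foldMap_heq (fold_append _ _ _) rfl (subs_cons _ _ _) rfl
    have e₁ : C.fold (C.fold x (List.flatMap Multimap.src (f :: fs)))
        (fs'.flatMap Multimap.src) = _ :=
      congrArg (fun y => C.fold y (fs'.flatMap Multimap.src)) (fold_append _ _ _)
    refine HEq.trans ?_ (heq_comp e₁ rfl rfl e HEq.rfl).symm
    rw [Category.assoc]
    have e₂ : ∀ y : C.Obj, C.fold y ((fs ++ fs').flatMap Multimap.src) =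
        C.fold (C.fold y (fs.flatMap Multimap.src)) (fs'.flatMap Multimap.src) := fun y => by
      rw [List.flatMap_append, fold_append]
    refine heq_comp (e₂ _) (e₂ _) (by rw [List.map_append, fold_append]; rfl) ?_ (ih _)
    rw [List.flatMap_append]
    exact foldMap_append _ _ _

theorem foldMap_eqToHom {x y : C.Obj} (p : x ⟶ y) {Γ Γ' : List C.Obj} (h : Γ = Γ')
    (h₁ : C.fold x Γ = C.fold x Γ') (h₂ : C.fold y Γ = C.fold y Γ') :
    eqToHom h₁ ≫ C.foldMap p Γ' = C.foldMap p Γ ≫ eqToHom h₂ := by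
  subst h
  simp

/-- A multimap together with multimaps that can be substituted into it. -/
abbrev SubstPair (C : SkewMonCat.{v, u}) : Type (max u v) :=
  (g : C.MMap) × {fs : List C.MMap // fs.map Multimap.tgt = g.src}

/-- The result of the substitution. -/
abbrev SubstPair.eval (p : C.SubstPair) : C.MMap := Multimap.of (msubst p.1.map p.2.1 p.2.2)

theorem flatMap_src_eval (ps : List C.SubstPair) :
    (ps.flatMap fun p => p.2.1).flatMap Multimap.src =
      (ps.map SubstPair.eval).flatMap Multimap.src := by
  simp [List.flatMap_assoc, List.flatMap_map]

/-- By induction on the list. The action of the head `g` on `x` commutes with the substitutions in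
the later places by `subs_natural`; it then stands next to the substitution of its own arguments
`fs`, and `act_msubst` merges the two. -/
theorem subs_assoc (ps : List C.SubstPair) (x : C.Obj)
    (h : (ps.flatMap fun p => p.2.1).map Multimap.tgt =
      (ps.map fun p => p.1).flatMap Multimap.src)
    (h' : C.fold x ((ps.flatMap fun p => p.2.1).map Multimap.tgt) = _) :
    subs (ps.flatMap fun p => p.2.1) x ≫ eqToHom h' ≫ subs (ps.map fun p => p.1) x ≍
      subs (ps.map SubstPair.eval) x := by
  induction ps generalizing x with
  | nil =>
    change 𝟙 x ≫ 𝟙 x ≫ 𝟙 x ≍ 𝟙 x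
    simp
  | cons p ps ih =>
    obtain ⟨⟨k, Δ, b, g⟩, fs, hfs⟩ := p
    dsimp at hfs
    subst hfs
    have h₁ : (ps.flatMap fun p => p.2.1).map Multimap.tgt =
        (ps.map fun p => p.1).flatMap Multimap.src := by simpa using h
    have ih' := ih (C.tensor x b) h₁ (congrArg _ h₁)
    let f' : C.MMap := SubstPair.eval ⟨⟨k, _, b, g⟩, fs, rfl⟩
    -- The mathematical content, with all transports confined to `h₁`; the rest matches the two
    -- sides of `key` with the statement up to casts.
    have key : C.foldMap (subs fs x) ((ps.flatMap fun p => p.2.1).flatMap Multimap.src) ≫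
        subs (ps.flatMap fun p => p.2.1) (C.fold x (fs.map Multimap.tgt)) ≫
        eqToHom (congrArg (C.fold _) h₁) ≫
        C.foldMap (act ⟨k, _, b, g⟩ x) ((ps.map fun p => p.1).flatMap Multimap.src) ≫
        subs (ps.map fun p => p.1) (C.tensor x b) =
      C.foldMap (act f' x) ((ps.flatMap fun p => p.2.1).flatMap Multimap.src) ≫
        subs (ps.flatMap fun p => p.2.1) (C.tensor x b) ≫ eqToHom (congrArg (C.fold _) h₁) ≫
          subs (ps.map fun p => p.1) (C.tensor x b) := by
      rw [reassoc_of% (foldMap_eqToHom (act ⟨k, _, b, g⟩ x) h₁ _ (congrArg (C.fold _) h₁)),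
        ← reassoc_of% (subs_natural (ps.flatMap fun p => p.2.1) (act ⟨k, _, b, g⟩ x)),
        act_msubst, ← Category.assoc, ← foldMap_comp]
      simp
    refine HEq.trans ?_ (HEq.trans (heq_of_eq key) ?_)
    · rw [← Category.assoc (C.foldMap _ _)]
      refine heq_comp ?_ ?_ rfl (subs_append fs (ps.flatMap fun p : C.SubstPair => p.2.1) x) ?_
      · rw [← fold_append, ← List.flatMap_append]
        rfl
      · rw [← fold_append, ← List.map_append]
        rfl
      · rw [eqToHom_comp_heq_iff, heq_eqToHom_comp_iff]
        exact subs_cons _ _ _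
    · refine HEq.trans ?_ (subs_cons f' (ps.map SubstPair.eval) x).symm
      refine heq_comp ?_ ?_ (by rw [List.map_map, List.map_map]; rfl) ?_ ih'
      · rw [flatMap_src_eval]
      · rw [flatMap_src_eval]
      · rw [flatMap_src_eval]

theorem mact_cons (f : C.MMap) (fs : List C.MMap) :
    mact .tight (f :: fs) ≍
      C.foldMap f.map.1 (fs.flatMap Multimap.src) ≫ subs fs f.tgt :=
  eqToHom_comp_heq _ _

theorem mact_append (k : SkewKind) (fs fs' : List C.MMap) (h : k = .tight → fs ≠ []) :
    mact k (fs ++ fs') ≍ C.foldMap (mact k fs) (fs'.flatMap Multimap.src) ≫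
      subs fs' (C.st k (fs.map Multimap.tgt)) := by
  rcases k with _ | _
  · rcases fs with _ | ⟨f, fs⟩
    · exact absurd rfl (h rfl)
    · refine (mact_cons f (fs ++ fs')).trans ?_
      have e₀ := C.st_comp f.kind (fs.map Multimap.kind) f.src (fs.flatMap Multimap.src) f.map.2
      have e : C.foldMap (mact .tight (f :: fs)) (fs'.flatMap Multimap.src) ≍
          C.foldMap (C.foldMap f.map.1 (fs.flatMap Multimap.src)) (fs'.flatMap Multimap.src) ≫
            C.foldMap (subs fs f.tgt) (fs'.flatMap Multimap.src) := by
        rw [← foldMap_comp]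
        exact foldMap_heq e₀ rfl (mact_cons _ _) rfl
      refine HEq.trans ?_ (heq_comp (congrArg (fun y => C.fold y (fs'.flatMap Multimap.src)) e₀)
        rfl rfl e HEq.rfl).symm
      rw [Category.assoc]
      have e₂ : ∀ y : C.Obj, C.fold y ((fs ++ fs').flatMap Multimap.src) =
          C.fold (C.fold y (fs.flatMap Multimap.src)) (fs'.flatMap Multimap.src) := fun y => by
        rw [List.flatMap_append, fold_append]
      refine heq_comp (e₂ _) (e₂ _) (by rw [List.map_append, fold_append]; rfl) ?_
        (subs_append fs fs' f.tgt)
      rw [List.flatMap_append]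
      exact foldMap_append _ _ _
  · exact subs_append fs fs' C.unit

theorem mact_heq {k k' : SkewKind} (e : k = k') (fs : List C.MMap) :
    mact k fs ≍ mact k' fs := by
  subst e
  rfl

theorem comp_kind_eval (k : SkewKind) (ps : List C.SubstPair) :
    (k.comp ((ps.map fun p => p.1).map Multimap.kind)).comp
      ((ps.flatMap fun p => p.2.1).map Multimap.kind) =
      k.comp ((ps.map SubstPair.eval).map Multimap.kind) := by
  have := SkewKind.comp_assoc k (ps.map fun p => (p.1.kind, p.2.1.map Multimap.kind)) (by
    simp only [List.mem_map]
    rintro _ ⟨p, -, rfl⟩ e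
    have := p.1.map.2 e
    rw [← p.2.2] at this
    simpa using this)
  simpa [Function.comp_def, List.map_flatMap, List.flatMap_map] using this

/-- For loose `k` this is `subs_assoc` at the unit. For tight `k` only the head changes: the first
argument enters through its underlying morphism instead of through `act`, and the argument of
`subs_assoc` is repeated with this morphism. -/
theorem mact_assoc (k : SkewKind) (ps : List C.SubstPair) (hk : k = .tight → ps ≠ [])
    (h : (ps.flatMap fun p => p.2.1).map Multimap.tgt =
      (ps.map fun p => p.1).flatMap Multimap.src)
    (h' : C.st (k.comp ((ps.map fun p => p.1).map Multimap.kind))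
      ((ps.flatMap fun p => p.2.1).map Multimap.tgt) = _) :
    mact (k.comp ((ps.map fun p => p.1).map Multimap.kind)) (ps.flatMap fun p => p.2.1) ≫
        eqToHom h' ≫ mact k (ps.map fun p => p.1) ≍
      mact k (ps.map SubstPair.eval) := by
  rcases k with _ | _
  · rcases ps with _ | ⟨⟨⟨k, Δ, b, g⟩, fs, hfs⟩, ps⟩
    · exact absurd rfl (hk rfl)
    dsimp at hfs
    subst hfs
    have h₁ : (ps.flatMap fun p => p.2.1).map Multimap.tgt =
        (ps.map fun p => p.1).flatMap Multimap.src := by simpa using h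
    have hfs : k = .tight → fs ≠ [] := fun e => by simpa using g.2 e
    have ih' := subs_assoc ps b h₁ (congrArg _ h₁)
    let f' : C.MMap := SubstPair.eval ⟨⟨k, _, b, g⟩, fs, rfl⟩
    have key : C.foldMap (mact k fs) ((ps.flatMap fun p => p.2.1).flatMap Multimap.src) ≫
        subs (ps.flatMap fun p => p.2.1) (C.st k (fs.map Multimap.tgt)) ≫
        eqToHom (congrArg (C.fold _) h₁) ≫
        C.foldMap g.1 ((ps.map fun p => p.1).flatMap Multimap.src) ≫
        subs (ps.map fun p => p.1) b =
      C.foldMap f'.map.1 ((ps.flatMap fun p => p.2.1).flatMap Multimap.src) ≫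
        subs (ps.flatMap fun p => p.2.1) b ≫ eqToHom (congrArg (C.fold _) h₁) ≫
          subs (ps.map fun p => p.1) b := by
      rw [reassoc_of% (foldMap_eqToHom g.1 h₁ _ (congrArg (C.fold _) h₁)),
        ← reassoc_of% (subs_natural (ps.flatMap fun p => p.2.1) g.1),
        ← Category.assoc, ← foldMap_comp]
      simp [f', SubstPair.eval, msubst]
    refine HEq.trans ?_ (HEq.trans (heq_of_eq key) ?_)
    · rw [← Category.assoc (C.foldMap _ _)]
      refine heq_comp ?_ ?_ rfl (HEq.trans (mact_heq (SkewKind.comp_tight_cons _ _) _)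
        (mact_append k fs (ps.flatMap fun p : C.SubstPair => p.2.1) hfs)) ?_
      · change C.st (SkewKind.comp (SkewKind.comp .tight (k :: _)) _)
          (List.flatMap Multimap.src (fs ++ _)) = _
        rw [SkewKind.comp_tight_cons, List.flatMap_append]
        refine Eq.trans ?_ (st_append _ _ _ (msubst g fs rfl).2)
        congr 1
        rcases k with _ | _
        · rcases fs with _ | ⟨f, fs⟩
          · exact absurd rfl (hfs rfl)
          · change SkewKind.comp .tight (f.kind :: _) = SkewKind.comp .tight (f.kind :: _)
            rw [SkewKind.comp_tight_cons, SkewKind.comp_tight_cons]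
        · rfl
      · change C.st (SkewKind.comp .tight (k :: _)) (List.map Multimap.tgt (fs ++ _)) = _
        rw [SkewKind.comp_tight_cons, List.map_append]
        exact st_append _ _ _ g.2
      · rw [eqToHom_comp_heq_iff, heq_eqToHom_comp_iff]
        exact mact_cons _ _
    · refine HEq.trans ?_ (mact_cons f' (ps.map SubstPair.eval)).symm
      refine heq_comp ?_ ?_ (by rw [List.map_map, List.map_map]; rfl) ?_ ih'
      · rw [flatMap_src_eval]
      · rw [flatMap_src_eval]
      · rw [flatMap_src_eval]
  · exact subs_assoc ps C.unit h h'

end SkewMonCat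

/-! ### The skew multicategory of a skew monoidal category -/

namespace SkewMonCat

variable {C : SkewMonCat.{v, u}}

variable (C) in
/-- The identity multimap. -/
abbrev mone (a : C.Obj) : C.MHom .tight [a] a := ⟨𝟙 a, by simp⟩

variable (C) in
/-- The data of the skew multicategory of a skew monoidal category. -/
@[reducible]
def multicatData : SkewMulticatData.{v, u} where
  Obj := C.Obj
  Hom := C.MHom
  tight_nil _ := ⟨fun f => f.2 rfl rfl⟩
  j := mloosen
  one := C.mone
  subst := msubst

/-- A morphism, as a tight unary multimap. -/
abbrev munary {a b : C.Obj} (f : a ⟶ b) : C.MHom .tight [a] b := ⟨f, by simp⟩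

theorem act_munary {a b : C.Obj} (f : a ⟶ b) (x : C.Obj) :
    act (Multimap.of (munary f)) x = C.tensorMap (𝟙 x) f := by
  change 𝟙 _ ≫ C.tensorMap (𝟙 x) f = _
  rw [Category.id_comp]

/-- A consequence of `pre_lo`: as `act` places a multimap after `x`, it does not see the difference
between a tight multimap and its loose image. -/
theorem act_loosen (f : C.MMap) (x : C.Obj) :
    act (f.loosen mloosen) x ≍ act f x := by
  rcases f with ⟨_ | _, Γ, b, f⟩
  · refine heq_of_eq ?_
    change C.pre .loose Γ x ≫ C.tensorMap (𝟙 x) (C.lo .tight Γ ≫ f.1) = _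
    rw [C.tensorMap_id_comp, reassoc_of% (pre_lo .tight Γ x)]
    rfl
  · rfl

theorem subs_one (Γ : List C.Obj) (x : C.Obj) :
    subs (Γ.map fun a => (Multimap.of (C.mone a) : C.MMap)) x ≍ 𝟙 (C.fold x Γ) := by
  induction Γ generalizing x with
  | nil => rfl
  | cons a Γ ih =>
    refine (subs_cons _ _ _).trans ?_
    rw [act_munary, C.tensorMap_id, foldMap_id, Category.id_comp]
    exact ih _

theorem subs_loosen (fs fs' : List C.MMap) (f : C.MMap) (x : C.Obj) :
    subs (fs ++ f.loosen mloosen :: fs') x ≍ subs (fs ++ f :: fs') x := by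
  induction fs generalizing x with
  | nil =>
    refine (subs_cons _ _ _).trans (HEq.trans ?_ (subs_cons _ _ _).symm)
    have e : C.tensor x (f.loosen mloosen).tgt = C.tensor x f.tgt := by rw [Multimap.loosen_tgt]
    refine heq_comp (by rw [Multimap.loosen_src]) (by rw [e]) (by rw [e])
      (foldMap_heq (by rw [Multimap.loosen_src]) e (act_loosen f x) rfl) ?_
    rw [e]
  | cons g fs ih =>
    refine (subs_cons _ _ _).trans (HEq.trans ?_ (subs_cons _ _ _).symm)
    have e : (fs ++ f.loosen mloosen :: fs').flatMap Multimap.src =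
        (fs ++ f :: fs').flatMap Multimap.src := by simp
    have e' : (fs ++ f.loosen mloosen :: fs').map Multimap.tgt =
        (fs ++ f :: fs').map Multimap.tgt := by simp
    refine heq_comp ?_ ?_ ?_ (foldMap_heq rfl rfl HEq.rfl e) (ih _)
    · exact congrArg _ e
    · exact congrArg _ e
    · exact congrArg _ e'

/-- Both occurrences of `lo` are rewritten by `pre_l` as `pre` at the unit followed by `l`; then
`mact_pre` and naturality of `l` suffice. -/
theorem mact_lo (k : SkewKind) (fs : List C.MMap) :
    subs fs C.unit ≫ C.lo k (fs.map Multimap.tgt) =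
      C.lo (k.comp (fs.map Multimap.kind)) (fs.flatMap Multimap.src) ≫ mact k fs := by
  rw [← pre_l, ← reassoc_of% (mact_pre k fs C.unit), C.l_natural, ← Category.assoc, pre_l]

/-- Since `lo` is an identity on loose sources, one formula covers both kinds. -/
theorem loosen_of {k : SkewKind} {Γ : List C.Obj} {b : C.Obj} (f : C.MHom k Γ b) :
    (Multimap.of f : C.MMap).loosen mloosen =
      Multimap.of (⟨C.lo k Γ ≫ f.1, by simp⟩ : C.MHom .loose Γ b) := by
  rcases k with _ | _
  · rfl
  · refine mmap_ext rfl rfl rfl (heq_of_eq (Category.id_comp _).symm)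

variable (C) in
/-- The skew multicategory of a skew monoidal category. -/
@[reducible]
def multicat : SkewMulticat.{v, u} where
  toSkewMulticatData := C.multicatData
  one_subst f := by
    refine mmap_ext (SkewKind.comp_tight_cons _ _) (List.append_nil _) rfl ?_
    have h := mact_cons f []
    change mact .tight [f] ≫ 𝟙 _ ≫ 𝟙 _ ≍ _
    rw [Category.comp_id, Category.comp_id]
    refine h.trans (heq_of_eq ?_)
    exact Category.comp_id _
  subst_one g h := by
    have e : (g.src.map fun a => (Multimap.of (C.mone a) : C.MMap)).map Multimap.tgt = g.src := h
    have e' : (g.src.map fun a => (Multimap.of (C.mone a) : C.MMap)).flatMap Multimap.src =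
      g.src := by simp [List.flatMap_map]
    have ek : g.kind.comp ((g.src.map fun a => (Multimap.of (C.mone a) : C.MMap)).map
        Multimap.kind) = g.kind := by
      rcases g with ⟨_ | _, _ | ⟨a, Γ⟩, b, g⟩
      · exact absurd rfl (g.2 rfl)
      · rfl
      · rfl
      · rfl
    refine mmap_ext ek e' rfl ?_
    have key : mact g.kind (g.src.map fun a => (Multimap.of (C.mone a) : C.MMap)) ≍
        𝟙 (C.st g.kind g.src) := by
      rcases g with ⟨_ | _, _ | ⟨a, Γ⟩, b, g⟩
      · exact absurd rfl (g.2 rfl)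
      · refine (mact_cons _ _).trans ?_
        rw [foldMap_id, Category.id_comp]
        exact subs_one Γ a
      · exact subs_one _ _
      · exact subs_one _ _
    change mact g.kind _ ≫ eqToHom (congrArg (C.st g.kind) e) ≫ g.map.1 ≍ g.map.1
    refine (heq_comp (by rw [ek, e']) (by rw [e]) rfl key (eqToHom_comp_heq _ _)).trans ?_
    rw [Category.id_comp]
  assoc k ps h₁ h₂ h₃ := by
    have h₁' : (ps.map fun p : C.SubstPair => p.1).map Multimap.tgt = k.src := h₁
    have h₃' : (ps.map SubstPair.eval).map Multimap.tgt = k.src := h₃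
    refine mmap_ext (comp_kind_eval k.kind ps) (flatMap_src_eval ps) rfl ?_
    have hk : k.kind = .tight → ps ≠ [] := by
      intro e e'
      subst e'
      exact k.map.2 e h₁.symm
    change mact _ _ ≫ eqToHom _ ≫ mact _ _ ≫ eqToHom (congrArg (C.st k.kind) h₁') ≫ k.map.1 ≍
      mact _ _ ≫ eqToHom (congrArg (C.st k.kind) h₃') ≫ k.map.1
    rw [← Category.assoc, ← Category.assoc, Category.assoc (mact _ _)]
    refine heq_comp ?_ ?_ rfl (mact_assoc k.kind ps hk h₂ _) ?_
    · rw [comp_kind_eval, flatMap_src_eval]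
    · rw [h₁', h₃']
    · rw [eqToHom_comp_heq_iff, heq_eqToHom_comp_iff]
  loosen_subst g fs h h' := by
    rcases g with ⟨k, Δ, c, g⟩
    dsimp at h
    subst h
    rcases k with _ | _
    · refine Eq.trans ?_ (loosen_of (msubst g fs rfl)).symm
      refine mmap_ext rfl rfl rfl (heq_of_eq ?_)
      change subs fs C.unit ≫ 𝟙 _ ≫ C.lo .tight _ ≫ g.1 = C.lo _ _ ≫ mact .tight fs ≫ 𝟙 _ ≫ g.1
      rw [Category.id_comp, Category.id_comp, reassoc_of% (mact_lo .tight fs)]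
    · rfl
  subst_loosen_head g f fs h h' := by
    have h₀ : (f.loosen mloosen :: fs).map Multimap.tgt = (f :: fs).map Multimap.tgt := by
      rw [List.map_cons, Multimap.loosen_tgt]
      rfl
    have e : (f.loosen mloosen :: fs).flatMap Multimap.src = (f :: fs).flatMap Multimap.src := by
      rw [List.flatMap_cons, Multimap.loosen_src]
      rfl
    rcases g with ⟨_ | _, Δ, c, g⟩
    · dsimp at h
      subst h
      rcases f with ⟨_ | _, _ | ⟨a, Γ⟩, b, f⟩
      · exact absurd rfl (f.2 rfl)
      -- With `g` and `f` both tight, loosening is visible on both sides: `l` is applied to the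
      -- first entry of `f.src`, before or after concatenation with the other sources.
      · refine mmap_ext rfl rfl rfl ?_
        change mact .tight (Multimap.of (mloosen f) :: fs) ≫ 𝟙 _ ≫ g.1 ≍
          C.foldMap (C.l a) (Γ ++ _) ≫ mact .tight (Multimap.of f :: fs) ≫ 𝟙 _ ≫ g.1
        rw [Category.id_comp, Category.id_comp]
        refine HEq.trans ?_ (heq_of_eq (Category.assoc _ _ _))
        refine heq_comp rfl rfl rfl ?_ HEq.rfl
        refine (mact_cons _ _).trans ?_
        have e₁ : C.foldMap (mloosen f).1 (fs.flatMap Multimap.src) =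
          C.foldMap (C.foldMap (C.l a) Γ) _ ≫ C.foldMap f.1 _ := foldMap_comp _ _ _
        rw [e₁, Category.assoc]
        exact heq_comp (fold_append _ _ _).symm (fold_append _ _ _).symm rfl
          (foldMap_append _ _ _).symm (mact_cons (Multimap.of f) fs).symm
      · rfl
      · rfl
    -- For loose `g` the composite is loose already, and `f` stands after the unit, where
    -- `subs_loosen` makes its kind irrelevant.
    · refine mmap_ext rfl e rfl ?_
      change subs _ _ ≫ eqToHom _ ≫ g.1 ≍ subs _ _ ≫ eqToHom _ ≫ g.1
      refine heq_comp (congrArg _ e) (congrArg _ h₀) rfl (subs_loosen [] fs f _) ?_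
      rw [eqToHom_comp_heq_iff, heq_eqToHom_comp_iff]
  subst_loosen_tail g f₁ f fs fs' h h' := by
    have h₀ : (fs ++ f.loosen mloosen :: fs').map Multimap.tgt =
        (fs ++ f :: fs').map Multimap.tgt := by simp
    have e : (fs ++ f.loosen mloosen :: fs').flatMap Multimap.src =
        (fs ++ f :: fs').flatMap Multimap.src := by simp
    have e₁ : (f₁ :: (fs ++ f.loosen mloosen :: fs')).flatMap Multimap.src =
        (f₁ :: (fs ++ f :: fs')).flatMap Multimap.src := congrArg (f₁.src ++ ·) e
    have h₁ : (f₁ :: (fs ++ f.loosen mloosen :: fs')).map Multimap.tgt =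
        (f₁ :: (fs ++ f :: fs')).map Multimap.tgt := congrArg (f₁.tgt :: ·) h₀
    rcases g with ⟨_ | _, Δ, c, g⟩
    · have ek : SkewKind.comp .tight ((f₁ :: (fs ++ f.loosen mloosen :: fs')).map Multimap.kind) =
          SkewKind.comp .tight ((f₁ :: (fs ++ f :: fs')).map Multimap.kind) :=
        (SkewKind.comp_tight_cons _ _).trans (SkewKind.comp_tight_cons _ _).symm
      refine mmap_ext ek e₁ rfl ?_
      change mact .tight _ ≫ eqToHom _ ≫ g.1 ≍ mact .tight _ ≫ eqToHom _ ≫ g.1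
      refine heq_comp (by rw [ek, e₁]) (by rw [h₁]) rfl ?_
        (by rw [eqToHom_comp_heq_iff, heq_eqToHom_comp_iff])
      refine (mact_cons _ _).trans (HEq.trans ?_ (mact_cons _ _).symm)
      exact heq_comp (congrArg _ e) (congrArg _ e) (congrArg _ h₀)
        (foldMap_heq rfl rfl HEq.rfl e) (subs_loosen fs fs' f _)
    · refine mmap_ext rfl e₁ rfl ?_
      change subs _ _ ≫ eqToHom _ ≫ g.1 ≍ subs _ _ ≫ eqToHom _ ≫ g.1
      refine heq_comp (congrArg _ e₁) (congrArg _ h₁) rfl (subs_loosen (f₁ :: fs) fs' f _) ?_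
      rw [eqToHom_comp_heq_iff, heq_eqToHom_comp_iff]

end SkewMonCat

/-! ### Calculus of substitution in an arbitrary skew multicategory -/

namespace SkewMulticat

variable (A : SkewMulticat.{v, u})

open Classical in
/-- Substitution as a total function, with an irrelevant value on lists that do not match. -/
noncomputable def sub (g : A.Map) (fs : List A.Map) : A.Map :=
  -- The default `g` has the right target, so `sub_tgt` needs no hypothesis.
  if h : fs.map Multimap.tgt = g.src then A.substM g fs h else g

variable {A}

theorem sub_eq {g : A.Map} {fs : List A.Map} (h : fs.map Multimap.tgt = g.src) :
    A.sub g fs = A.substM g fs h := dif_pos h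

@[simp]
theorem sub_tgt (g : A.Map) (fs : List A.Map) : (A.sub g fs).tgt = g.tgt := by
  unfold sub
  split <;> rfl

theorem sub_src {g : A.Map} {fs : List A.Map} (h : fs.map Multimap.tgt = g.src) :
    (A.sub g fs).src = fs.flatMap Multimap.src := by
  rw [sub_eq h]

theorem sub_kind {g : A.Map} {fs : List A.Map} (h : fs.map Multimap.tgt = g.src) :
    (A.sub g fs).kind = g.kind.comp (fs.map Multimap.kind) := by
  rw [sub_eq h]

/-- The axiom `assoc` for plain pairs. The matching conditions are hypotheses instead of components
of the list, so the terms can be rewritten freely; `attach` restores the dependent pairs. -/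
theorem sub_assoc (k : A.Map) (ps : List (A.Map × List A.Map))
    (h : ∀ p ∈ ps, p.2.map Multimap.tgt = p.1.src)
    (hk : ps.map (fun p => p.1.tgt) = k.src) :
    A.sub (A.sub k (ps.map Prod.fst)) (ps.flatMap Prod.snd) =
      A.sub k (ps.map fun p => A.sub p.1 p.2) := by
  let qs : List ((g : A.Map) × {fs : List A.Map // fs.map Multimap.tgt = g.src}) :=
    ps.attach.map fun p => ⟨p.1.1, p.1.2, h p.1 p.2⟩
  have e₁ : qs.map (fun p => p.1) = ps.map Prod.fst := by
    rw [List.map_map]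
    exact List.attach_map_val (f := Prod.fst)
  have e₂ : qs.flatMap (fun p => p.2.1) = ps.flatMap Prod.snd := by
    rw [List.flatMap_def, List.flatMap_def, List.map_map]
    exact congrArg List.flatten (List.attach_map_val (f := Prod.snd))
  have e₃ : qs.map (fun p => A.substM p.1 p.2.1 p.2.2) = ps.map fun p => A.sub p.1 p.2 := by
    rw [List.map_map, ← List.attach_map_val (l := ps) (f := fun p => A.sub p.1 p.2)]
    refine List.map_congr_left fun p _ => ?_
    exact (sub_eq (h p.1 p.2)).symm
  have h₁ : (ps.map Prod.fst).map Multimap.tgt = k.src := by rw [← hk, List.map_map]; rfl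
  have h₂ : (ps.flatMap Prod.snd).map Multimap.tgt = (ps.map Prod.fst).flatMap Multimap.src := by
    rw [List.map_flatMap, List.flatMap_map]
    exact List.flatMap_congr h
  have h₃ : (ps.map fun p => A.sub p.1 p.2).map Multimap.tgt = k.src := by
    rw [← hk, List.map_map]
    exact List.map_congr_left fun p _ => sub_tgt _ _
  have := A.assoc k qs (by rw [e₁]; exact h₁) (by rw [e₁, e₂]; exact h₂) (by rw [e₃]; exact h₃)
  rw [sub_eq h₁, sub_eq h₂, sub_eq h₃]
  refine Eq.trans ?_ (this.trans ?_)
  · exact A.substM_congr (A.substM_congr rfl e₁.symm _ _) e₂.symm _ _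
  · exact A.substM_congr rfl e₃ _ _

theorem one_sub (f : A.Map) {a : A.Obj} (h : f.tgt = a) : A.sub (A.oneM a) [f] = f := by
  subst h
  exact (sub_eq rfl).trans (A.one_subst f)

theorem sub_one (g : A.Map) {Γ : List A.Obj} (h : Γ = g.src) : A.sub g (Γ.map A.oneM) = g := by
  subst h
  have : (g.src.map A.oneM).map Multimap.tgt = g.src := by simp [Function.comp_def]
  exact (sub_eq this).trans (A.subst_one g this)

theorem sub_unary {u g : A.Map} {fs : List A.Map} (hu : u.src = [g.tgt])
    (h : fs.map Multimap.tgt = g.src) : A.sub u [A.sub g fs] = A.sub (A.sub u [g]) fs := by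
  have := sub_assoc u [(g, fs)] (by simpa using h) (by simp [hu])
  simpa using this.symm

theorem sub_unary_unary {u w g : A.Map} (hu : u.src = [w.tgt]) (hw : w.src = [g.tgt]) :
    A.sub u [A.sub w [g]] = A.sub (A.sub u [w]) [g] :=
  sub_unary hu (by simp [hw])

/-- `sub_head` and `sub_tail` are the instances of `sub_assoc` in which identities fill the places
after the first, respectively the first place. They allow one place to be treated separately from
the others. -/
theorem sub_head {k g : A.Map} {fs rest : List A.Map} {Δ : List A.Obj}
    (hk : k.src = g.tgt :: Δ) (hΔ : rest.map Multimap.tgt = Δ) (h : fs.map Multimap.tgt = g.src) :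
    A.sub (A.sub k (g :: Δ.map A.oneM)) (fs ++ rest) = A.sub k (A.sub g fs :: rest) := by
  subst hΔ
  have := sub_assoc k ((g, fs) :: rest.map fun r => (A.oneM r.tgt, [r]))
    (by simpa using h) (by simp [hk, Function.comp_def])
  have e : rest.map (fun r => A.sub (A.oneM r.tgt) [r]) = rest := by
    conv_rhs => rw [← List.map_id rest]
    exact List.map_congr_left fun r _ => one_sub r rfl
  simpa [Function.comp_def, List.flatMap_map, e] using this

theorem sub_tail {k h : A.Map} {rest : List A.Map} {a : A.Obj} {Δ : List A.Obj}
    (hk : k.src = a :: rest.map Multimap.tgt) (ha : h.tgt = a)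
    (hΔ : Δ = rest.flatMap Multimap.src) :
    A.sub (A.sub k (A.oneM a :: rest)) (h :: Δ.map A.oneM) = A.sub k (h :: rest) := by
  subst ha hΔ
  have := sub_assoc k ((A.oneM h.tgt, [h]) :: rest.map fun r => (r, r.src.map A.oneM))
    (by simp [Function.comp_def]) (by simp [hk, Function.comp_def])
  have e : rest.map (fun r => A.sub r (r.src.map A.oneM)) = rest := by
    conv_rhs => rw [← List.map_id rest]
    exact List.map_congr_left fun r _ => sub_one r rfl
  simpa [Function.comp_def, List.flatMap_map, e, one_sub, List.map_flatMap] using this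

theorem sub_pair {k g g' : A.Map} {fs fs' : List A.Map} (hk : k.src = [g.tgt, g'.tgt])
    (h : fs.map Multimap.tgt = g.src) (h' : fs'.map Multimap.tgt = g'.src) :
    A.sub (A.sub k [g, g']) (fs ++ fs') = A.sub k [A.sub g fs, A.sub g' fs'] := by
  have := sub_assoc k [(g, fs), (g', fs')] (by simp [h, h']) (by simp [hk])
  simpa using this

theorem loosen_sub {g : A.Map} {fs : List A.Map} (h : fs.map Multimap.tgt = g.src) :
    A.sub (A.loosen g) fs = A.loosen (A.sub g fs) := by
  have h' : fs.map Multimap.tgt = (A.loosen g).src := by rw [h, Multimap.loosen_src]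
  rw [sub_eq h, sub_eq h', A.loosen_subst]

theorem sub_loosen {g f : A.Map} {fs : List A.Map} (h : (f :: fs).map Multimap.tgt = g.src) :
    A.sub g (A.loosen f :: fs) = A.loosen (A.sub g (f :: fs)) := by
  have h' : (A.loosen f :: fs).map Multimap.tgt = g.src := by
    rw [← h, List.map_cons, List.map_cons, Multimap.loosen_tgt]
  rw [sub_eq h, sub_eq h', A.subst_loosen_head]

theorem loosen_of_loose {m : A.Map} (h : m.kind = .loose) : A.loosen m = m := by
  rcases m with ⟨_ | _, _, _, _⟩
  · cases h
  · rfl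

/-- Transport of the source of a multimap along an equality. -/
def castSrc {k : SkewKind} {Γ Γ' : List A.Obj} {b : A.Obj} (h : Γ = Γ') (f : A.Hom k Γ b) :
    A.Hom k Γ' b := h ▸ f

@[simp]
theorem of_castSrc {k : SkewKind} {Γ Γ' : List A.Obj} {b : A.Obj} (h : Γ = Γ')
    (f : A.Hom k Γ b) : (Multimap.of (castSrc h f) : A.Map) = Multimap.of f := by
  subst h
  rfl

end SkewMulticat

/-! ### Representations of a skew monoidal category in a skew multicategory -/

/-- A lax monoidal functor from a skew monoidal category to a skew multicategory: the data of an
`Association`, without the bijectivity and universality conditions. -/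
structure SkewRep (C : SkewMonCat.{v, u}) (A : SkewMulticat.{v, u}) where
  obj : C.Obj → A.Obj
  hom {a b : C.Obj} : (a ⟶ b) → A.Hom .tight [obj a] (obj b)
  hom_id (a : C.Obj) : hom (𝟙 a) = A.one (obj a)
  hom_comp {a b c : C.Obj} (f : a ⟶ b) (g : b ⟶ c) : hom (f ≫ g) = A.unaryComp (hom f) (hom g)
  θ₀ : A.Hom .loose [] (obj C.unit)
  θ (a b : C.Obj) : A.Hom .tight [obj a, obj b] (obj (C.tensor a b))
  hom_tensorMap {a a' b b' : C.Obj} (f : a ⟶ a') (g : b ⟶ b') :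
    A.substM (Multimap.of (hom (C.tensorMap f g))) [Multimap.of (θ a b)] rfl =
      A.substM (Multimap.of (θ a' b')) [Multimap.of (hom f), Multimap.of (hom g)] rfl
  hom_α (a b c : C.Obj) :
    A.substM (Multimap.of (hom (C.α a b c)))
        [A.substM (Multimap.of (θ (C.tensor a b) c))
          [Multimap.of (θ a b), A.oneM (obj c)] rfl] rfl =
      A.substM (Multimap.of (θ a (C.tensor b c))) [A.oneM (obj a), Multimap.of (θ b c)] rfl
  hom_l (a : C.Obj) :
    A.substM (Multimap.of (hom (C.l a)))
        [A.substM (Multimap.of (θ C.unit a)) [Multimap.of θ₀, A.oneM (obj a)] rfl] rfl =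
      A.loosen (A.oneM (obj a))
  hom_ρ (a : C.Obj) :
    Multimap.of (hom (C.ρ a)) =
      A.substM (Multimap.of (θ a C.unit)) [A.oneM (obj a), Multimap.of θ₀] rfl

namespace SkewRep

open SkewMulticat

variable {C : SkewMonCat.{v, u}} {A : SkewMulticat.{v, u}} (R : SkewRep C A)

/-- The image of a morphism, as a bundled multimap. -/
abbrev homM {a b : C.Obj} (f : a ⟶ b) : A.Map := Multimap.of (R.hom f)

/-- The image of the universal binary multimap, as a bundled multimap. -/
abbrev θM (a b : C.Obj) : A.Map := Multimap.of (R.θ a b)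

/-- The image of the universal nullary multimap, as a bundled multimap. -/
abbrev θ₀M : A.Map := Multimap.of R.θ₀

/-- Identities of the images of objects. -/
def ones (Γ : List C.Obj) : List A.Map := (Γ.map R.obj).map A.oneM

@[simp]
theorem ones_tgt (Γ : List C.Obj) : (R.ones Γ).map Multimap.tgt = Γ.map R.obj := by
  simp [ones, Function.comp_def]

@[simp]
theorem ones_src (Γ : List C.Obj) : (R.ones Γ).flatMap Multimap.src = Γ.map R.obj := by
  induction Γ with
  | nil => rfl
  | cons a Γ ih => exact congrArg (R.obj a :: ·) ih

@[simp]
theorem ones_append (Γ Δ : List C.Obj) : R.ones (Γ ++ Δ) = R.ones Γ ++ R.ones Δ := by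
  simp [ones]

theorem sub_ones_head {k g : A.Map} {fs rest : List A.Map} {Γ : List C.Obj}
    (hk : k.src = g.tgt :: Γ.map R.obj) (hΓ : rest.map Multimap.tgt = Γ.map R.obj)
    (h : fs.map Multimap.tgt = g.src) :
    A.sub (A.sub k (g :: R.ones Γ)) (fs ++ rest) = A.sub k (A.sub g fs :: rest) :=
  sub_head hk hΓ h

theorem homM_id (a : C.Obj) : R.homM (𝟙 a) = A.oneM (R.obj a) := by
  rw [homM, R.hom_id]

theorem homM_comp {a b c : C.Obj} (f : a ⟶ b) (g : b ⟶ c) :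
    R.homM (f ≫ g) = A.sub (R.homM g) [R.homM f] := by
  rw [homM, R.hom_comp, sub_eq rfl]
  rfl

theorem sub_homM_comp {a b c : C.Obj} (f : a ⟶ b) (g : b ⟶ c) (m : A.Map)
    (h : m.tgt = R.obj a) :
    A.sub (R.homM (f ≫ g)) [m] = A.sub (R.homM g) [A.sub (R.homM f) [m]] := by
  rw [homM_comp, sub_unary_unary rfl (by simp [h])]

theorem sub_homM_eqToHom {a b c : C.Obj} (f : a = b) (g : b ⟶ c) (m : A.Map) :
    A.sub (R.homM (eqToHom f ≫ g)) [m] = A.sub (R.homM g) [m] := by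
  subst f
  simp

theorem sub_tensorMap {a a' b b' : C.Obj} (f : a ⟶ a') (g : b ⟶ b') :
    A.sub (R.homM (C.tensorMap f g)) [R.θM a b] = A.sub (R.θM a' b') [R.homM f, R.homM g] := by
  rw [sub_eq rfl, sub_eq rfl, R.hom_tensorMap]

theorem sub_α (a b c : C.Obj) :
    A.sub (R.homM (C.α a b c))
        [A.sub (R.θM (C.tensor a b) c) [R.θM a b, A.oneM (R.obj c)]] =
      A.sub (R.θM a (C.tensor b c)) [A.oneM (R.obj a), R.θM b c] := by
  rw [sub_eq (g := R.θM (C.tensor a b) c) rfl, sub_eq rfl, sub_eq rfl, R.hom_α]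

theorem sub_l (a : C.Obj) :
    A.sub (R.homM (C.l a)) [A.sub (R.θM C.unit a) [R.θ₀M, A.oneM (R.obj a)]] =
      A.loosen (A.oneM (R.obj a)) := by
  rw [sub_eq (g := R.θM C.unit a) rfl, sub_eq rfl, R.hom_l]

theorem homM_ρ (a : C.Obj) :
    R.homM (C.ρ a) = A.sub (R.θM a C.unit) [A.oneM (R.obj a), R.θ₀M] := by
  rw [sub_eq rfl, ← R.hom_ρ]

/-- The canonical multimap `x, a₁, …, aₙ ⟶ x ⊗ a₁ ⊗ ⋯ ⊗ aₙ`. -/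
def Θ : (x : C.Obj) → (Γ : List C.Obj) →
    A.Hom .tight (R.obj x :: Γ.map R.obj) (R.obj (C.fold x Γ))
  | x, [] => A.one (R.obj x)
  | x, a :: Γ => castSrc (Γ := [R.obj x, R.obj a] ++ (R.ones Γ).flatMap Multimap.src)
      (by simp) (A.subst (Θ (C.tensor x a) Γ) (R.θM x a :: R.ones Γ) (by simp))

/-- The canonical multimap, bundled. -/
abbrev ΘM (x : C.Obj) (Γ : List C.Obj) : A.Map := Multimap.of (R.Θ x Γ)

theorem ΘM_nil (x : C.Obj) : R.ΘM x [] = A.oneM (R.obj x) := rfl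

theorem ΘM_cons (x a : C.Obj) (Γ : List C.Obj) :
    R.ΘM x (a :: Γ) = A.sub (R.ΘM (C.tensor x a) Γ) (R.θM x a :: R.ones Γ) := by
  rw [sub_eq (by simp)]
  exact of_castSrc _ _

theorem ΘM_append (x : C.Obj) (Γ Δ : List C.Obj) :
    R.ΘM x (Γ ++ Δ) = A.sub (R.ΘM (C.fold x Γ) Δ) (R.ΘM x Γ :: R.ones Δ) := by
  induction Γ generalizing x with
  | nil => exact (sub_one (R.ΘM x Δ) (Γ := R.obj x :: Δ.map R.obj) rfl).symm
  | cons a Γ ih =>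
    rw [List.cons_append, ΘM_cons, ih, ΘM_cons]
    refine Eq.trans ?_ (R.sub_ones_head (k := R.ΘM (C.fold (C.tensor x a) Γ) Δ)
      (g := R.ΘM (C.tensor x a) Γ) (fs := R.θM x a :: R.ones Γ) (rest := R.ones Δ)
      rfl (by simp) (by simp))
    simp

/-- Iterated use of `hom_tensorMap`, one for each entry of `Γ`. -/
theorem ΘM_natural {x y : C.Obj} (p : x ⟶ y) (Γ : List C.Obj) :
    A.sub (R.homM (C.foldMap p Γ)) [R.ΘM x Γ] = A.sub (R.ΘM y Γ) (R.homM p :: R.ones Γ) := by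
  induction Γ generalizing x y with
  | nil => exact (sub_one (R.homM p) (Γ := [R.obj x]) rfl).trans (one_sub (R.homM p) rfl).symm
  | cons a Γ ih =>
    have h₁ := R.sub_ones_head (k := R.ΘM (C.tensor y a) Γ) (g := R.homM (C.tensorMap p (𝟙 a)))
      (fs := [R.θM x a]) (rest := R.ones Γ) rfl (by simp) (by simp)
    have h₂ := R.sub_ones_head (k := R.ΘM (C.tensor y a) Γ) (g := R.θM y a)
      (fs := [R.homM p, A.oneM (R.obj a)]) (rest := R.ones Γ) rfl (by simp) (by simp)
    rw [ΘM_cons, ΘM_cons, sub_unary rfl (by simp)]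
    change A.sub (A.sub (R.homM (C.foldMap (C.tensorMap p (𝟙 a)) Γ)) [_]) _ = _
    rw [ih]
    refine h₁.trans (Eq.trans ?_ h₂.symm)
    rw [sub_tensorMap, homM_id]

theorem ΘM_foldMap {x y : C.Obj} (p : x ⟶ y) (Γ : List C.Obj) {m : A.Map} {rest : List A.Map}
    (hm : m.tgt = R.obj x) (h : rest.map Multimap.tgt = Γ.map R.obj) :
    A.sub (R.homM (C.foldMap p Γ)) [A.sub (R.ΘM x Γ) (m :: rest)] =
      A.sub (R.ΘM y Γ) (A.sub (R.homM p) [m] :: rest) := by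
  rw [sub_unary rfl (by simp [hm, h]), ΘM_natural]
  exact R.sub_ones_head (fs := [m]) rfl h (by simp [hm])

/-- The translation of iterated `α` into `A`: every associator in `lin` is replaced by a regrouping
of substitutions through `hom_α`. -/
theorem ΘM_lin (x y : C.Obj) (Γ : List C.Obj) :
    A.sub (R.homM (C.lin x y Γ)) [A.sub (R.ΘM (C.tensor x y) Γ) (R.θM x y :: R.ones Γ)] =
      A.sub (R.θM x (C.fold y Γ)) [A.oneM (R.obj x), R.ΘM y Γ] := by
  induction Γ generalizing y with
  | nil =>
    change A.sub (R.homM (𝟙 _)) [A.sub (A.oneM (R.obj (C.tensor x y))) [R.θM x y]] =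
      A.sub (R.θM x y) [A.oneM (R.obj x), A.oneM (R.obj y)]
    rw [homM_id, one_sub (R.θM x y) rfl]
    refine (one_sub (R.θM x y) rfl).trans ?_
    exact (sub_one (R.θM x y) (Γ := [R.obj x, R.obj y]) rfl).symm
  | cons a Γ ih =>
    have h₁ := R.sub_ones_head (k := R.ΘM (C.tensor (C.tensor x y) a) Γ)
      (g := R.θM (C.tensor x y) a) (fs := [R.θM x y, A.oneM (R.obj a)]) (rest := R.ones Γ)
      rfl (by simp) (by simp)
    have h₃ := R.sub_ones_head (k := R.ΘM (C.tensor x (C.tensor y a)) Γ)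
      (g := R.θM x (C.tensor y a)) (fs := [A.oneM (R.obj x), R.θM y a]) (rest := R.ones Γ)
      rfl (by simp) (by simp)
    have h₄ := sub_pair (k := R.θM x (C.fold (C.tensor y a) Γ)) (g := A.oneM (R.obj x))
      (g' := R.ΘM (C.tensor y a) Γ) (fs := [A.oneM (R.obj x)]) (fs' := R.θM y a :: R.ones Γ)
      rfl rfl (by simp)
    have e : A.sub (R.ΘM (C.tensor x y) (a :: Γ)) (R.θM x y :: R.ones (a :: Γ)) =
        A.sub (R.ΘM (C.tensor (C.tensor x y) a) Γ) (A.sub (R.θM (C.tensor x y) a)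
          [R.θM x y, A.oneM (R.obj a)] :: R.ones Γ) := by
      rw [ΘM_cons]
      exact h₁
    rw [e]
    change A.sub (R.homM (C.foldMap (C.α x y a) Γ ≫ C.lin x (C.tensor y a) Γ)) _ = _
    rw [sub_homM_comp _ _ _ _ (by simp), ΘM_foldMap _ _ _ (by simp) (by simp), sub_α, ← h₃,
      sub_unary (by simp) (by simp [sub_src]), ih]
    refine h₄.trans ?_
    rw [one_sub (A.oneM (R.obj x)) rfl, ← ΘM_cons]

theorem ΘM_ρ (x : C.Obj) (Γ : List C.Obj) :
    A.sub (R.homM (C.foldMap (C.ρ x) Γ)) [R.ΘM x Γ] =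
      A.sub (A.sub (R.ΘM (C.tensor x C.unit) Γ) (R.θM x C.unit :: R.ones Γ))
        ([A.oneM (R.obj x), R.θ₀M] ++ R.ones Γ) := by
  rw [ΘM_natural, homM_ρ]
  exact (R.sub_ones_head rfl (by simp) (by simp)).symm

/-- The canonical multimap `a₁, …, aₙ ⟶ st k (a₁, …, aₙ)` of kind `k`. -/
def univ : (k : SkewKind) → (Γ : List C.Obj) → (k = .tight → Γ ≠ []) →
    A.Hom k (Γ.map R.obj) (R.obj (C.st k Γ))
  | .tight, [], h => absurd rfl (h rfl)
  | .tight, a :: Γ, _ => R.Θ a Γ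
  | .loose, Γ, _ => castSrc (Γ := (R.ones Γ).flatMap Multimap.src) (by simp)
      (A.subst (R.Θ C.unit Γ) (R.θ₀M :: R.ones Γ) (by simp))

/-- The canonical multimap, bundled. -/
abbrev univM (k : SkewKind) (Γ : List C.Obj) (h : k = .tight → Γ ≠ []) : A.Map :=
  Multimap.of (R.univ k Γ h)

theorem univM_loose (Γ : List C.Obj) (h : SkewKind.loose = .tight → Γ ≠ []) :
    R.univM .loose Γ h = A.sub (R.ΘM C.unit Γ) (R.θ₀M :: R.ones Γ) := by
  rw [sub_eq (by simp)]
  exact of_castSrc _ _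

theorem univM_append (k : SkewKind) (Γ Δ : List C.Obj) (h : k = .tight → Γ ≠ [])
    (h' : k = .tight → Γ ++ Δ ≠ []) :
    R.univM k (Γ ++ Δ) h' = A.sub (R.ΘM (C.st k Γ) Δ) (R.univM k Γ h :: R.ones Δ) := by
  rcases k with _ | _
  · rcases Γ with _ | ⟨a, Γ⟩
    · exact absurd rfl (h rfl)
    · exact R.ΘM_append a Γ Δ
  · rw [univM_loose, univM_loose, ΘM_append]
    exact Eq.trans (by simp) (R.sub_ones_head rfl (by simp) (by simp))

/-- A tight block is handled by `ΘM_lin`. For a loose block `hom_ρ` first introduces `θ₀`, which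
then becomes the leading argument of the bracketed block. -/
theorem univM_pre (k : SkewKind) (Γ : List C.Obj) (h : k = .tight → Γ ≠ []) (x : C.Obj) :
    A.sub (R.homM (C.pre k Γ x)) [R.ΘM x Γ] =
      A.sub (R.θM x (C.st k Γ)) [A.oneM (R.obj x), R.univM k Γ h] := by
  rcases k with _ | _
  · rcases Γ with _ | ⟨a, Γ⟩
    · exact absurd rfl (h rfl)
    · rw [ΘM_cons]
      exact R.ΘM_lin x a Γ
  · change A.sub (R.homM (C.foldMap (C.ρ x) Γ ≫ C.lin x C.unit Γ)) _ = _
    rw [sub_homM_comp _ _ _ _ rfl, ΘM_ρ, sub_unary (by simp) (by simp [sub_src]), ΘM_lin,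
      univM_loose]
    refine (sub_pair (k := R.θM x (C.fold C.unit Γ)) (g := A.oneM (R.obj x))
      (g' := R.ΘM C.unit Γ) (fs := [A.oneM (R.obj x)]) (fs' := R.θ₀M :: R.ones Γ)
      rfl rfl (by simp)).trans ?_
    rw [one_sub (A.oneM (R.obj x)) rfl]

/-- The action of the representation on multimaps. -/
noncomputable def map (f : C.MMap) : A.Map :=
  A.sub (R.homM f.map.1) [R.univM f.kind f.src f.map.2]

@[simp]
theorem map_tgt (f : C.MMap) : (R.map f).tgt = R.obj f.tgt := sub_tgt _ _

@[simp]
theorem map_src (f : C.MMap) : (R.map f).src = f.src.map R.obj := by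
  rw [map, sub_src rfl]
  simp

@[simp]
theorem map_kind (f : C.MMap) : (R.map f).kind = f.kind := by
  rw [map, sub_kind rfl]
  exact SkewKind.comp_tight_cons _ _

theorem ΘM_act (f : C.MMap) (x : C.Obj) :
    A.sub (R.homM (SkewMonCat.act f x)) [R.ΘM x f.src] =
      A.sub (R.θM x f.tgt) [A.oneM (R.obj x), R.map f] := by
  rw [SkewMonCat.act, sub_homM_comp _ _ _ _ rfl, univM_pre _ _ _ f.map.2,
    sub_unary rfl (by simp), sub_tensorMap, homM_id]
  refine (sub_pair (k := R.θM x f.tgt) (g := A.oneM (R.obj x))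
    (g' := R.homM f.map.1) (fs := [A.oneM (R.obj x)]) (fs' := [_])
      rfl rfl (by simp)).trans ?_
  rw [one_sub (A.oneM (R.obj x)) rfl, map]

theorem flatMap_src_map (fs : List C.MMap) :
    (fs.map R.map).flatMap Multimap.src = (fs.flatMap Multimap.src).map R.obj := by
  rw [List.flatMap_map, List.map_flatMap]
  exact List.flatMap_congr fun f _ => R.map_src f

/-- Translates the simultaneous action `subs` into substitution in `A`. In the inductive step
`ΘM_act` treats the head and `sub_tail` recombines it with the other arguments. -/
theorem ΘM_subs (fs : List C.MMap) (x : C.Obj) :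
    A.sub (R.homM (SkewMonCat.subs fs x)) [R.ΘM x (fs.flatMap Multimap.src)] =
      A.sub (R.ΘM x (fs.map Multimap.tgt)) (A.oneM (R.obj x) :: fs.map R.map) := by
  induction fs generalizing x with
  | nil =>
    change A.sub (R.homM (𝟙 _)) [A.oneM (R.obj x)] = A.sub (A.oneM (R.obj x)) [A.oneM (R.obj x)]
    rw [homM_id]
    rfl
  | cons f fs ih =>
    have h₁ := R.sub_ones_head (k := R.ΘM (C.tensor x f.tgt) (fs.map Multimap.tgt))
      (g := R.θM x f.tgt) (fs := [A.oneM (R.obj x), R.map f]) (rest := fs.map R.map)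
      rfl (by simp) (by simp)
    have h₂ := sub_tail (k := R.ΘM (C.tensor x f.tgt) (fs.map Multimap.tgt))
      (h := A.sub (R.θM x f.tgt) [A.oneM (R.obj x), R.map f]) (rest := fs.map R.map)
      (Δ := (fs.flatMap Multimap.src).map R.obj) (by simp) (sub_tgt _ _)
      (R.flatMap_src_map fs).symm
    change A.sub (R.homM (eqToHom (SkewMonCat.fold_append _ _ _) ≫
      C.foldMap (SkewMonCat.act f x) (fs.flatMap Multimap.src) ≫
        SkewMonCat.subs fs (C.tensor x f.tgt))) [R.ΘM x (f.src ++ fs.flatMap Multimap.src)] =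
      A.sub (R.ΘM x (f.tgt :: fs.map Multimap.tgt)) ([A.oneM (R.obj x), R.map f] ++ fs.map R.map)
    rw [sub_homM_eqToHom, ΘM_append, sub_homM_comp _ _ _ _ (by simp),
      ΘM_foldMap _ _ _ rfl (by simp), ΘM_act, sub_unary rfl (by simp), ih]
    refine Eq.trans h₂ ?_
    rw [← h₁, ΘM_cons]

/-- This carries preservation of substitution: `map` is defined by composition with `univM`, so
`map_msubst` only adds the underlying morphism of the outer multimap. -/
theorem univM_mact (k : SkewKind) (fs : List C.MMap) (h : k = .tight → fs.map Multimap.tgt ≠ [])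
    (h' : k.comp (fs.map Multimap.kind) = .tight → fs.flatMap Multimap.src ≠ []) :
    A.sub (R.homM (SkewMonCat.mact k fs))
        [R.univM (k.comp (fs.map Multimap.kind)) (fs.flatMap Multimap.src) h'] =
      A.sub (R.univM k (fs.map Multimap.tgt) h) (fs.map R.map) := by
  rcases k with _ | _
  · rcases fs with _ | ⟨f, fs⟩
    · exact absurd rfl (h rfl)
    have h₂ := sub_tail (k := R.ΘM f.tgt (fs.map Multimap.tgt))
      (h := R.map f) (rest := fs.map R.map)
      (Δ := (fs.flatMap Multimap.src).map R.obj) (by simp) (map_tgt _ _)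
      (R.flatMap_src_map fs).symm
    have e : R.univM (SkewKind.comp .tight (f.kind :: fs.map Multimap.kind))
        (f.src ++ fs.flatMap Multimap.src) h' =
        R.univM f.kind (f.src ++ fs.flatMap Multimap.src)
          (by rw [← SkewKind.comp_tight_cons f.kind (fs.map Multimap.kind)]; exact h') := by
      congr 1
      exact SkewKind.comp_tight_cons _ _
    change A.sub (R.homM (eqToHom (C.st_comp f.kind _ f.src _ f.map.2) ≫
      C.foldMap f.map.1 (fs.flatMap Multimap.src) ≫ SkewMonCat.subs fs f.tgt))
        [R.univM (SkewKind.comp .tight (f.kind :: fs.map Multimap.kind))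
          (f.src ++ fs.flatMap Multimap.src) h'] =
      A.sub (R.ΘM f.tgt (fs.map Multimap.tgt)) (R.map f :: fs.map R.map)
    rw [sub_homM_eqToHom, e, univM_append _ _ _ _ f.map.2, sub_homM_comp _ _ _ _ (by simp),
      ΘM_foldMap _ _ _ rfl (by simp), sub_unary rfl (by simp), ΘM_subs]
    exact h₂
  · have h₁ := R.sub_ones_head (k := R.ΘM C.unit (fs.map Multimap.tgt))
      (g := R.θ₀M) (fs := []) (rest := fs.map R.map)
      rfl (by simp) (by simp)
    have h₂ := sub_tail (k := R.ΘM C.unit (fs.map Multimap.tgt))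
      (h := R.θ₀M) (rest := fs.map R.map)
      (Δ := (fs.flatMap Multimap.src).map R.obj) (by simp) rfl
      (R.flatMap_src_map fs).symm
    change A.sub (R.homM (SkewMonCat.subs fs C.unit))
      [R.univM .loose (fs.flatMap Multimap.src) nofun] = _
    rw [univM_loose, univM_loose, sub_unary rfl (by simp), ΘM_subs]
    refine h₂.trans (Eq.trans ?_ h₁.symm)
    rw [show A.sub R.θ₀M [] = R.θ₀M from sub_one R.θ₀M (Γ := []) rfl]

theorem map_msubst (g : C.MMap) (fs : List C.MMap) (h : fs.map Multimap.tgt = g.src) :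
    R.map (Multimap.of (SkewMonCat.msubst g.map fs h)) = A.sub (R.map g) (fs.map R.map) := by
  rcases g with ⟨k, Δ, c, g⟩
  dsimp at h
  subst h
  change A.sub (R.homM (SkewMonCat.mact k fs ≫ 𝟙 _ ≫ g.1)) [_] = _
  rw [Category.id_comp, sub_homM_comp _ _ _ _ rfl, univM_mact _ _ _ g.2, sub_unary rfl (by simp)]
  rfl

theorem map_one (a : C.Obj) : R.map (Multimap.of (C.mone a)) = A.oneM (R.obj a) := by
  change A.sub (R.homM (𝟙 a)) [A.oneM (R.obj a)] = _
  rw [homM_id, one_sub (A.oneM (R.obj a)) rfl]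

/-- The axiom `hom_l` produces the loosened identity in the first place of `ΘM`; naturality of
substitution in the kind of its first argument carries the loosening outside. -/
theorem map_loosen (f : C.MMap) :
    R.map (f.loosen SkewMonCat.mloosen) = A.loosen (R.map f) := by
  rcases f with ⟨_ | _, _ | ⟨a, Γ⟩, b, f⟩
  · exact absurd rfl (f.2 rfl)
  · have h₁ := R.sub_ones_head (k := R.ΘM (C.tensor C.unit a) Γ)
      (g := R.θM C.unit a) (fs := [R.θ₀M, A.oneM (R.obj a)]) (rest := R.ones Γ)
      rfl (by simp) (by simp)
    have h₂ : A.sub (R.ΘM C.unit (a :: Γ)) (R.θ₀M :: R.ones (a :: Γ)) =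
        A.sub (R.ΘM (C.tensor C.unit a) Γ)
          (A.sub (R.θM C.unit a) [R.θ₀M, A.oneM (R.obj a)] :: R.ones Γ) := by
      rw [ΘM_cons]
      exact h₁
    have h₃ : A.sub (R.ΘM a Γ) (A.oneM (R.obj a) :: R.ones Γ) = R.ΘM a Γ :=
      sub_one (R.ΘM a Γ) (Γ := R.obj a :: Γ.map R.obj) rfl
    change A.sub (R.homM (C.foldMap (C.l a) Γ ≫ f.1)) [R.univM .loose (a :: Γ) nofun] =
      A.loosen (A.sub (R.homM f.1) [R.ΘM a Γ])
    rw [sub_homM_comp _ _ _ _ rfl, univM_loose, h₂, ΘM_foldMap _ _ _ (by simp) (by simp),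
      sub_l, sub_loosen (by simp), sub_loosen (by simp), h₃]
  · exact (loosen_of_loose (R.map_kind _)).symm
  · exact (loosen_of_loose (R.map_kind _)).symm

/-- The morphism of skew multicategories given by a representation. -/
noncomputable def functor : SkewMulticat.Functor C.multicat A where
  obj := R.obj
  map := R.map
  map_kind := R.map_kind
  map_src := R.map_src
  map_tgt := R.map_tgt
  map_loosen := R.map_loosen
  map_one := R.map_one
  map_subst g fs h h' := (R.map_msubst g fs h).trans (sub_eq h')

end SkewRep

namespace SkewRep

open SkewMulticat

variable {C : SkewMonCat.{v, u}} {A : SkewMulticat.{v, u}} (R : SkewRep C A)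

theorem map_munary {a b : C.Obj} (f : a ⟶ b) :
    R.map (Multimap.of (SkewMonCat.munary f)) = R.homM f :=
  sub_one (R.homM f) (Γ := [R.obj a]) rfl

end SkewRep

/-! ### Lax monoidal functors as representations -/

namespace SkewMonCat

variable {C D : SkewMonCat.{v, u}}

variable (C) in
/-- The universal binary multimap. -/
abbrev mθ (a b : C.Obj) : C.MHom .tight [a, b] (C.tensor a b) := ⟨𝟙 _, by simp⟩

variable (C) in
/-- The universal nullary multimap. -/
abbrev mθ₀ : C.MHom .loose [] C.unit := ⟨𝟙 _, by simp⟩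

theorem substM_munary {k : SkewKind} {Γ : List C.Obj} {a b : C.Obj} (m : C.MHom k Γ a)
    (p : a ⟶ b) : C.multicat.substM (Multimap.of (munary p)) [Multimap.of m] rfl =
      Multimap.of (⟨m.1 ≫ p, m.2⟩ : C.MHom k Γ b) := by
  refine mmap_ext (SkewKind.comp_tight_cons _ _) (List.append_nil _) rfl ?_
  have h := mact_cons (Multimap.of m) []
  change mact .tight [Multimap.of m] ≫ 𝟙 _ ≫ p ≍ _
  rw [Category.id_comp]
  refine heq_comp ?_ rfl rfl (h.trans (heq_of_eq (Category.comp_id _))) HEq.rfl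
  change C.st (SkewKind.comp .tight [k]) (Γ ++ []) = _
  rw [SkewKind.comp_tight_cons, List.append_nil]

/-- The lemmas after this one specialize the formula to the shapes that occur in the axioms of a
`SkewRep`; these axioms in `D.multicat` thereby become equations in `D`. -/
theorem substM_pair (f₁ f₂ : C.MMap) {c : C.Obj} (g : C.MHom .tight [f₁.tgt, f₂.tgt] c) :
    (C.multicat.substM (Multimap.of g) [f₁, f₂] rfl).map.1 ≍
      C.foldMap f₁.map.1 f₂.src ≫ act f₂ f₁.tgt ≫ g.1 := by
  change mact .tight [f₁, f₂] ≫ 𝟙 _ ≫ g.1 ≍ _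
  rw [Category.id_comp, ← Category.assoc]
  have e : [f₂].flatMap Multimap.src = f₂.src := List.append_nil _
  refine heq_comp ?_ rfl rfl ((mact_cons _ _).trans ?_) HEq.rfl
  · change C.st (SkewKind.comp .tight (f₁.kind :: _)) (f₁.src ++ [f₂].flatMap Multimap.src) = _
    rw [SkewKind.comp_tight_cons, e, st_append _ _ _ f₁.map.2]
  · refine heq_comp (by rw [e]) (by rw [e]) rfl (foldMap_heq rfl rfl HEq.rfl e) ?_
    refine (subs_cons _ _ _).trans (heq_of_eq ?_)
    exact Category.comp_id _

theorem substM_pair_unary {a a' b b' c : C.Obj} (g : C.MHom .tight [a', b'] c) (f : a ⟶ a')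
    (f' : b ⟶ b') :
    C.multicat.substM (Multimap.of g) [Multimap.of (munary f), Multimap.of (munary f')] rfl =
      Multimap.of (⟨C.tensorMap f f' ≫ g.1, by simp⟩ : C.MHom .tight [a, b] c) := by
  refine mmap_ext rfl rfl rfl ((substM_pair _ _ _).trans (heq_of_eq ?_))
  rw [act_munary]
  change C.tensorMap f (𝟙 _) ≫ C.tensorMap (𝟙 _) f' ≫ _ = _
  rw [← Category.assoc, tensorMap_split]

theorem substM_pair_tight_one {a a' b c d : C.Obj} (g : C.MHom .tight [b, c] d)
    (m : C.MHom .tight [a, a'] b) :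
    C.multicat.substM (Multimap.of g) [Multimap.of m, Multimap.of (C.mone c)] rfl =
      Multimap.of (⟨C.tensorMap m.1 (𝟙 c) ≫ g.1, by simp⟩ : C.MHom .tight [a, a', c] d) := by
  refine mmap_ext rfl rfl rfl ((substM_pair _ _ _).trans (heq_of_eq ?_))
  rw [act_munary, C.tensorMap_id, Category.id_comp]
  rfl

theorem substM_pair_loose_one {b c d : C.Obj} (g : C.MHom .tight [b, c] d)
    (m : C.MHom .loose [] b) :
    C.multicat.substM (Multimap.of g) [Multimap.of m, Multimap.of (C.mone c)] rfl =
      Multimap.of (⟨C.tensorMap m.1 (𝟙 c) ≫ g.1, by simp⟩ : C.MHom .loose [c] d) := by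
  refine mmap_ext rfl rfl rfl ((substM_pair _ _ _).trans (heq_of_eq ?_))
  rw [act_munary, C.tensorMap_id, Category.id_comp]
  rfl

theorem substM_pair_one_tight {a b b' c d : C.Obj} (g : C.MHom .tight [a, c] d)
    (m : C.MHom .tight [b, b'] c) :
    C.multicat.substM (Multimap.of g) [Multimap.of (C.mone a), Multimap.of m] rfl =
      Multimap.of (⟨C.α a b b' ≫ C.tensorMap (𝟙 a) m.1 ≫ g.1, by simp⟩ :
        C.MHom .tight [a, b, b'] d) := by
  refine mmap_ext rfl rfl rfl ((substM_pair _ _ _).trans (heq_of_eq ?_))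
  rw [foldMap_id, Category.id_comp]
  change ((C.α _ _ _ ≫ 𝟙 _) ≫ C.tensorMap (𝟙 _) m.1) ≫ _ = _
  rw [Category.comp_id, Category.assoc]

theorem substM_pair_one_loose {a c d : C.Obj} (g : C.MHom .tight [a, c] d)
    (m : C.MHom .loose [] c) :
    C.multicat.substM (Multimap.of g) [Multimap.of (C.mone a), Multimap.of m] rfl =
      Multimap.of (⟨C.ρ a ≫ C.tensorMap (𝟙 a) m.1 ≫ g.1, by simp⟩ : C.MHom .tight [a] d) := by
  refine mmap_ext rfl rfl rfl ((substM_pair _ _ _).trans (heq_of_eq ?_))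
  rw [foldMap_id, Category.id_comp]
  change ((C.ρ _ ≫ 𝟙 _) ≫ C.tensorMap (𝟙 _) m.1) ≫ _ = _
  rw [Category.comp_id, Category.assoc]

theorem substM_munary_cons {k : SkewKind} {Γ : List C.Obj} {a b : C.Obj} {m : C.MMap}
    {m' : C.MHom k Γ a} (h : m = Multimap.of m') (p : a ⟶ b)
    (h' : [m].map Multimap.tgt = [a]) :
    C.multicat.substM (Multimap.of (munary p)) [m] h' =
      Multimap.of (⟨m'.1 ≫ p, m'.2⟩ : C.MHom k Γ b) := by
  subst h
  exact substM_munary m' p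

theorem of_eq_iff {k : SkewKind} {Γ : List C.Obj} {b : C.Obj} {f g : C.MHom k Γ b} :
    (Multimap.of f : C.MMap) = Multimap.of g ↔ f.1 = g.1 :=
  ⟨fun h => congrArg _ (Multimap.of_inj h), fun h => congrArg _ (Subtype.ext h)⟩

/-- A lax monoidal functor as a representation in a skew multicategory. -/
@[reducible]
def LaxFunctor.rep (F : LaxFunctor C D) : SkewRep C D.multicat where
  obj := F.obj
  hom f := munary (F.map f)
  hom_id a := by rw [F.map_id]
  hom_comp f g := by
    apply Multimap.of_inj
    rw [F.map_comp]
    exact (substM_munary (munary (F.map f)) (F.map g)).symm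
  θ₀ := ⟨F.ε, by simp⟩
  θ a b := ⟨F.μ a b, by simp⟩
  hom_tensorMap f g := by
    rw [substM_munary, substM_pair_unary, of_eq_iff]
    exact (F.μ_natural f g).symm
  hom_α a b c := by
    rw [substM_munary_cons (substM_pair_tight_one _ _), substM_pair_one_tight, of_eq_iff]
    exact (Category.assoc _ _ _).trans (F.associativity a b c)
  hom_l a := by
    rw [substM_munary_cons (substM_pair_loose_one _ _)]
    refine of_eq_iff.2 ?_
    exact (Category.assoc _ _ _).trans ((F.left_unit a).trans (Category.comp_id _).symm)
  hom_ρ a := by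
    rw [substM_pair_one_loose, of_eq_iff]
    exact (F.right_unit a).symm

/-- A representation in the skew multicategory of a skew monoidal category, as a lax monoidal
functor. -/
def _root_.SkewRep.laxFunctor (R : SkewRep C D.multicat) : LaxFunctor C D where
  obj := R.obj
  map f := (R.hom f).1
  map_id a := congrArg Subtype.val (R.hom_id a)
  map_comp f g := (congrArg Subtype.val (R.hom_comp f g)).trans
    (of_eq_iff.1 (substM_munary (R.hom f) (R.hom g).1))
  ε := R.θ₀.1
  μ a b := (R.θ a b).1
  μ_natural f g := by
    have h := R.hom_tensorMap f g
    rw [substM_munary_cons (p := (R.hom (C.tensorMap f g)).1) rfl,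
      substM_pair_unary (R.θ _ _) (R.hom f).1 (R.hom g).1] at h
    exact (of_eq_iff.1 h).symm
  associativity a b c := by
    have h := R.hom_α a b c
    rw [substM_munary_cons (substM_pair_tight_one _ _) (R.hom (C.α a b c)).1,
      substM_pair_one_tight] at h
    exact (Category.assoc _ _ _).symm.trans (of_eq_iff.1 h)
  left_unit a := by
    have h := R.hom_l a
    rw [substM_munary_cons (substM_pair_loose_one _ _) (R.hom (C.l a)).1] at h
    exact (Category.assoc _ _ _).symm.trans ((of_eq_iff.1 h).trans (Category.comp_id _))
  right_unit a := by
    have h := R.hom_ρ a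
    rw [substM_pair_one_loose] at h
    exact (of_eq_iff.1 h).symm

variable (C) in
/-- The tautological representation of a skew monoidal category. -/
@[reducible]
def rep : SkewRep C C.multicat := (LaxFunctor.id C).rep

theorem sub_rep_ones (m : C.MMap) (Γ : List C.Obj) :
    (C.multicat.sub (Multimap.of (⟨𝟙 _, by simp⟩ :
      C.MHom .tight (m.tgt :: Γ) (C.fold m.tgt Γ))) (m :: C.rep.ones Γ)) =
      Multimap.of (⟨eqToHom (st_append _ _ _ m.map.2) ≫ C.foldMap m.map.1 Γ,
        fun h h' => m.map.2 h (List.append_eq_nil_iff.1 h').1⟩ :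
          C.MHom m.kind (m.src ++ Γ) (C.fold m.tgt Γ)) := by
  have h₁ : C.rep.ones Γ = Γ.map fun a => (Multimap.of (C.mone a) : C.MMap) := by
    simp [SkewRep.ones]
  have h₂ : (C.rep.ones Γ).flatMap Multimap.src = Γ := (C.rep.ones_src Γ).trans (List.map_id _)
  have h₄ : (C.rep.ones Γ).map Multimap.tgt = Γ := (C.rep.ones_tgt Γ).trans (List.map_id _)
  have h₅ : (m :: C.rep.ones Γ).map Multimap.tgt = m.tgt :: Γ := congrArg (m.tgt :: ·) h₄
  refine (SkewMulticat.sub_eq h₅).trans ?_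
  refine mmap_ext (SkewKind.comp_tight_cons _ _) (congrArg (m.src ++ ·) h₂) rfl ?_
  change mact .tight _ ≫ eqToHom _ ≫ 𝟙 _ ≍ eqToHom _ ≫ _
  rw [Category.comp_id, comp_eqToHom_heq_iff, heq_eqToHom_comp_iff]
  refine (mact_cons _ _).trans ?_
  have h₃ : C.foldMap m.map.1 Γ = C.foldMap m.map.1 Γ ≫ 𝟙 _ := (Category.comp_id _).symm
  rw [h₃]
  refine heq_comp (by rw [h₂]) (by rw [h₂]) (congrArg (C.fold m.tgt) h₄)
    (foldMap_heq rfl rfl HEq.rfl h₂) ?_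
  rw [h₁]
  exact subs_one Γ _

theorem rep_ΘM (x : C.Obj) (Γ : List C.Obj) :
    C.rep.ΘM x Γ = Multimap.of (⟨𝟙 _, by simp⟩ : C.MHom .tight (x :: Γ) (C.fold x Γ)) := by
  induction Γ generalizing x with
  | nil => rfl
  | cons a Γ ih =>
    rw [SkewRep.ΘM_cons, ih]
    refine (sub_rep_ones (Multimap.of (C.mθ x a)) Γ).trans ?_
    refine mmap_ext rfl rfl rfl (heq_of_eq ?_)
    change 𝟙 _ ≫ C.foldMap (𝟙 _) Γ = _
    rw [foldMap_id, Category.comp_id]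

/-- For the tautological representation every canonical multimap `univM` has an identity as
underlying morphism. With `SkewRep.map_induction` this shows that `C.multicat` is generated by its
unary and universal multimaps. -/
theorem rep_map (f : C.MMap) : C.rep.map f = f := by
  have h : ∀ (k : SkewKind) (Γ : List C.Obj) (h : k = .tight → Γ ≠ []),
      C.rep.univM k Γ h = Multimap.of (⟨𝟙 _, h⟩ : C.MHom k Γ (C.st k Γ)) := by
    intro k Γ h
    rcases k with _ | _
    · rcases Γ with _ | ⟨a, Γ⟩
      · exact absurd rfl (h rfl)
      · exact rep_ΘM a Γ
    · rw [SkewRep.univM_loose, rep_ΘM]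
      refine (sub_rep_ones (Multimap.of C.mθ₀) Γ).trans ?_
      refine mmap_ext rfl rfl rfl (heq_of_eq ?_)
      change 𝟙 _ ≫ C.foldMap (𝟙 _) Γ = _
      rw [foldMap_id, Category.comp_id]
  rw [SkewRep.map, h, SkewMulticat.sub_eq rfl]
  exact (substM_munary _ _).trans (mmap_ext rfl rfl rfl (heq_of_eq (Category.id_comp _)))

end SkewMonCat

/-! ### Generation by unary maps and the universal multimaps -/

namespace SkewRep

open SkewMulticat

variable {C : SkewMonCat.{v, u}} {A : SkewMulticat.{v, u}} (R : SkewRep C A)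

/-- Each `univM` is an iterated substitution of `θ₀`, of multimaps `θ a b` and of identities, so a
property stable under substitution needs to be checked only on the generators. -/
theorem map_induction {P : A.Map → Prop} (hom : ∀ {a b : C.Obj} (f : a ⟶ b), P (R.homM f))
    (h₀ : P R.θ₀M) (h₂ : ∀ a b : C.Obj, P (R.θM a b))
    (sub : ∀ (g : A.Map) (fs : List A.Map), fs.map Multimap.tgt = g.src → P g →
      (∀ f ∈ fs, P f) → P (A.sub g fs)) (f : C.MMap) : P (R.map f) := by
  have hone : ∀ Γ : List C.Obj, ∀ f ∈ R.ones Γ, P f := by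
    intro Γ f hf
    simp only [ones, List.mem_map] at hf
    obtain ⟨_, ⟨a, -, rfl⟩, rfl⟩ := hf
    rw [← homM_id]
    exact hom _
  have hΘ : ∀ (Γ : List C.Obj) (x : C.Obj), P (R.ΘM x Γ) := by
    intro Γ
    induction Γ with
    | nil => exact fun x => hone [x] _ (List.mem_cons_self ..)
    | cons a Γ ih =>
      intro x
      rw [ΘM_cons]
      refine sub _ _ (by simp) (ih _) fun f hf => ?_
      rcases List.mem_cons.1 hf with rfl | hf
      · exact h₂ _ _
      · exact hone Γ f hf
  rw [map]
  refine sub _ _ rfl (hom _) fun m hm => ?_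
  rw [List.mem_singleton.1 hm]
  rcases f with ⟨_ | _, _ | ⟨a, Γ⟩, b, f⟩
  · exact absurd rfl (f.2 rfl)
  · exact hΘ Γ a
  all_goals
    rw [univM_loose]
    refine sub _ _ (by simp) (hΘ _ _) fun f hf => ?_
    rcases List.mem_cons.1 hf with rfl | hf
    · exact h₀
    · exact hone _ f hf

end SkewRep

namespace SkewMulticat

variable {A B : SkewMulticat.{v, u}}

theorem Functor.map_sub (F : Functor A B) {g : A.Map} {fs : List A.Map}
    (h : fs.map Multimap.tgt = g.src) :
    F.map (A.sub g fs) = B.sub (F.map g) (fs.map F.map) := by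
  rw [sub_eq h, sub_eq (F.map_tgt_list h), F.map_subst]

/-- The action on objects is recovered from the targets of the images of identities. -/
theorem Functor.ext_map {F G : Functor A B} (h : ∀ f, F.map f = G.map f) : F = G := by
  have h' : F.obj = G.obj := by
    funext a
    have := congrArg Multimap.tgt (h (A.oneM a))
    rwa [F.map_tgt, G.map_tgt] at this
  rcases F with ⟨o, m⟩
  rcases G with ⟨o', m'⟩
  obtain rfl : o = o' := h'
  obtain rfl : m = m' := funext h
  rfl

/-- Naturality of a family of tight unary maps at a multimap. -/
def NatAt (F G : Functor A B) (app : ∀ a, B.Hom .tight [F.obj a] (G.obj a)) (f : A.Map) : Prop :=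
  B.sub (Multimap.of (app f.tgt)) [F.map f] =
    B.sub (G.map f) (f.src.map fun a => Multimap.of (app a))

/-- The components are moved first through `g` and then through each `fs`; associativity justifies
the two regroupings. -/
theorem NatAt.sub {F G : Functor A B} {app : ∀ a, B.Hom .tight [F.obj a] (G.obj a)}
    {g : A.Map} {fs : List A.Map} (h : fs.map Multimap.tgt = g.src) (hg : NatAt F G app g)
    (hfs : ∀ f ∈ fs, NatAt F G app f) : NatAt F G app (A.sub g fs) := by
  have e₁ := sub_assoc (G.map g) (fs.map fun f => (Multimap.of (app f.tgt), [F.map f]))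
    (by simp [F.map_tgt]) (by rw [G.map_src, ← h]; simp)
  have e₂ := sub_assoc (G.map g) (fs.map fun f => (G.map f, f.src.map fun a =>
    (Multimap.of (app a) : B.Map))) (by simp [G.map_src])
    (by rw [G.map_src, ← h]; simp [G.map_tgt])
  have e₃ : (fs.map fun f => B.sub (Multimap.of (app f.tgt)) [F.map f]) =
      fs.map fun f => B.sub (G.map f) (f.src.map fun a => (Multimap.of (app a) : B.Map)) :=
    List.map_congr_left hfs
  have e₄ : (fs.map F.map) = fs.flatMap fun f => [F.map f] :=
    (List.flatMap_pure_eq_map F.map fs).symm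
  simp only [List.map_map, List.flatMap_map, Function.comp_def] at e₁ e₂
  rw [NatAt, F.map_sub h, G.map_sub h, sub_tgt, sub_src h,
    sub_unary (g := F.map g) (by rw [F.map_tgt]) (F.map_tgt_list h), hg, ← h, List.map_map, e₄]
  refine e₁.trans ?_
  rw [e₃, ← e₂, List.map_flatMap]

/-- A natural family of tight unary maps as a 2-cell. -/
def Trans.mk' {F G : Functor A B} (app : ∀ a, B.Hom .tight [F.obj a] (G.obj a))
    (h : ∀ f, NatAt F G app f) : Trans F G where
  app := app
  naturality f h₁ h₂ := by
    have := h f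
    rwa [NatAt, sub_eq h₁, sub_eq h₂] at this

theorem Trans.natAt {F G : Functor A B} (φ : Trans F G) (f : A.Map) : NatAt F G φ.app f := by
  rw [NatAt, sub_eq (by simp [F.map_tgt]), sub_eq (by simp [G.map_src, Function.comp_def]),
    φ.naturality]

end SkewMulticat

namespace SkewRep

open SkewMulticat

variable {C D : SkewMonCat.{v, u}} {A : SkewMulticat.{v, u}} (R : SkewRep C A)

theorem map_comp {k : SkewKind} {Γ : List C.Obj} {a b : C.Obj} (m : C.MHom k Γ a) (p : a ⟶ b) :
    R.map (Multimap.of (⟨m.1 ≫ p, m.2⟩ : C.MHom k Γ b)) =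
      A.sub (R.homM p) [R.map (Multimap.of m)] :=
  R.sub_homM_comp _ _ _ rfl

theorem map_θ (a b : C.Obj) : R.map (Multimap.of (C.mθ a b)) = R.θM a b := by
  change A.sub (R.homM (𝟙 _)) [R.ΘM a [b]] = _
  rw [ΘM_cons, ΘM_nil, homM_id]
  exact (one_sub _ (by simp)).trans (one_sub _ rfl)

theorem map_θ₀ : R.map (Multimap.of C.mθ₀) = R.θ₀M := by
  change A.sub (R.homM (𝟙 _)) [R.univM .loose [] nofun] = _
  rw [univM_loose, ΘM_nil, homM_id]
  exact (one_sub _ (by simp)).trans (one_sub _ rfl)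

theorem functor_ext {F G : SkewMulticat.Functor C.multicat A}
    (h : ∀ {a b : C.Obj} (f : a ⟶ b), F.map (Multimap.of (SkewMonCat.munary f)) =
      G.map (Multimap.of (SkewMonCat.munary f)))
    (h₀ : F.map (Multimap.of C.mθ₀) = G.map (Multimap.of C.mθ₀))
    (h₂ : ∀ a b, F.map (Multimap.of (C.mθ a b)) = G.map (Multimap.of (C.mθ a b))) : F = G := by
  refine Functor.ext_map fun f => ?_
  rw [← SkewMonCat.rep_map f]
  refine C.rep.map_induction (P := fun m => F.map m = G.map m) (fun f => h f) h₀ h₂ ?_ f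
  intro g fs e hg hfs
  rw [F.map_sub e, G.map_sub e, hg, List.map_congr_left hfs]

theorem natAt_of_generators {F G : SkewMulticat.Functor C.multicat A}
    {app : ∀ a, A.Hom .tight [F.obj a] (G.obj a)}
    (h : ∀ {a b : C.Obj} (f : a ⟶ b), NatAt F G app (Multimap.of (SkewMonCat.munary f)))
    (h₀ : NatAt F G app (Multimap.of C.mθ₀))
    (h₂ : ∀ a b, NatAt F G app (Multimap.of (C.mθ a b))) (f : C.MMap) : NatAt F G app f := by
  rw [← SkewMonCat.rep_map f]
  exact C.rep.map_induction (P := fun m => NatAt F G app m) (fun f => h f) h₀ h₂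
    (fun g fs e hg hfs => NatAt.sub e hg hfs) f

theorem functor_map_munary {a b : C.Obj} (f : a ⟶ b) :
    R.functor.map (Multimap.of (SkewMonCat.munary f)) = R.homM f := R.map_munary f

theorem functor_map_θ (a b : C.Obj) : R.functor.map (Multimap.of (C.mθ a b)) = R.θM a b :=
  R.map_θ a b

theorem functor_map_θ₀ : R.functor.map (Multimap.of C.mθ₀) = R.θ₀M := R.map_θ₀

/-- The image of the universal binary multimap. -/
def functorθ (F : SkewMulticat.Functor C.multicat A) (a b : C.Obj) :
    A.Hom .tight [F.obj a, F.obj b] (F.obj (C.tensor a b)) :=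
  cast (by rw [F.map_kind, F.map_src, F.map_tgt]; rfl) (F.map (Multimap.of (C.mθ a b))).map

theorem of_functorθ (F : SkewMulticat.Functor C.multicat A) (a b : C.Obj) :
    Multimap.of (functorθ F a b) = F.map (C.rep.θM a b) :=
  of_cast _ (F.map_kind _) (F.map_src _) (F.map_tgt _) _

/-- The image of the universal nullary multimap. -/
def functorθ₀ (F : SkewMulticat.Functor C.multicat A) : A.Hom .loose [] (F.obj C.unit) :=
  cast (by rw [F.map_kind, F.map_src, F.map_tgt]; rfl) (F.map (Multimap.of C.mθ₀)).map

theorem of_functorθ₀ (F : SkewMulticat.Functor C.multicat A) :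
    Multimap.of (functorθ₀ F) = F.map C.rep.θ₀M :=
  of_cast _ (F.map_kind _) (F.map_src _) (F.map_tgt _) _

theorem of_functor_hom (F : SkewMulticat.Functor C.multicat A) {a b : C.Obj} (f : a ⟶ b) :
    Multimap.of (F.mapUnary (SkewMonCat.munary f)) = F.map (C.rep.homM f) :=
  F.of_mapUnary _

theorem functor_one (F : SkewMulticat.Functor C.multicat A) (a : C.Obj) :
    A.oneM (F.obj a) = F.map (C.multicat.oneM a) := (F.map_one a).symm

/-- The representation given by a morphism of skew multicategories. -/
def ofFunctor (F : SkewMulticat.Functor C.multicat A) : SkewRep C A where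
  obj := F.obj
  hom f := F.mapUnary (SkewMonCat.munary f)
  hom_id a := F.mapUnary_one a
  hom_comp f g := by
    rw [← F.mapUnary_comp]
    congr 1
    exact (Multimap.of_inj (SkewMonCat.substM_munary (SkewMonCat.munary f) g)).symm
  θ₀ := functorθ₀ F
  θ := functorθ F
  hom_tensorMap f g := by
    refine (sub_eq _).symm.trans (Eq.trans ?_ (sub_eq _))
    rw [of_functor_hom, of_functor_hom, of_functor_hom, of_functorθ, of_functorθ]
    have := congrArg F.map (C.rep.sub_tensorMap f g)
    rwa [F.map_sub rfl, F.map_sub rfl] at this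
  hom_α a b c := by
    refine (sub_eq _).symm.trans (Eq.trans ?_ (sub_eq _))
    rw [← sub_eq, of_functor_hom, of_functorθ, of_functorθ, of_functorθ, of_functorθ, functor_one,
      functor_one]
    have := congrArg F.map (C.rep.sub_α a b c)
    rwa [F.map_sub (by simp), F.map_sub rfl, List.map_singleton, F.map_sub rfl] at this
  hom_l a := by
    refine (sub_eq _).symm.trans ?_
    rw [← sub_eq, of_functor_hom, of_functorθ, of_functorθ₀, functor_one, ← F.map_loosen]
    have := congrArg F.map (C.rep.sub_l a)
    rwa [F.map_sub (by simp), List.map_singleton, F.map_sub rfl] at this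
  hom_ρ a := by
    refine Eq.trans ?_ (sub_eq _)
    rw [of_functor_hom, of_functorθ, of_functorθ₀, functor_one]
    have := congrArg F.map (C.rep.homM_ρ a)
    rwa [F.map_sub rfl] at this

theorem ofFunctor_functor (F : SkewMulticat.Functor C.multicat A) : (ofFunctor F).functor = F :=
  functor_ext (fun f => (functor_map_munary _ f).trans (F.of_mapUnary _))
    ((functor_map_θ₀ _).trans (of_functorθ₀ F))
    (fun a b => (functor_map_θ _ a b).trans (of_functorθ F a b))

end SkewRep

namespace SkewMonCat

variable {C D E : SkewMonCat.{v, u}}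

/-- The data of a lax monoidal functor can be read off from the images of the objects, the unary
maps, `θ₀` and `θ a b`. -/
theorem LaxFunctor.rep_injective : Function.Injective
    (fun F : LaxFunctor C D => F.rep.functor) := by
  intro F G h
  have hobj : F.obj = G.obj := congrArg SkewMulticat.Functor.obj h
  have hmap := fun m => congrFun (congrArg SkewMulticat.Functor.map h) m
  dsimp only at hmap
  rcases F with ⟨⟨o, m, _, _⟩, ε, μ, _, _, _, _⟩
  rcases G with ⟨⟨o', m', _, _⟩, ε', μ', _, _, _, _⟩
  obtain rfl : o = o' := hobj
  have h₁ : @m = @m' := by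
    funext a b f
    have := hmap (Multimap.of (munary f))
    rw [SkewRep.functor_map_munary, SkewRep.functor_map_munary] at this
    exact of_eq_iff.1 this
  have h₂ : ε = ε' := by
    have := hmap (Multimap.of C.mθ₀)
    rw [SkewRep.functor_map_θ₀, SkewRep.functor_map_θ₀] at this
    exact of_eq_iff.1 this
  have h₃ : μ = μ' := by
    funext a b
    have := hmap (Multimap.of (C.mθ a b))
    rw [SkewRep.functor_map_θ, SkewRep.functor_map_θ] at this
    exact of_eq_iff.1 this
  subst h₁ h₂ h₃
  rfl

end SkewMonCat

/-! ### The 2-functor to skew multicategories -/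

namespace SkewMulticat

open Bicategory

theorem trans_ext {A B : SkewMulticat.{v, u}} {F G : A ⟶ B} {φ ψ : F ⟶ G}
    (h : ∀ a, (Multimap.of (Trans.app φ a) : B.Map) = Multimap.of (Trans.app ψ a)) : φ = ψ := by
  apply Trans.ext
  funext a
  exact Multimap.of_inj (h a)

/-- Bundling makes components insensitive to transport along equalities of 1-cells, so compatibility
with whiskering is checked on bare components. -/
theorem of_eqToHom_conj_app {A B : SkewMulticat.{v, u}} {F F' G G' : A ⟶ B} (h : F = F')
    (η : F' ⟶ G') (h' : G' = G) (a : A.Obj) :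
    (Multimap.of (Trans.app (eqToHom h ≫ η ≫ eqToHom h') a) : B.Map) =
      Multimap.of (Trans.app η a) := by
  subst h h'
  rw [eqToHom_refl, eqToHom_refl, Category.id_comp, Category.comp_id]

end SkewMulticat

namespace SkewMonCat

open SkewMulticat Bicategory

variable {C D E : SkewMonCat.{v, u}}

theorem rep_functor_id : (LaxFunctor.id C).rep.functor = SkewMulticat.Functor.id C.multicat :=
  Functor.ext_map fun f => rep_map f

/-- Checked on generators. On `θ₀` and `θ a b`, the image under `F` is a universal multimap of
`D.multicat` followed by `ε` or `μ`, and applying `G` to this composite gives the structure maps of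
`F.comp G`. -/
theorem rep_functor_comp (F : LaxFunctor C D) (G : LaxFunctor D E) :
    (F.comp G).rep.functor = F.rep.functor.comp G.rep.functor := by
  refine SkewRep.functor_ext (fun f => ?_) ?_ fun a b => ?_
  · rw [SkewRep.functor_map_munary, Functor.comp_map, SkewRep.functor_map_munary]
    exact (SkewRep.functor_map_munary G.rep (F.map f)).symm
  · rw [SkewRep.functor_map_θ₀, Functor.comp_map, SkewRep.functor_map_θ₀]
    have e : F.rep.θ₀M = Multimap.of (⟨D.mθ₀.1 ≫ F.ε, by simp⟩ : D.MHom .loose [] _) :=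
      of_eq_iff.2 (Category.id_comp _).symm
    have h := G.rep.map_comp D.mθ₀ F.ε
    rw [G.rep.map_θ₀, sub_eq rfl, substM_munary] at h
    exact (h.symm.trans (congrArg G.rep.map e.symm))
  · rw [SkewRep.functor_map_θ, Functor.comp_map, SkewRep.functor_map_θ]
    have e : F.rep.θM a b = Multimap.of (⟨(D.mθ (F.obj a) (F.obj b)).1 ≫ F.μ a b, by simp⟩ :
        D.MHom .tight [F.obj a, F.obj b] _) := of_eq_iff.2 (Category.id_comp _).symm
    have h := G.rep.map_comp (D.mθ (F.obj a) (F.obj b)) (F.μ a b)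
    rw [G.rep.map_θ, sub_eq rfl, substM_munary] at h
    exact (h.symm.trans (congrArg G.rep.map e.symm))

/-- The 2-cell of skew multicategories given by a monoidal transformation. -/
noncomputable def MonTrans.trans {F G : LaxFunctor C D} (φ : MonTrans F G) :
    Trans F.rep.functor G.rep.functor :=
  Trans.mk' (fun a => munary (φ.app a)) <| SkewRep.natAt_of_generators
    (fun {a b} f => by
      change D.multicat.sub (Multimap.of (munary (φ.app b))) [_] =
        D.multicat.sub _ [Multimap.of (munary (φ.app a))]
      rw [SkewRep.functor_map_munary, SkewRep.functor_map_munary, sub_eq rfl, sub_eq rfl,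
        substM_munary, substM_munary, of_eq_iff]
      exact φ.naturality f)
    (by
      change D.multicat.sub (Multimap.of (munary (φ.app C.unit))) [_] = D.multicat.sub _ []
      rw [SkewRep.functor_map_θ₀, SkewRep.functor_map_θ₀, sub_eq rfl, substM_munary]
      refine Eq.trans ?_ (sub_one G.rep.θ₀M (Γ := []) rfl).symm
      exact of_eq_iff.2 φ.unit)
    (fun a b => by
      change D.multicat.sub (Multimap.of (munary (φ.app (C.tensor a b)))) [_] =
        D.multicat.sub _ [Multimap.of (munary (φ.app a)), Multimap.of (munary (φ.app b))]
      rw [SkewRep.functor_map_θ, SkewRep.functor_map_θ, sub_eq rfl, sub_eq rfl,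
        substM_munary, substM_pair_unary, of_eq_iff]
      exact φ.tensor a b)

/-- The canonical 2-functor from skew monoidal categories to skew multicategories. -/
noncomputable def toMulticat : StrictPseudofunctor SkewMonCat.{v, u} SkewMulticat.{v, u} :=
  StrictPseudofunctor.mk''
    { obj := fun C => C.multicat
      map := fun F => (LaxFunctor.rep F).functor
      map₂ := fun φ => MonTrans.trans φ
      map₂_id := fun F => rfl
      map₂_comp := fun η θ => by
        refine trans_ext fun a => ?_
        exact (substM_munary (munary (η.app a)) (θ.app a)).symm
      map_id := fun X => rep_functor_id
      map_comp := fun f g => rep_functor_comp f g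
      map₂_whisker_left := fun {a b c} f {g g'} η => by
        refine trans_ext fun x => ?_
        refine Eq.trans ?_ (of_eqToHom_conj_app _ _ _ _).symm
        rfl
      map₂_whisker_right := fun {a b c} {f f'} η g => by
        refine trans_ext fun x => ?_
        refine Eq.trans ?_ (of_eqToHom_conj_app _ _ _ _).symm
        refine Eq.trans ?_ (Functor.of_mapUnary _ _).symm
        exact (SkewRep.functor_map_munary (LaxFunctor.rep g) (MonTrans.app η x)).symm }

end SkewMonCat

/-! ### A criterion for 2-equivalences -/

namespace TwoCat

open Bicategory

variable {B : Type u₁} [Bicategory.{w₁, v₁} B] {C : Type u₂} [Bicategory.{w₂, v₂} C]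

theorem whiskerLeft_heq {a b c : C} {f f' : a ⟶ b} {g g' h h' : b ⟶ c} {η : g ⟶ h} {η' : g' ⟶ h'}
    (hf : f = f') (hg : g = g') (hh : h = h') (hη : η ≍ η') : f ◁ η ≍ f' ◁ η' := by
  subst hf hg hh hη
  rfl

theorem whiskerRight_heq {a b c : C} {f f' h h' : a ⟶ b} {g g' : b ⟶ c} {η : f ⟶ h} {η' : f' ⟶ h'}
    (hf : f = f') (hh : h = h') (hg : g = g') (hη : η ≍ η') : η ▷ g ≍ η' ▷ g' := by
  subst hf hg hh hη
  rfl

section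

variable [Strict C] {a b c d : C}

/-- In a strict 2-category associators and unitors are `eqToHom`s, so the whiskering laws become
heterogeneous equalities without coherence cells. -/
theorem comp_whiskerLeft_heq (f : a ⟶ b) (g : b ⟶ c) {h h' : c ⟶ d} (η : h ⟶ h') :
    (f ≫ g) ◁ η ≍ f ◁ g ◁ η := by
  rw [comp_whiskerLeft, Strict.associator_eqToIso, Strict.associator_eqToIso]
  simp

theorem whiskerRight_comp_heq {f f' : a ⟶ b} (η : f ⟶ f') (g : b ⟶ c) (h : c ⟶ d) :
    η ▷ (g ≫ h) ≍ (η ▷ g) ▷ h := by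
  rw [whiskerRight_comp, Strict.associator_eqToIso, Strict.associator_eqToIso]
  simp

theorem whisker_assoc_heq (f : a ⟶ b) {g g' : b ⟶ c} (η : g ⟶ g') (h : c ⟶ d) :
    (f ◁ η) ▷ h ≍ f ◁ η ▷ h := by
  rw [whisker_assoc, Strict.associator_eqToIso, Strict.associator_eqToIso]
  simp

theorem whiskerRight_id_heq {f g : a ⟶ b} (η : f ⟶ g) : η ▷ 𝟙 b ≍ η := by
  rw [whiskerRight_id, Strict.rightUnitor_eqToIso, Strict.rightUnitor_eqToIso]
  simp

end

theorem map₂_whiskerLeft_heq (F : StrictPseudofunctor B C) {a b c : B} (f : a ⟶ b)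
    {g g' : b ⟶ c} (η : g ⟶ g') : F.map₂ (f ◁ η) ≍ F.map f ◁ F.map₂ η := by
  rw [F.map₂_whisker_left, F.mapComp_eq_eqToIso, F.mapComp_eq_eqToIso]
  simp

theorem map₂_whiskerRight_heq (F : StrictPseudofunctor B C) {a b c : B} {f f' : a ⟶ b}
    (η : f ⟶ f') (g : b ⟶ c) : F.map₂ (η ▷ g) ≍ F.map₂ η ▷ F.map g := by
  rw [F.map₂_whisker_right, F.mapComp_eq_eqToIso, F.mapComp_eq_eqToIso]
  simp

/-- An isomorphism in (the underlying category of) a 2-category. -/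
structure OneIso (X Y : C) where
  hom : X ⟶ Y
  inv : Y ⟶ X
  hom_inv : hom ≫ inv = 𝟙 X
  inv_hom : inv ≫ hom = 𝟙 Y

theorem comp_eqToHom_eq_iff {X Y : C} {f g f' g' : X ⟶ Y} (x : f ⟶ g) (y : f' ⟶ g')
    (h : g = g') (h' : f = f') : x ≫ eqToHom h = eqToHom h' ≫ y ↔ x ≍ y := by
  subst h h'
  simp

theorem map₂_eqToHom_conj (F : StrictPseudofunctor B C) {X Y : B} {f f' g g' : X ⟶ Y}
    (h : f = f') (η : f' ⟶ g') (h' : g' = g) :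
    F.map₂ (eqToHom h ≫ η ≫ eqToHom h') ≍ F.map₂ η := by
  subst h h'
  simp

/-- Data that exhibit a 2-functor as surjective on objects up to isomorphism and bijective on
1-cells and 2-cells. -/
structure EquivData (F : StrictPseudofunctor B C) where
  obj : C → B
  iso (c : C) : OneIso (F.obj (obj c)) c
  lift {X Y : B} (f : F.obj X ⟶ F.obj Y) : X ⟶ Y
  map_lift {X Y : B} (f : F.obj X ⟶ F.obj Y) : F.map (lift f) = f
  map_injective {X Y : B} {f g : X ⟶ Y} (h : F.map f = F.map g) : f = g
  lift₂ {X Y : B} {f g : X ⟶ Y} (η : F.map f ⟶ F.map g) : f ⟶ g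
  map₂_lift₂ {X Y : B} {f g : X ⟶ Y} (η : F.map f ⟶ F.map g) : F.map₂ (lift₂ η) = η
  map₂_injective {X Y : B} {f g : X ⟶ Y} {η θ : f ⟶ g} (h : F.map₂ η = F.map₂ θ) : η = θ

namespace EquivData

variable {F : StrictPseudofunctor B C}

theorem heq_of_map₂_heq (E : EquivData F) {X Y : B} {f g f' g' : X ⟶ Y} {η : f ⟶ g}
    {θ : f' ⟶ g'} (hf : f = f') (hg : g = g') (h : F.map₂ η ≍ F.map₂ θ) : η ≍ θ := by
  subst hf hg
  exact heq_of_eq (E.map₂_injective (eq_of_heq h))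

variable [Strict C] (E : EquivData F)

/-- Conjugation of a 1-cell by the chosen isomorphisms. -/
def conj {c d : C} (f : c ⟶ d) : F.obj (E.obj c) ⟶ F.obj (E.obj d) :=
  (E.iso c).hom ≫ f ≫ (E.iso d).inv

/-- Conjugation of a 2-cell by the chosen isomorphisms. -/
def conj₂ {c d : C} {f g : c ⟶ d} (η : f ⟶ g) : E.conj f ⟶ E.conj g :=
  (E.iso c).hom ◁ η ▷ (E.iso d).inv

theorem conj_id (c : C) : E.conj (𝟙 c) = 𝟙 _ := by
  rw [conj, Strict.id_comp, (E.iso c).hom_inv]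

theorem conj_comp_hom {c d : C} (f : c ⟶ d) :
    E.conj f ≫ (E.iso d).hom = (E.iso c).hom ≫ f := by
  rw [conj, Strict.assoc, Strict.assoc, (E.iso d).inv_hom, Strict.comp_id]

theorem inv_comp_conj {c d : C} (f : c ⟶ d) :
    (E.iso c).inv ≫ E.conj f = f ≫ (E.iso d).inv := by
  rw [conj, ← Strict.assoc, (E.iso c).inv_hom, Strict.id_comp]

theorem conj_comp {c d d' : C} (f : c ⟶ d) (g : d ⟶ d') :
    E.conj (f ≫ g) = E.conj f ≫ E.conj g := by
  rw [conj, conj, Strict.assoc, Strict.assoc, Strict.assoc, inv_comp_conj]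

/-- The inverse at `d` cancels against the isomorphism at `d`. This gives naturality of both the
unit and the counit with respect to 2-cells. -/
theorem conj₂_whiskerRight_hom {c d : C} {f g : c ⟶ d} (η : f ⟶ g) :
    E.conj₂ η ▷ (E.iso d).hom ≍ (E.iso c).hom ◁ η := by
  refine (whisker_assoc_heq _ _ _).trans ?_
  have e : ∀ k : c ⟶ d, (k ≫ (E.iso d).inv) ≫ (E.iso d).hom = k := fun k => by
    rw [Strict.assoc, (E.iso d).inv_hom, Strict.comp_id]
  refine whiskerLeft_heq rfl (e f) (e g) ((whiskerRight_comp_heq _ _ _).symm.trans ?_)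
  exact (whiskerRight_heq rfl rfl (E.iso d).inv_hom HEq.rfl).trans (whiskerRight_id_heq η)

/-- The isomorphism at the intermediate object cancels against its inverse, as in `conj_comp`. -/
theorem conj₂_whiskerLeft {c d d' : C} (f : c ⟶ d) {g g' : d ⟶ d'} (η : g ⟶ g') :
    E.conj₂ (f ◁ η) ≍ E.conj f ◁ E.conj₂ η := by
  refine HEq.trans ?_ (comp_whiskerLeft_heq _ _ _)
  have e : E.conj f ≫ (E.iso d).hom = (E.iso c).hom ≫ f := E.conj_comp_hom f
  refine HEq.trans ?_ (whiskerLeft_heq e rfl rfl HEq.rfl).symm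
  refine HEq.trans ?_ (comp_whiskerLeft_heq _ _ _).symm
  exact whiskerLeft_heq rfl (Strict.assoc _ _ _) (Strict.assoc _ _ _) (whisker_assoc_heq _ _ _)

theorem conj₂_whiskerRight {c d d' : C} {f f' : c ⟶ d} (η : f ⟶ f') (g : d ⟶ d') :
    E.conj₂ (η ▷ g) ≍ E.conj₂ η ▷ E.conj g := by
  refine HEq.trans ?_ (whisker_assoc_heq _ _ _).symm
  have e : ∀ k : c ⟶ d, (k ≫ g) ≫ (E.iso d').inv = (k ≫ (E.iso d).inv) ≫ E.conj g :=
    fun k => by rw [Strict.assoc, Strict.assoc, inv_comp_conj]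
  refine whiskerLeft_heq rfl (e f) (e f') ?_
  refine (whiskerRight_comp_heq _ _ _).symm.trans (HEq.trans ?_ (whiskerRight_comp_heq _ _ _))
  exact whiskerRight_heq rfl rfl (E.inv_comp_conj g).symm HEq.rfl

/-- The action of the inverse on 2-cells. -/
def inverseMap₂ {c d : C} {f g : c ⟶ d} (η : f ⟶ g) :
    E.lift (E.conj f) ⟶ E.lift (E.conj g) :=
  E.lift₂ (eqToHom (E.map_lift _) ≫ E.conj₂ η ≫ eqToHom (E.map_lift _).symm)

theorem map₂_inverseMap₂ {c d : C} {f g : c ⟶ d} (η : f ⟶ g) :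
    F.map₂ (E.inverseMap₂ η) ≍ E.conj₂ η := by
  rw [inverseMap₂, map₂_lift₂]
  simp

theorem conj₂_id {c d : C} (f : c ⟶ d) : E.conj₂ (𝟙 f) = 𝟙 (E.conj f) := by
  rw [conj₂, id_whiskerRight, whiskerLeft_id]
  rfl

theorem conj₂_comp {c d : C} {f g h : c ⟶ d} (η : f ⟶ g) (θ : g ⟶ h) :
    E.conj₂ (η ≫ θ) = E.conj₂ η ≫ E.conj₂ θ := by
  rw [conj₂, comp_whiskerRight, whiskerLeft_comp]
  rfl

/-- The inverse 2-functor. -/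
def inverse [Strict B] (E : EquivData F) : StrictPseudofunctor C B :=
  StrictPseudofunctor.mk''
    { obj := E.obj
      map := fun f => E.lift (E.conj f)
      map₂ := fun η => E.inverseMap₂ η
      map₂_id := fun f => by
        apply E.map₂_injective
        rw [F.map₂_id, inverseMap₂, map₂_lift₂, conj₂_id]
        simp
      map₂_comp := fun η θ => by
        apply E.map₂_injective
        rw [F.map₂_comp, inverseMap₂, inverseMap₂, inverseMap₂, map₂_lift₂, map₂_lift₂,
          map₂_lift₂, conj₂_comp]
        simp
      map_id := fun X => by
        apply E.map_injective
        rw [E.map_lift, conj_id, F.map_id]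
      map_comp := fun f g => by
        apply E.map_injective
        rw [E.map_lift, conj_comp, F.map_comp, E.map_lift, E.map_lift]
      map₂_whisker_left := fun {a b c} f {g g'} η => by
        apply E.map₂_injective
        apply eq_of_heq
        refine (E.map₂_inverseMap₂ _).trans ((E.conj₂_whiskerLeft f η).trans ?_)
        refine HEq.trans ?_ (map₂_eqToHom_conj F _ _ _).symm
        refine HEq.trans ?_ (map₂_whiskerLeft_heq F _ _).symm
        exact (whiskerLeft_heq (E.map_lift _) (E.map_lift _) (E.map_lift _)
          (E.map₂_inverseMap₂ η)).symm
      map₂_whisker_right := fun {a b c} {f f'} η g => by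
        apply E.map₂_injective
        apply eq_of_heq
        refine (E.map₂_inverseMap₂ _).trans ((E.conj₂_whiskerRight η g).trans ?_)
        refine HEq.trans ?_ (map₂_eqToHom_conj F _ _ _).symm
        refine HEq.trans ?_ (map₂_whiskerRight_heq F _ _).symm
        exact (whiskerRight_heq (E.map_lift _) (E.map_lift _) (E.map_lift _)
          (E.map₂_inverseMap₂ η)).symm }

theorem lift_naturality {a b : B} (f : a ⟶ b) :
    E.lift (E.conj (F.map f)) ≫ E.lift (E.iso (F.obj b)).hom =
      E.lift (E.iso (F.obj a)).hom ≫ f := by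
  apply E.map_injective
  rw [F.map_comp, F.map_comp, E.map_lift, E.map_lift, E.map_lift, conj_comp_hom]

theorem lift_comp_lift {X Y : B} {f : F.obj X ⟶ F.obj Y} {g : F.obj Y ⟶ F.obj X}
    (h : f ≫ g = 𝟙 (F.obj X)) : E.lift f ≫ E.lift g = 𝟙 X := by
  apply E.map_injective
  rw [F.map_comp, E.map_lift, E.map_lift, h, F.map_id]

theorem lift_naturality₂ {a b : B} {f g : a ⟶ b} (η : f ⟶ g) :
    E.inverseMap₂ (F.map₂ η) ▷ E.lift (E.iso (F.obj b)).hom ≍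
      E.lift (E.iso (F.obj a)).hom ◁ η := by
  refine E.heq_of_map₂_heq (E.lift_naturality f) (E.lift_naturality g) ?_
  refine (map₂_whiskerRight_heq F _ _).trans (HEq.trans ?_ (map₂_whiskerLeft_heq F _ _).symm)
  refine (whiskerRight_heq (E.map_lift _) (E.map_lift _) (E.map_lift _)
    (E.map₂_inverseMap₂ _)).trans ?_
  refine (E.conj₂_whiskerRight_hom _).trans ?_
  exact whiskerLeft_heq (E.map_lift _).symm rfl rfl HEq.rfl

/-- The unit of the 2-equivalence. -/
def unitIso [Strict B] (E : EquivData F) :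
    TwoNatIso (F.comp E.inverse) (StrictPseudofunctor.id B) where
  app b := E.lift (E.iso (F.obj b)).hom
  inv b := E.lift (E.iso (F.obj b)).inv
  app_inv b := E.lift_comp_lift (E.iso (F.obj b)).hom_inv
  inv_app b := E.lift_comp_lift (E.iso (F.obj b)).inv_hom
  naturality f := E.lift_naturality f
  naturality₂ {a b f g} η := (comp_eqToHom_eq_iff (X := E.obj (F.obj a)) (Y := b)
    (E.inverseMap₂ (F.map₂ η) ▷ E.lift (E.iso (F.obj b)).hom)
    (E.lift (E.iso (F.obj a)).hom ◁ η) (E.lift_naturality g) (E.lift_naturality f)).2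
      (E.lift_naturality₂ η)

theorem map_lift_conj_comp_hom {a b : C} (f : a ⟶ b) :
    F.map (E.lift (E.conj f)) ≫ (E.iso b).hom = (E.iso a).hom ≫ f := by
  rw [E.map_lift, conj_comp_hom]

/-- The counit of the 2-equivalence. -/
def counitIso [Strict B] (E : EquivData F) :
    TwoNatIso (E.inverse.comp F) (StrictPseudofunctor.id C) where
  app c := (E.iso c).hom
  inv c := (E.iso c).inv
  app_inv c := (E.iso c).hom_inv
  inv_app c := (E.iso c).inv_hom
  naturality f := E.map_lift_conj_comp_hom f
  naturality₂ {a b f g} η := (comp_eqToHom_eq_iff (X := F.obj (E.obj a)) (Y := b)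
    (F.map₂ (E.inverseMap₂ η) ▷ (E.iso b).hom) ((E.iso a).hom ◁ η)
    (E.map_lift_conj_comp_hom g) (E.map_lift_conj_comp_hom f)).2
      ((whiskerRight_heq (E.map_lift _) (E.map_lift _) rfl (E.map₂_inverseMap₂ _)).trans
        (E.conj₂_whiskerRight_hom η))

theorem isTwoEquivalence [Strict B] (E : EquivData F) : IsTwoEquivalence F :=
  ⟨E.inverse, ⟨E.unitIso⟩, ⟨E.counitIso⟩⟩

end EquivData

end TwoCat

/-! ### Universal multimaps in the skew multicategory of a skew monoidal category -/

namespace SkewMonCat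

open SkewMulticat

variable {C : SkewMonCat.{v, u}}

/-- By `substM_munary`, substituting `θ` into a unary map is precomposition with its underlying
morphism; the next lemma is the converse. -/
theorem isUniversal_of_inverse {k : SkewKind} {Γ : List C.Obj} {m : C.Obj} (θ : C.MHom k Γ m)
    (p : m ⟶ C.st k Γ) (h₁ : θ.1 ≫ p = 𝟙 _) (h₂ : p ≫ θ.1 = 𝟙 _) :
    C.multicat.IsUniversal (Multimap.of θ) := by
  rintro ⟨k', Γ', b, g⟩ hk hΓ
  dsimp at hk hΓ
  subst hk hΓ
  refine ⟨munary (p ≫ g.1), ?_, fun f hf => ?_⟩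
  · refine (substM_munary _ _).trans (of_eq_iff.2 ?_)
    rw [← Category.assoc, h₁, Category.id_comp]
  · have := of_eq_iff.1 ((substM_munary θ f.1).symm.trans hf)
    apply Subtype.ext
    change f.1 = p ≫ g.1
    rw [← this, ← Category.assoc, h₂, Category.id_comp]

/-- The Yoneda argument: existence at the identity of the source object gives `p`, and uniqueness at
`θ` itself makes `p` a two-sided inverse. -/
theorem exists_inverse_of_isUniversal {θ : C.MMap} (h : C.multicat.IsUniversal θ) :
    ∃ p : θ.tgt ⟶ C.st θ.kind θ.src, θ.map.1 ≫ p = 𝟙 _ ∧ p ≫ θ.map.1 = 𝟙 _ := by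
  obtain ⟨p, hp, -⟩ := h (Multimap.of (⟨𝟙 _, θ.map.2⟩ : C.MHom θ.kind θ.src _)) rfl rfl
  have h₁ : θ.map.1 ≫ p.1 = 𝟙 _ := of_eq_iff.1 ((substM_munary θ.map p.1).symm.trans hp)
  obtain ⟨_, -, hq⟩ := h θ rfl rfl
  have e₁ := hq (munary (p.1 ≫ θ.map.1)) ((substM_munary θ.map _).trans
    (of_eq_iff.2 (by rw [← Category.assoc, h₁, Category.id_comp])))
  have e₂ := hq (munary (𝟙 _)) ((substM_munary θ.map _).trans
    (of_eq_iff.2 (Category.comp_id _)))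
  exact ⟨p.1, h₁, congrArg Subtype.val (e₁.trans e₂.symm)⟩

theorem sub_ones_heq (θ : C.MMap) {Δ : List C.Obj} {c : C.Obj}
    (f : C.MHom .tight (θ.tgt :: Δ) c) :
    C.multicat.substM (Multimap.of f) (θ :: Δ.map C.multicat.oneM)
        (C.multicat.tgt_cons_one θ Δ) =
      Multimap.of (⟨eqToHom (st_append _ _ _ θ.map.2) ≫ C.foldMap θ.map.1 Δ ≫ f.1,
        fun h h' => θ.map.2 h (List.append_eq_nil_iff.1 h').1⟩ :
          C.MHom θ.kind (θ.src ++ Δ) c) := by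
  have e : C.rep.ones Δ = Δ.map C.multicat.oneM := by simp [SkewRep.ones]
  have h := sub_rep_ones θ Δ
  rw [e] at h
  have hf : (Multimap.of f : C.MMap) = C.multicat.sub (Multimap.of (munary f.1))
      [Multimap.of (⟨𝟙 _, by simp⟩ : C.MHom .tight (θ.tgt :: Δ) (C.fold θ.tgt Δ))] := by
    rw [sub_eq rfl, substM_munary, of_eq_iff]
    exact (Category.id_comp _).symm
  rw [← sub_eq, hf, ← sub_unary rfl (C.multicat.tgt_cons_one θ Δ), h, sub_eq rfl, substM_munary,
    of_eq_iff, Category.assoc]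

/-- Extra arguments apply the functor `C.foldMap · Δ` to the underlying morphism of `θ`, and
functors preserve invertibility. -/
theorem isLeftUniversal_of_isUniversal {θ : C.MMap} (h : C.multicat.IsUniversal θ) :
    C.multicat.IsLeftUniversal θ := by
  obtain ⟨p, h₁, h₂⟩ := exists_inverse_of_isUniversal h
  rintro Δ ⟨k', Γ', b, g⟩ hk hΓ
  dsimp at hk hΓ
  subst hk hΓ
  refine ⟨⟨C.foldMap p Δ ≫ eqToHom (st_append _ _ _ θ.map.2).symm ≫ g.1, by simp⟩, ?_,
    fun f hf => ?_⟩
  · refine (sub_ones_heq _ _).trans (of_eq_iff.2 ?_)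
    change eqToHom _ ≫ C.foldMap θ.map.1 Δ ≫ C.foldMap p Δ ≫ _ = _
    rw [← Category.assoc (C.foldMap _ _), ← foldMap_comp, h₁, foldMap_id, Category.id_comp,
      eqToHom_trans_assoc, eqToHom_refl, Category.id_comp]
  · have := of_eq_iff.1 ((sub_ones_heq _ f).symm.trans hf)
    apply Subtype.ext
    change f.1 = _
    rw [← this, eqToHom_trans_assoc, eqToHom_refl, Category.id_comp, ← Category.assoc,
      ← foldMap_comp, h₂, foldMap_id, Category.id_comp]

theorem multicat_isLeftRepresentable (C : SkewMonCat.{v, u}) :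
    C.multicat.IsLeftRepresentable :=
  ⟨fun k Γ h => ⟨C.st k Γ, ⟨𝟙 _, h⟩,
    isUniversal_of_inverse _ (𝟙 _) (Category.comp_id _) (Category.comp_id _)⟩,
    fun _ => isLeftUniversal_of_isUniversal⟩

/-- A skew monoidal category is associated with its skew multicategory. -/
def association (C : SkewMonCat.{v, u}) : Association C C.multicat where
  obj := Equiv.refl _
  hom := ⟨munary, fun f => f.1, fun _ => rfl, fun _ => rfl⟩
  hom_id := C.rep.hom_id
  hom_comp := C.rep.hom_comp
  θ₀ := C.mθ₀
  θ₀_universal :=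
    isUniversal_of_inverse _ (𝟙 _) (Category.comp_id _) (Category.comp_id _)
  θ := C.mθ
  θ_universal _ _ :=
    isUniversal_of_inverse _ (𝟙 _) (Category.comp_id _) (Category.comp_id _)
  hom_tensorMap := C.rep.hom_tensorMap
  hom_α := C.rep.hom_α
  hom_l := C.rep.hom_l
  hom_ρ := C.rep.hom_ρ

theorem toMulticat_isCanonical : IsCanonical toMulticat.{v, u} := by
  refine ⟨association, fun C D F => ⟨fun a => rfl, fun a b f => ?_, ?_, fun a b => ?_⟩,
    fun C D F G φ a => rfl⟩
  · exact SkewRep.functor_map_munary (LaxFunctor.rep F) f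
  · refine (SkewRep.functor_map_θ₀ (LaxFunctor.rep F)).trans ?_
    exact (of_eq_iff.2 (Category.id_comp _).symm).trans (substM_munary D.mθ₀ F.ε).symm
  · refine (SkewRep.functor_map_θ (LaxFunctor.rep F) a b).trans ?_
    exact (of_eq_iff.2 (Category.id_comp _).symm).trans
      (substM_munary (D.mθ (F.obj a) (F.obj b)) (F.μ a b)).symm

end SkewMonCat

/-! ### The skew monoidal category of a left representable skew multicategory -/

namespace SkewMulticat

variable {A : SkewMulticat.{v, u}}

theorem isUniversal_iff {θ : A.Map} : A.IsUniversal θ ↔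
    ∀ k : A.Map, k.kind = θ.kind → k.src = θ.src →
      ∃! f : A.Hom .tight [θ.tgt] k.tgt, A.sub (Multimap.of f) [θ] = k :=
  forall_congr' fun k => forall_congr' fun _ => forall_congr' fun _ =>
    existsUnique_congr fun f => by rw [sub_eq (g := Multimap.of f) (fs := [θ]) rfl]

theorem isLeftUniversal_iff {θ : A.Map} : A.IsLeftUniversal θ ↔
    ∀ (Δ : List A.Obj) (k : A.Map), k.kind = θ.kind → k.src = θ.src ++ Δ →
      ∃! f : A.Hom .tight (θ.tgt :: Δ) k.tgt,
        A.sub (Multimap.of f) (θ :: Δ.map A.oneM) = k :=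
  forall_congr' fun Δ => forall_congr' fun k => forall_congr' fun _ => forall_congr' fun _ =>
    existsUnique_congr fun f => by rw [sub_eq (g := Multimap.of f) (A.tgt_cons_one θ Δ)]

/-- Composition of a unary map with a multimap. -/
noncomputable def ap {a b : A.Obj} (f : A.Hom .tight [a] b) (x : A.Map) : A.Map :=
  A.sub (Multimap.of f) [x]

@[simp]
theorem ap_tgt {a b : A.Obj} (f : A.Hom .tight [a] b) (x : A.Map) : (ap f x).tgt = b :=
  sub_tgt _ _

theorem ap_kind {a b : A.Obj} (f : A.Hom .tight [a] b) (x : A.Map) (hx : x.tgt = a) :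
    (ap f x).kind = x.kind :=
  (sub_kind (by simp [hx])).trans (SkewKind.comp_tight_cons _ _)

theorem ap_src {a b : A.Obj} (f : A.Hom .tight [a] b) (x : A.Map) (hx : x.tgt = a) :
    (ap f x).src = x.src :=
  (sub_src (by simp [hx])).trans (by simp)

theorem ap_unaryComp {a b c : A.Obj} (f : A.Hom .tight [a] b) (g : A.Hom .tight [b] c)
    (x : A.Map) (hx : x.tgt = a) : ap (A.unaryComp f g) x = ap g (ap f x) := by
  have e : Multimap.of (A.unaryComp f g) = A.sub (Multimap.of g) [Multimap.of f] :=
    (sub_eq (g := Multimap.of g) rfl).symm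
  rw [ap, e, ← sub_unary_unary rfl (by simp [hx])]
  rfl

theorem ap_one (a : A.Obj) (x : A.Map) (hx : x.tgt = a) : ap (A.one a) x = x := one_sub x hx

theorem ap_oneM {a b : A.Obj} (f : A.Hom .tight [a] b) : ap f (A.oneM a) = Multimap.of f :=
  sub_one (Multimap.of f) (Γ := [a]) rfl

theorem ap_loosen {a b : A.Obj} (f : A.Hom .tight [a] b) (x : A.Map) (hx : x.tgt = a) :
    ap f (A.loosen x) = A.loosen (ap f x) :=
  sub_loosen (by simp [hx])

theorem IsUniversal.hom_ext {θ : A.Map} (hθ : A.IsUniversal θ) {a b : A.Obj} (ha : θ.tgt = a)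
    {f g : A.Hom .tight [a] b} (h : ap f θ = ap g θ) : f = g := by
  subst ha
  have := isUniversal_iff.1 hθ (ap g θ) (ap_kind _ _ rfl) (ap_src _ _ rfl)
  rw [ap_tgt] at this
  exact this.unique h rfl

theorem IsUniversal.exists_ap_eq {θ : A.Map} (hθ : A.IsUniversal θ) (k : A.Map) {a b : A.Obj}
    (hk : k.kind = θ.kind) (hs : k.src = θ.src) (ha : θ.tgt = a) (hb : k.tgt = b) :
    ∃ f : A.Hom .tight [a] b, ap f θ = k := by
  subst ha hb
  exact (isUniversal_iff.1 hθ k hk hs).exists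

theorem isUniversal_oneM (a : A.Obj) : A.IsUniversal (A.oneM a) := by
  rintro ⟨k, Γ, b, f⟩ hk hΓ
  dsimp at hk hΓ
  subst hk hΓ
  exact ⟨f, A.subst_one (Multimap.of f) rfl, fun g hg =>
    Multimap.of_inj ((A.subst_one (Multimap.of g) rfl).symm.trans hg)⟩

/-- The composite of two bijections: left universality of `θ` removes the inner substitution and
universality of `φ` the outer one. This is where left universality does its work. -/
theorem IsUniversal.comp {θ φ : A.Map} (hφ : A.IsUniversal φ) (hθ : A.IsLeftUniversal θ)
    {Δ : List A.Obj} (hk : φ.kind = .tight) (hs : φ.src = θ.tgt :: Δ) :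
    A.IsUniversal (A.sub φ (θ :: Δ.map A.oneM)) := by
  have h₁ : (θ :: Δ.map A.oneM).map Multimap.tgt = φ.src := (A.tgt_cons_one θ Δ).trans hs.symm
  refine isUniversal_iff.2 fun k hk' hs' => ?_
  have hk₂ : k.kind = θ.kind := by
    rw [hk', sub_kind h₁, hk, List.map_cons, SkewKind.comp_tight_cons]
  have hs₂ : k.src = θ.src ++ Δ := by
    rw [hs', sub_src h₁, List.flatMap_cons]
    simp [List.flatMap_map]
  obtain ⟨f, hf, hf'⟩ := isLeftUniversal_iff.1 hθ Δ k hk₂ hs₂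
  obtain ⟨g, hg, hg'⟩ := isUniversal_iff.1 hφ (Multimap.of f) hk.symm hs.symm
  rw [sub_tgt]
  refine ⟨g, ?_, fun g' h => ?_⟩
  · dsimp only
    rw [sub_unary rfl h₁, hg, hf]
  · refine hg' g' ?_
    rcases φ with ⟨_, _, m, φ⟩
    dsimp at hk hs
    subst hk hs
    -- Uniqueness for `θ` concerns multimaps with source literally `θ.tgt :: Δ`, whereas
    -- substitution yields a concatenation with `[]`.
    let f' : A.Hom .tight (θ.tgt :: Δ) k.tgt := castSrc (by simp) (A.subst g' [Multimap.of φ] rfl)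
    have e : Multimap.of f' = A.sub (Multimap.of g') [Multimap.of φ] :=
      (of_castSrc _ _).trans (sub_eq (g := Multimap.of g') rfl).symm
    have := hf' f' (by dsimp only; rw [e, ← sub_unary rfl h₁, h])
    exact e.symm.trans (congrArg _ this)

/-- A choice of universal nullary and binary multimaps in a left representable skew
multicategory. -/
structure UnivData (A : SkewMulticat.{v, u}) where
  leftUniversal {θ : A.Map} : A.IsUniversal θ → A.IsLeftUniversal θ
  unit : A.Obj
  θ₀ : A.Hom .loose [] unit
  θ₀_universal : A.IsUniversal (Multimap.of θ₀)
  tensor : A.Obj → A.Obj → A.Obj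
  θ (a b : A.Obj) : A.Hom .tight [a, b] (tensor a b)
  θ_universal (a b : A.Obj) : A.IsUniversal (Multimap.of (θ a b))

theorem IsLeftRepresentable.nonempty_univData (h : A.IsLeftRepresentable) :
    Nonempty (UnivData A) := by
  obtain ⟨i, θ₀, h₀⟩ := h.1 .loose [] nofun
  choose T θ hθ using fun a b => h.1 .tight [a, b] (by simp)
  exact ⟨⟨h.2 _, i, θ₀, h₀, T, θ, hθ⟩⟩

namespace UnivData

variable (U : UnivData A)

/-- The composite of a universal binary multimap with two multimaps. -/
noncomputable def pair (a b : A.Obj) (x y : A.Map) : A.Map :=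
  A.sub (Multimap.of (U.θ a b)) [x, y]

/-- The universal nullary multimap, bundled. -/
def θ₀M : A.Map := Multimap.of U.θ₀

@[simp]
theorem θ₀M_tgt : U.θ₀M.tgt = U.unit := by
  rfl

@[simp]
theorem pair_tgt (a b : A.Obj) (x y : A.Map) : (U.pair a b x y).tgt = U.tensor a b := sub_tgt _ _

theorem pair_kind {a b : A.Obj} (x y : A.Map) (hx : x.tgt = a) (hy : y.tgt = b) :
    (U.pair a b x y).kind = x.kind :=
  (sub_kind (by simp [hx, hy])).trans (SkewKind.comp_tight_cons _ _)

theorem pair_src {a b : A.Obj} (x y : A.Map) (hx : x.tgt = a) (hy : y.tgt = b) :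
    (U.pair a b x y).src = x.src ++ y.src :=
  (sub_src (by simp [hx, hy])).trans (by simp)

theorem pair_one (a b : A.Obj) :
    U.pair a b (A.oneM a) (A.oneM b) = Multimap.of (U.θ a b) :=
  sub_one (Multimap.of (U.θ a b)) (Γ := [a, b]) rfl

theorem ap_pair {a b c : A.Obj} (f : A.Hom .tight [U.tensor a b] c) (x y : A.Map)
    (hx : x.tgt = a) (hy : y.tgt = b) :
    ap f (U.pair a b x y) = A.sub (ap f (Multimap.of (U.θ a b))) [x, y] :=
  sub_unary rfl (by simp [hx, hy])

theorem pair_sub_pair {a b : A.Obj} {x y : A.Map} (fs fs' : List A.Map) (hx : x.tgt = a)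
    (hy : y.tgt = b) (h : fs.map Multimap.tgt = x.src) (h' : fs'.map Multimap.tgt = y.src) :
    A.sub (U.pair a b x y) (fs ++ fs') = U.pair a b (A.sub x fs) (A.sub y fs') :=
  sub_pair (by simp [hx, hy]) h h'

theorem sub_θ₀M : A.sub U.θ₀M [] = U.θ₀M := sub_one U.θ₀M (Γ := []) rfl

theorem isUniversal_pair {a : A.Obj} (b : A.Obj) {x : A.Map} (hx : A.IsUniversal x)
    (ha : x.tgt = a) : A.IsUniversal (U.pair a b x (A.oneM b)) :=
  (U.θ_universal a b).comp (Δ := [b]) (U.leftUniversal hx) rfl (by rw [ha])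

theorem isUniversal_pair_one (a b : A.Obj) :
    A.IsUniversal (U.pair a b (A.oneM a) (A.oneM b)) :=
  U.isUniversal_pair b (isUniversal_oneM a) rfl

theorem pair_loosen_left {a b : A.Obj} (x y : A.Map) (hx : x.tgt = a) (hy : y.tgt = b) :
    U.pair a b (A.loosen x) y = A.loosen (U.pair a b x y) :=
  sub_loosen (by simp [hx, hy])

theorem pair_loosen_right {a b : A.Obj} (x y : A.Map) (hx : x.tgt = a) (hy : y.tgt = b) :
    U.pair a b x (A.loosen y) = U.pair a b x y := by
  rw [pair, pair, sub_eq (by simp [hx, hy]), sub_eq (by simp [hx, hy])]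
  exact A.subst_loosen_tail (Multimap.of (U.θ a b)) x y [] [] _ _

/-- The action of the tensor product on unary maps. -/
noncomputable def tensorMap {a a' b b' : A.Obj} (f : A.Hom .tight [a] a')
    (g : A.Hom .tight [b] b') : A.Hom .tight [U.tensor a b] (U.tensor a' b') :=
  ((U.θ_universal a b).exists_ap_eq (a := U.tensor a b) (b := U.tensor a' b')
    (U.pair a' b' (Multimap.of f) (Multimap.of g))
    (sub_kind rfl) (sub_src rfl) rfl (sub_tgt _ _)).choose

theorem ap_tensorMap {a a' b b' : A.Obj} (f : A.Hom .tight [a] a') (g : A.Hom .tight [b] b')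
    (x y : A.Map) (hx : x.tgt = a) (hy : y.tgt = b) :
    ap (U.tensorMap f g) (U.pair a b x y) = U.pair a' b' (ap f x) (ap g y) := by
  have h : ap (U.tensorMap f g) (Multimap.of (U.θ a b)) =
      U.pair a' b' (Multimap.of f) (Multimap.of g) :=
    ((U.θ_universal a b).exists_ap_eq (a := U.tensor a b) (b := U.tensor a' b') _
      (sub_kind rfl) (sub_src rfl) rfl (sub_tgt _ _)).choose_spec
  rw [ap_pair _ _ _ _ hx hy, h]
  exact U.pair_sub_pair [x] [y] rfl rfl (by simp [hx]) (by simp [hy])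

theorem exists_α (a b c : A.Obj) :
    ∃ f : A.Hom .tight [U.tensor (U.tensor a b) c] (U.tensor a (U.tensor b c)),
      ap f (U.pair (U.tensor a b) c (Multimap.of (U.θ a b)) (A.oneM c)) =
        U.pair a (U.tensor b c) (A.oneM a) (Multimap.of (U.θ b c)) :=
  (U.isUniversal_pair (a := U.tensor a b) c (U.θ_universal a b) rfl).exists_ap_eq _
    ((U.pair_kind _ _ rfl rfl).trans
      (U.pair_kind (Multimap.of (U.θ a b)) (A.oneM c) rfl rfl).symm)
    ((U.pair_src _ _ rfl rfl).trans
      (U.pair_src (Multimap.of (U.θ a b)) (A.oneM c) rfl rfl).symm) (sub_tgt _ _) (sub_tgt _ _)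

/-- The associativity map. -/
noncomputable def α (a b c : A.Obj) :
    A.Hom .tight [U.tensor (U.tensor a b) c] (U.tensor a (U.tensor b c)) :=
  (U.exists_α a b c).choose

/-- The defining equation of `α` with arbitrary multimaps substituted into it. In this form, as in
`ap_tensorMap`, `ap_l` and `ap_ρ`, structure maps are evaluated on generalized elements, and the
axioms reduce to `simp` computations. -/
theorem ap_α (a b c : A.Obj) (x y z : A.Map) (hx : x.tgt = a) (hy : y.tgt = b) (hz : z.tgt = c) :
    ap (U.α a b c) (U.pair (U.tensor a b) c (U.pair a b x y) z) =
      U.pair a (U.tensor b c) x (U.pair b c y z) := by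
  have h : ap (U.α a b c) (U.pair (U.tensor a b) c (Multimap.of (U.θ a b)) (A.oneM c)) =
      U.pair a (U.tensor b c) (A.oneM a) (Multimap.of (U.θ b c)) :=
    (U.exists_α a b c).choose_spec
  have h₁ := congrArg (fun m => A.sub m [x, y, z]) h
  have h₂ := U.pair_sub_pair (x := Multimap.of (U.θ a b)) (y := A.oneM c) [x, y] [z] rfl rfl
    (by simp [hx, hy]) (by simp [hz])
  have h₃ := U.pair_sub_pair (x := A.oneM a) (y := Multimap.of (U.θ b c)) [x] [y, z] rfl rfl
    (by simp [hx]) (by simp [hy, hz])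
  rw [one_sub x hx] at h₃
  rw [one_sub z hz] at h₂
  refine Eq.trans ?_ (h₁.trans h₃)
  rw [ap, ap, ← sub_unary (by simp) (by rw [pair, sub_src rfl]; simp [hx, hy, hz])]
  exact congrArg (fun m => A.sub _ [m]) h₂.symm

theorem exists_l (a : A.Obj) : ∃ f : A.Hom .tight [U.tensor U.unit a] a,
    ap f (U.pair U.unit a U.θ₀M (A.oneM a)) = A.loosen (A.oneM a) :=
  (U.isUniversal_pair (a := U.unit) (x := U.θ₀M) a U.θ₀_universal rfl).exists_ap_eq _
    (U.pair_kind U.θ₀M (A.oneM a) rfl rfl).symm (U.pair_src U.θ₀M (A.oneM a) rfl rfl).symm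
    (sub_tgt _ _) rfl

/-- The left unit map. -/
noncomputable def l (a : A.Obj) : A.Hom .tight [U.tensor U.unit a] a :=
  (U.exists_l a).choose

theorem ap_l (a : A.Obj) (x : A.Map) (hx : x.tgt = a) :
    ap (U.l a) (U.pair U.unit a U.θ₀M x) = A.loosen x := by
  have h : ap (U.l a) (U.pair U.unit a U.θ₀M (A.oneM a)) = A.loosen (A.oneM a) :=
    (U.exists_l a).choose_spec
  have h₁ := congrArg (fun m => A.sub m [x]) h
  have h₂ := U.pair_sub_pair (x := U.θ₀M) (y := A.oneM a) [] [x] rfl rfl rfl (by simp [hx])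
  rw [loosen_sub (by simp [hx]), one_sub x hx] at h₁
  rw [one_sub x hx, sub_θ₀M] at h₂
  rw [← h₁, ap, ap, ← sub_unary (by simp) (by rw [pair, sub_src rfl]; simp [hx, θ₀M])]
  exact congrArg (fun m => A.sub _ [m]) h₂.symm

/-- The right unit map. -/
def ρ (a : A.Obj) : A.Hom .tight [a] (U.tensor a U.unit) :=
  A.subst (U.θ a U.unit) [A.oneM a, Multimap.of U.θ₀] rfl

theorem ap_ρ (a : A.Obj) (x : A.Map) (hx : x.tgt = a) :
    ap (U.ρ a) x = U.pair a U.unit x U.θ₀M := by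
  have h := U.pair_sub_pair (x := A.oneM a) (y := U.θ₀M) [x] [] rfl rfl (by simp [hx]) rfl
  rw [one_sub x hx, sub_θ₀M] at h
  exact (congrArg (fun m => A.sub m [x]) (sub_eq rfl).symm).trans h

/-- The extensionality lemmas from here on correspond to the sources occurring in the axioms: each
gives a universal multimap on which two unary maps out of that object can be compared. -/
theorem ext_one {a b : A.Obj} {f g : A.Hom .tight [a] b}
    (h : ap f (A.oneM a) = ap g (A.oneM a)) : f = g :=
  (isUniversal_oneM a).hom_ext rfl h

theorem ext_pair {a b c : A.Obj} {f g : A.Hom .tight [U.tensor a b] c}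
    (h : ap f (U.pair a b (A.oneM a) (A.oneM b)) = ap g (U.pair a b (A.oneM a) (A.oneM b))) :
    f = g :=
  (U.isUniversal_pair_one a b).hom_ext (U.pair_tgt ..) h

theorem ext_pair₃ {a b c d : A.Obj} {f g : A.Hom .tight [U.tensor (U.tensor a b) c] d}
    (h : ap f (U.pair (U.tensor a b) c (U.pair a b (A.oneM a) (A.oneM b)) (A.oneM c)) =
      ap g (U.pair (U.tensor a b) c (U.pair a b (A.oneM a) (A.oneM b)) (A.oneM c))) : f = g :=
  (U.isUniversal_pair c (U.isUniversal_pair_one a b) (U.pair_tgt ..)).hom_ext (U.pair_tgt ..) h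

theorem ext_pair₄ {a b c d e : A.Obj}
    {f g : A.Hom .tight [U.tensor (U.tensor (U.tensor a b) c) d] e}
    (h : ap f (U.pair (U.tensor (U.tensor a b) c) d
        (U.pair (U.tensor a b) c (U.pair a b (A.oneM a) (A.oneM b)) (A.oneM c)) (A.oneM d)) =
      ap g (U.pair (U.tensor (U.tensor a b) c) d
        (U.pair (U.tensor a b) c (U.pair a b (A.oneM a) (A.oneM b)) (A.oneM c)) (A.oneM d))) :
    f = g :=
  (U.isUniversal_pair d (U.isUniversal_pair c (U.isUniversal_pair_one a b) (U.pair_tgt ..))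
    (U.pair_tgt ..)).hom_ext (U.pair_tgt ..) h

theorem ext_unit {a : A.Obj} {f g : A.Hom .tight [U.unit] a}
    (h : ap f U.θ₀M = ap g U.θ₀M) : f = g :=
  IsUniversal.hom_ext (θ := U.θ₀M) U.θ₀_universal rfl h

theorem ext_unit_pair {a b : A.Obj} {f g : A.Hom .tight [U.tensor U.unit a] b}
    (h : ap f (U.pair U.unit a U.θ₀M (A.oneM a)) = ap g (U.pair U.unit a U.θ₀M (A.oneM a))) :
    f = g :=
  (U.isUniversal_pair a (x := U.θ₀M) U.θ₀_universal rfl).hom_ext (U.pair_tgt ..) h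

theorem ext_unit_pair₃ {a b c : A.Obj}
    {f g : A.Hom .tight [U.tensor (U.tensor U.unit a) b] c}
    (h : ap f (U.pair (U.tensor U.unit a) b (U.pair U.unit a U.θ₀M (A.oneM a)) (A.oneM b)) =
      ap g (U.pair (U.tensor U.unit a) b (U.pair U.unit a U.θ₀M (A.oneM a)) (A.oneM b))) : f = g :=
  (U.isUniversal_pair b (U.isUniversal_pair a (x := U.θ₀M) U.θ₀_universal rfl)
    (U.pair_tgt ..)).hom_ext (U.pair_tgt ..) h

/-- The underlying category of a skew multicategory. -/
@[reducible]
def _root_.SkewMulticat.underlying (A : SkewMulticat.{v, u}) : Category.{v} A.Obj where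
  Hom a b := A.Hom .tight [a] b
  id a := A.one a
  comp f g := A.unaryComp f g
  id_comp f := A.one_unaryComp f
  comp_id f := A.unaryComp_one f
  assoc f g h := A.unaryComp_assoc f g h

theorem tensorMap_one (a b : A.Obj) :
    U.tensorMap (A.one a) (A.one b) = A.one (U.tensor a b) :=
  U.ext_pair (by simp [ap_tensorMap, ap_one])

theorem tensorMap_unaryComp {a a' a'' b b' b'' : A.Obj} (f : A.Hom .tight [a] a')
    (f' : A.Hom .tight [a'] a'') (g : A.Hom .tight [b] b') (g' : A.Hom .tight [b'] b'') :
    U.tensorMap (A.unaryComp f f') (A.unaryComp g g') =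
      A.unaryComp (U.tensorMap f g) (U.tensorMap f' g') :=
  U.ext_pair (by simp [ap_tensorMap, ap_unaryComp])

theorem α_natural {a a' b b' c c' : A.Obj} (f : A.Hom .tight [a] a') (g : A.Hom .tight [b] b')
    (h : A.Hom .tight [c] c') :
    A.unaryComp (U.tensorMap (U.tensorMap f g) h) (U.α a' b' c') =
      A.unaryComp (U.α a b c) (U.tensorMap f (U.tensorMap g h)) :=
  U.ext_pair₃ (by simp [ap_tensorMap, ap_unaryComp, ap_α])

theorem l_natural {a a' : A.Obj} (f : A.Hom .tight [a] a') :
    A.unaryComp (U.tensorMap (A.one U.unit) f) (U.l a') = A.unaryComp (U.l a) f :=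
  U.ext_unit_pair (by simp [ap_tensorMap, ap_unaryComp, ap_l, ap_one, ap_loosen])

theorem ρ_natural {a a' : A.Obj} (f : A.Hom .tight [a] a') :
    A.unaryComp f (U.ρ a') = A.unaryComp (U.ρ a) (U.tensorMap f (A.one U.unit)) :=
  ext_one (by simp [ap_tensorMap, ap_unaryComp, ap_ρ, ap_one])

theorem pentagon (a b c d : A.Obj) :
    A.unaryComp (U.tensorMap (U.α a b c) (A.one d))
        (A.unaryComp (U.α a (U.tensor b c) d) (U.tensorMap (A.one a) (U.α b c d))) =
      A.unaryComp (U.α (U.tensor a b) c d) (U.α a b (U.tensor c d)) :=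
  U.ext_pair₄ (by simp [ap_tensorMap, ap_unaryComp, ap_α, ap_one])

theorem α_l (a b : A.Obj) :
    A.unaryComp (U.α U.unit a b) (U.l (U.tensor a b)) = U.tensorMap (U.l a) (A.one b) :=
  U.ext_unit_pair₃
    (by simp [ap_tensorMap, ap_unaryComp, ap_α, ap_one, ap_l, pair_loosen_left])

theorem ρ_α (a b : A.Obj) :
    A.unaryComp (U.ρ (U.tensor a b)) (U.α a b U.unit) = U.tensorMap (A.one a) (U.ρ b) :=
  U.ext_pair (by simp [ap_tensorMap, ap_unaryComp, ap_α, ap_one, ap_ρ])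

/-- The map `l` leaves a loosened identity in the second place, where `pair_loosen_right` removes
it. -/
theorem ρ_α_l (a b : A.Obj) :
    A.unaryComp (U.tensorMap (U.ρ a) (A.one b))
      (A.unaryComp (U.α a U.unit b) (U.tensorMap (A.one a) (U.l b))) = A.one (U.tensor a b) :=
  U.ext_pair
    (by simp [ap_tensorMap, ap_unaryComp, ap_α, ap_one, ap_ρ, ap_l, pair_loosen_right])

theorem ρ_l : A.unaryComp (U.ρ U.unit) (U.l U.unit) = A.one U.unit :=
  U.ext_unit (by
    simp [ap_unaryComp, ap_one, ap_ρ, ap_l]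
    -- What remains is that loosening fixes `θ₀`, which is loose.
    exact loosen_of_loose rfl)

/-- The skew monoidal category determined by a choice of universal multimaps. -/
@[reducible]
noncomputable def skewMonCat : SkewMonCat.{v, u} where
  Obj := A.Obj
  cat := A.underlying
  tensor := U.tensor
  tensorMap f g := U.tensorMap f g
  tensorMap_id := U.tensorMap_one
  tensorMap_comp := U.tensorMap_unaryComp
  unit := U.unit
  α := U.α
  l := U.l
  ρ := U.ρ
  α_natural := U.α_natural
  l_natural := U.l_natural
  ρ_natural := U.ρ_natural
  pentagon := U.pentagon
  α_l := U.α_l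
  ρ_α := U.ρ_α
  ρ_α_l := U.ρ_α_l
  ρ_l := U.ρ_l

/-- The skew monoidal category determined by universal multimaps is associated with the skew
multicategory. -/
noncomputable def association : Association U.skewMonCat A where
  obj := Equiv.refl _
  hom := Equiv.refl _
  hom_id _ := rfl
  hom_comp _ _ := rfl
  θ₀ := U.θ₀
  θ₀_universal := U.θ₀_universal
  θ := U.θ
  θ_universal := U.θ_universal
  hom_tensorMap {a a' b b'} f g := by
    have := U.ap_tensorMap f g (A.oneM a) (A.oneM b) rfl rfl
    rw [pair_one, ap_oneM, ap_oneM] at this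
    exact (sub_eq rfl).symm.trans (this.trans (sub_eq rfl))
  hom_α a b c := by
    have := U.ap_α a b c (A.oneM a) (A.oneM b) (A.oneM c) rfl rfl rfl
    rw [pair_one, pair_one] at this
    rw [pair, pair, sub_eq rfl, sub_eq rfl] at this
    exact (sub_eq rfl).symm.trans this
  hom_l a := by
    have := U.ap_l a (A.oneM a) rfl
    rw [pair, sub_eq rfl] at this
    exact (sub_eq rfl).symm.trans this
  hom_ρ _ := rfl

end UnivData

end SkewMulticat

/-! ### Isomorphism between a left representable skew multicategory and that of an associated
category -/

namespace SkewMulticat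

/-- The inverse of a morphism of skew multicategories that is bijective on objects and on
multimaps. -/
@[reducible]
def Functor.inverse {A B : SkewMulticat.{v, u}} (F : Functor A B) (o : A.Obj ≃ B.Obj)
    (m : A.Map ≃ B.Map) (ho : ∀ a, F.obj a = o a) (hm : ∀ f, F.map f = m f) : Functor B A where
  obj := o.symm
  map := m.symm
  map_kind f := by rw [← F.map_kind, hm, m.apply_symm_apply]
  map_src f := by
    obtain ⟨f, rfl⟩ := m.surjective f
    rw [m.symm_apply_apply, ← hm, F.map_src, List.map_map]
    conv_lhs => rw [← List.map_id f.src]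
    exact List.map_congr_left fun a _ => by simp [ho]
  map_tgt f := by
    obtain ⟨f, rfl⟩ := m.surjective f
    rw [m.symm_apply_apply, ← hm, F.map_tgt, ho, o.symm_apply_apply]
  map_loosen f := by
    rw [m.symm_apply_eq, ← hm, F.map_loosen, hm, m.apply_symm_apply]
  map_one a := by
    rw [m.symm_apply_eq, ← hm, F.map_one, ho, o.apply_symm_apply]
  map_subst g fs h h' := by
    have e : (fs.map m.symm).map F.map = fs := by
      rw [List.map_map]
      conv_rhs => rw [← List.map_id fs]
      exact List.map_congr_left fun f _ => by simp [hm]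
    rw [m.symm_apply_eq, ← hm, F.map_subst _ _ h' (F.map_tgt_list h')]
    exact B.substM_congr (by rw [hm, m.apply_symm_apply]) e.symm _ _

/-- A morphism that is bijective on objects and on multimaps is invertible. -/
def Functor.oneIso {A B : SkewMulticat.{v, u}} (F : Functor A B) (o : A.Obj ≃ B.Obj)
    (m : A.Map ≃ B.Map) (ho : ∀ a, F.obj a = o a) (hm : ∀ f, F.map f = m f) :
    TwoCat.OneIso A B where
  hom := F
  inv := F.inverse o m ho hm
  hom_inv := Functor.ext_map fun f => by
    change m.symm (F.map f) = f
    rw [hm, m.symm_apply_apply]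
  inv_hom := Functor.ext_map fun f => by
    change F.map (m.symm f) = f
    rw [hm, m.apply_symm_apply]

theorem exists_of_eq {A : SkewMulticat.{v, u}} (m : A.Map) {k : SkewKind} {Γ : List A.Obj}
    {b : A.Obj} (hk : m.kind = k) (hs : m.src = Γ) (ht : m.tgt = b) :
    ∃ f : A.Hom k Γ b, Multimap.of f = m := by
  subst hk hs ht
  exact ⟨m.map, rfl⟩

end SkewMulticat

namespace SkewRep

open SkewMulticat

variable {C : SkewMonCat.{v, u}} {A : SkewMulticat.{v, u}} (R : SkewRep C A)

/-- The link between the two notions of closedness: if `p` corresponds to the evaluation of `A`,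
then substitution into that evaluation becomes the map `g ↦ (g ⊗ 1) ≫ p` of `C`. -/
theorem sub_sub_θM {a b c h : C.Obj} (p : C.tensor h b ⟶ c) (g : a ⟶ h) (m : A.Map)
    (hm : m.tgt = R.obj a) :
    A.sub (A.sub (R.homM p) [R.θM h b]) [A.sub (R.homM g) [m], A.oneM (R.obj b)] =
      A.sub (R.homM (C.tensorMap g (𝟙 b) ≫ p)) [A.sub (R.θM a b) [m, A.oneM (R.obj b)]] := by
  have h₁ := sub_pair (k := R.θM h b) (g := R.homM g) (g' := A.oneM (R.obj b)) (fs := [m])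
    (fs' := [A.oneM (R.obj b)]) rfl (by simp [hm]) rfl
  rw [sub_homM_comp _ _ _ _ (by simp), sub_unary (u := R.homM (C.tensorMap g (𝟙 b))) rfl
    (by simp [hm]), sub_tensorMap, homM_id, ← sub_unary rfl (by simp)]
  refine congrArg (fun x => A.sub (R.homM p) [x]) (Eq.trans ?_ h₁.symm)
  rw [one_sub (A.oneM (R.obj b)) rfl]

end SkewRep

namespace Association

open SkewMulticat

variable {C : SkewMonCat.{v, u}} {A : SkewMulticat.{v, u}} (κ : Association C A)

/-- The representation underlying an association. -/
@[reducible]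
def rep : SkewRep C A where
  obj := κ.obj
  hom := κ.hom
  hom_id := κ.hom_id
  hom_comp := κ.hom_comp
  θ₀ := κ.θ₀
  θ := κ.θ
  hom_tensorMap := κ.hom_tensorMap
  hom_α := κ.hom_α
  hom_l := κ.hom_l
  hom_ρ := κ.hom_ρ

theorem isUniversal_ΘM (hA : A.IsLeftRepresentable) (x : C.Obj) (Γ : List C.Obj) :
    A.IsUniversal (κ.rep.ΘM x Γ) := by
  induction Γ generalizing x with
  | nil => exact isUniversal_oneM _
  | cons a Γ ih =>
    rw [SkewRep.ΘM_cons]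
    exact (ih _).comp (hA.2 _ (κ.θ_universal x a)) rfl rfl

/-- Since `κ.rep.map` composes with these multimaps and `κ.hom` is bijective, their universality
amounts to bijectivity of `κ.rep.map` on each hom-set. -/
theorem isUniversal_univM (hA : A.IsLeftRepresentable) (k : SkewKind) (Γ : List C.Obj)
    (h : k = .tight → Γ ≠ []) : A.IsUniversal (κ.rep.univM k Γ h) := by
  rcases k with _ | _
  · rcases Γ with _ | ⟨a, Γ⟩
    · exact absurd rfl (h rfl)
    · exact κ.isUniversal_ΘM hA a Γ
  · rw [SkewRep.univM_loose]
    exact (κ.isUniversal_ΘM hA _ Γ).comp (hA.2 _ κ.θ₀_universal) rfl rfl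

theorem rep_map_injective (hA : A.IsLeftRepresentable) : Function.Injective κ.rep.map := by
  intro f g h
  have hk := congrArg Multimap.kind h
  have hs := congrArg Multimap.src h
  have ht := congrArg Multimap.tgt h
  rw [SkewRep.map_kind, SkewRep.map_kind] at hk
  rw [SkewRep.map_src, SkewRep.map_src] at hs
  rw [SkewRep.map_tgt, SkewRep.map_tgt] at ht
  replace hs := List.map_injective_iff.2 κ.obj.injective hs
  replace ht := κ.obj.injective ht
  rcases f with ⟨k, Γ, b, f⟩
  rcases g with ⟨k', Γ', b', g⟩
  dsimp at hk hs ht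
  subst hk hs ht
  refine SkewMonCat.of_eq_iff.2 (κ.hom.injective ?_)
  exact (κ.isUniversal_univM hA _ _ f.2).hom_ext rfl h

theorem rep_map_surjective (hA : A.IsLeftRepresentable) : Function.Surjective κ.rep.map := by
  rintro ⟨k, Γ, b, m⟩
  obtain ⟨Γ, rfl⟩ : ∃ Γ' : List C.Obj, Γ = Γ'.map κ.obj :=
    ⟨Γ.map κ.obj.symm, by simp [Function.comp_def]⟩
  obtain ⟨b, rfl⟩ := κ.obj.surjective b
  have h : k = .tight → Γ ≠ [] := by
    rintro rfl rfl
    exact (A.tight_nil _).false m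
  obtain ⟨f, hf⟩ := (κ.isUniversal_univM hA k Γ h).exists_ap_eq (Multimap.of m) rfl rfl rfl rfl
  obtain ⟨f, rfl⟩ := κ.hom.surjective f
  exact ⟨Multimap.of ⟨f, h⟩, hf⟩

/-- A left representable skew multicategory is isomorphic to the one of any skew monoidal category
associated with it. -/
noncomputable def oneIso (hA : A.IsLeftRepresentable) : TwoCat.OneIso C.multicat A :=
  κ.rep.functor.oneIso κ.obj
    (Equiv.ofBijective _ ⟨κ.rep_map_injective hA, κ.rep_map_surjective hA⟩)
    (fun _ => rfl) (fun _ => rfl)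

/-! ### Comparison of the two notions of closedness -/

theorem _root_.SkewMonCat.isClosed_of_association (κ : Association C A) (h : A.IsClosed) :
    C.IsClosed := by
  intro b c
  obtain ⟨h, e, he⟩ := h (κ.obj b) (κ.obj c)
  obtain ⟨h, rfl⟩ := κ.obj.surjective h
  -- The evaluation of `C` is the factorization of `e` through the universal multimap. Only the
  -- instances with one tight argument `a` are then needed.
  obtain ⟨p, hp⟩ := (κ.θ_universal h b).exists_ap_eq (Multimap.of e) rfl rfl rfl rfl
  obtain ⟨p, rfl⟩ := κ.hom.surjective p
  have key : ∀ {a : C.Obj} (f : a ⟶ h), A.sub (Multimap.of e)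
      [κ.rep.homM f, A.oneM (κ.obj b)] =
        ap (κ.hom (C.tensorMap f (𝟙 b) ≫ p)) (Multimap.of (κ.θ a b)) := by
    intro a f
    have := κ.rep.sub_sub_θM p f (A.oneM (κ.obj a)) rfl
    rw [show A.sub (κ.rep.homM f) [A.oneM (κ.obj a)] = κ.rep.homM f from ap_oneM _,
      show A.sub (κ.rep.homM p) [κ.rep.θM h b] = Multimap.of e from hp,
      show A.sub (κ.rep.θM a b) [A.oneM (κ.obj a), A.oneM (κ.obj b)] = κ.rep.θM a b from
        sub_one (κ.rep.θM a b) (Γ := [κ.obj a, κ.obj b]) rfl] at this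
    exact this
  refine ⟨h, p, fun a => ⟨fun f g hfg => ?_, fun q => ?_⟩⟩
  · obtain ⟨k, hk⟩ := exists_of_eq (A.sub (Multimap.of e) [κ.rep.homM f, A.oneM (κ.obj b)])
      (k := .tight) (Γ := [κ.obj a] ++ [κ.obj b]) (sub_kind rfl) (sub_src rfl) (sub_tgt _ _)
    have hg : A.sub (Multimap.of e) [κ.rep.homM g, A.oneM (κ.obj b)] = Multimap.of k := by
      rw [hk, key, key]
      exact congrArg (fun x => ap (κ.hom x) _) hfg.symm
    rw [sub_eq rfl] at hk hg
    exact κ.hom.injective ((he .tight [κ.obj a] (by simp) k).unique hk.symm hg)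
  · obtain ⟨k, hk⟩ := exists_of_eq (ap (κ.hom q) (Multimap.of (κ.θ a b)))
      (k := .tight) (Γ := [κ.obj a] ++ [κ.obj b]) (ap_kind _ _ rfl) (ap_src _ _ rfl)
      (sub_tgt _ _)
    obtain ⟨f, hf, -⟩ := he .tight [κ.obj a] (by simp) k
    obtain ⟨f, rfl⟩ := κ.hom.surjective f
    refine ⟨f, κ.hom.injective ((κ.θ_universal a b).hom_ext rfl ?_)⟩
    rw [← hk]
    refine (key f).symm.trans ?_
    rw [sub_eq rfl]
    exact hf

theorem _root_.SkewMulticat.isClosed_of_association (κ : Association C A)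
    (hA : A.IsLeftRepresentable) (h : C.IsClosed) : A.IsClosed := by
  intro b c
  obtain ⟨b, rfl⟩ := κ.obj.surjective b
  obtain ⟨c, rfl⟩ := κ.obj.surjective c
  obtain ⟨h, p, hp⟩ := h b c
  obtain ⟨e, he⟩ := exists_of_eq (ap (κ.hom p) (Multimap.of (κ.θ h b))) (k := .tight)
    (Γ := [κ.obj h, κ.obj b]) (ap_kind _ _ rfl) (ap_src _ _ rfl) (sub_tgt _ _)
  refine ⟨κ.obj h, e, fun x Γ hx k => ?_⟩
  -- A universal `φ` replaces the list `Γ` by the single object `m`. Left universality of `φ` makes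
  -- `θ m b` with `φ` in its first place universal, so the required bijection becomes that of `C` at
  -- `m`.
  obtain ⟨m, φ, hφ⟩ := hA.1 x Γ hx
  obtain ⟨m, rfl⟩ := κ.obj.surjective m
  have hU : A.IsUniversal (A.sub (κ.rep.θM m b) [Multimap.of φ, A.oneM (κ.obj b)]) :=
    (κ.θ_universal m b).comp (Δ := [κ.obj b]) (hA.2 _ hφ) rfl rfl
  have hUk : (A.sub (κ.rep.θM m b) [Multimap.of φ, A.oneM (κ.obj b)]).kind = x :=
    (sub_kind rfl).trans (SkewKind.comp_tight_cons _ _)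
  have hUs : (A.sub (κ.rep.θM m b) [Multimap.of φ, A.oneM (κ.obj b)]).src = Γ ++ [κ.obj b] :=
    sub_src rfl
  have key : ∀ (g : m ⟶ h), A.sub (Multimap.of e)
      [ap (κ.hom g) (Multimap.of φ), A.oneM (κ.obj b)] =
        ap (κ.hom (C.tensorMap g (𝟙 b) ≫ p))
          (A.sub (κ.rep.θM m b) [Multimap.of φ, A.oneM (κ.obj b)]) := by
    intro g
    rw [he]
    exact κ.rep.sub_sub_θM p g (Multimap.of φ) rfl
  obtain ⟨q, hq⟩ := hU.exists_ap_eq (a := κ.obj (C.tensor m b)) (Multimap.of k) hUk.symm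
    hUs.symm (sub_tgt _ _) rfl
  obtain ⟨q, rfl⟩ := κ.hom.surjective q
  obtain ⟨g, hg⟩ := (hp m).2 q
  obtain ⟨f, hf⟩ := exists_of_eq (ap (κ.hom g) (Multimap.of φ)) (k := x) (Γ := Γ)
    (ap_kind _ _ rfl) (ap_src _ _ rfl) (sub_tgt _ _)
  refine ⟨f, ?_, fun f₂ hf₂ => ?_⟩
  · refine (sub_eq (g := Multimap.of e) (fs := [Multimap.of f, A.oneM (κ.obj b)]) rfl).symm.trans ?_
    rw [hf, key, ← hq]
    exact congrArg (fun x => ap (κ.hom x) _) hg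
  -- Any competitor also factors through `φ`, so injectivity of `g ↦ (g ⊗ 1) ≫ p` decides
  -- uniqueness.
  · obtain ⟨g₂, hg₂⟩ := hφ.exists_ap_eq (Multimap.of f₂) rfl rfl rfl rfl
    obtain ⟨g₂, rfl⟩ := κ.hom.surjective g₂
    have h₂ := (sub_eq (g := Multimap.of e) (fs := [Multimap.of f₂, A.oneM (κ.obj b)]) rfl).trans
      hf₂
    rw [← hg₂, key, ← hq] at h₂
    have h₃ := κ.hom.injective (hU.hom_ext (sub_tgt _ _) h₂)
    obtain rfl : g₂ = g := (hp m).1 (h₃.trans hg.symm)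
    exact Multimap.of_inj (hg₂.symm.trans hf.symm)

theorem isClosed_iff (κ : Association C A) (hA : A.IsLeftRepresentable) : A.IsClosed ↔ C.IsClosed :=
  ⟨SkewMonCat.isClosed_of_association κ, SkewMulticat.isClosed_of_association κ hA⟩

end Association

/-! ### The 2-equivalences onto full sub-2-categories -/

namespace TwoCat

open Bicategory

variable {B : Type u₁} [Bicategory.{w₁, v₁} B] {C : Type u₂} [Bicategory.{w₂, v₂} C]

/-- A 2-functor that is bijective on 1-cells and on 2-cells, and surjective up to isomorphism on
the objects that satisfy `P`, is a 2-equivalence onto the full sub-2-category on these. -/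
theorem isTwoEquivalence_corestrict [Strict B] [Strict C] (F : StrictPseudofunctor B C)
    (P : C → Prop) (h : ∀ b, P (F.obj b))
    (hF : ∀ X Y : B, Function.Bijective fun f : X ⟶ Y => F.map f)
    (hF₂ : ∀ (X Y : B) (f g : X ⟶ Y), Function.Bijective fun η : f ⟶ g => F.map₂ η)
    (hobj : ∀ c, P c → ∃ b, Nonempty (OneIso (F.obj b) c)) :
    IsTwoEquivalence (corestrict F P h) := by
  choose o i using hobj
  choose l hl using fun X Y => (hF X Y).2
  choose l₂ hl₂ using fun X Y f g => (hF₂ X Y f g).2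
  refine EquivData.isTwoEquivalence
    { obj := fun c => o c.1 c.2
      iso := fun c =>
        { hom := InducedBicategory.mkHom (i c.1 c.2).some.hom
          inv := InducedBicategory.mkHom (i c.1 c.2).some.inv
          hom_inv := InducedBicategory.hom_ext (i c.1 c.2).some.hom_inv
          inv_hom := InducedBicategory.hom_ext (i c.1 c.2).some.inv_hom }
      lift := fun f => l _ _ f.hom
      map_lift := fun f => InducedBicategory.hom_ext (hl _ _ _)
      map_injective := fun {X Y f g} e => (hF X Y).1 (congrArg
        (fun k : (corestrict F P h).obj X ⟶ (corestrict F P h).obj Y => k.hom) e)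
      lift₂ := fun η => l₂ _ _ _ _ η.hom
      map₂_lift₂ := fun η => InducedBicategory.hom₂_ext (hl₂ _ _ _ _ _)
      map₂_injective := fun {X Y f g η θ} e => (hF₂ X Y f g).1 (congrArg
        (fun k : (corestrict F P h).map f ⟶ (corestrict F P h).map g => k.hom) e) }

end TwoCat

namespace SkewMonCat

open SkewMulticat

/-- For surjectivity, a morphism is restricted to the generators, read as a lax monoidal functor,
and recovered by `ofFunctor_functor`. -/
theorem toMulticat_map_bijective (C D : SkewMonCat.{v, u}) :
    Function.Bijective fun F : C ⟶ D => toMulticat.map F :=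
  ⟨LaxFunctor.rep_injective, fun F => ⟨(SkewRep.ofFunctor F).laxFunctor,
    SkewRep.ofFunctor_functor F⟩⟩

/-- The monoidal transformation given by a 2-cell of skew multicategories. -/
def monTransOfTrans {C D : SkewMonCat.{v, u}} {F G : LaxFunctor C D}
    (φ : Trans F.rep.functor G.rep.functor) : MonTrans F G where
  app a := (φ.app a).1
  naturality {a b} f := by
    have h := φ.natAt (Multimap.of (munary f))
    change D.multicat.sub (Multimap.of (φ.app b)) [_] =
      D.multicat.sub _ [Multimap.of (φ.app a)] at h
    rw [SkewRep.functor_map_munary, SkewRep.functor_map_munary, sub_eq rfl, sub_eq rfl] at h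
    exact of_eq_iff.1 ((substM_munary _ _).symm.trans (h.trans (substM_munary _ _)))
  unit := by
    have h := φ.natAt (Multimap.of C.mθ₀)
    change D.multicat.sub (Multimap.of (φ.app C.unit)) [_] = D.multicat.sub _ [] at h
    rw [SkewRep.functor_map_θ₀, SkewRep.functor_map_θ₀, sub_eq rfl,
      show D.multicat.sub G.rep.θ₀M [] = G.rep.θ₀M from sub_one G.rep.θ₀M (Γ := []) rfl] at h
    exact of_eq_iff.1 ((substM_munary _ _).symm.trans h)
  tensor a b := by
    have h := φ.natAt (Multimap.of (C.mθ a b))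
    change D.multicat.sub (Multimap.of (φ.app (C.tensor a b))) [_] =
      D.multicat.sub _ [Multimap.of (φ.app a), Multimap.of (φ.app b)] at h
    rw [SkewRep.functor_map_θ, SkewRep.functor_map_θ, sub_eq rfl, sub_eq rfl] at h
    exact of_eq_iff.1 ((substM_munary _ _).symm.trans (h.trans (substM_pair_unary _ _ _)))

theorem toMulticat_map₂_bijective (C D : SkewMonCat.{v, u}) (F G : C ⟶ D) :
    Function.Bijective fun φ : F ⟶ G => toMulticat.map₂ φ := by
  refine ⟨fun φ ψ h => MonTrans.ext (funext fun a => ?_), fun φ =>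
    ⟨monTransOfTrans φ, Trans.ext rfl⟩⟩
  exact congrArg (fun τ : Trans (LaxFunctor.rep F).functor (LaxFunctor.rep G).functor =>
    (τ.app a).1) h

theorem toMulticat_obj_isClosed_iff (C : SkewMonCat.{v, u}) :
    C.IsClosed ↔ (toMulticat.obj C).IsClosed :=
  (C.association.isClosed_iff C.multicat_isLeftRepresentable).symm

theorem _root_.SkewMulticat.IsLeftRepresentable.exists_oneIso {A : SkewMulticat.{v, u}}
    (hA : A.IsLeftRepresentable) :
    ∃ C : SkewMonCat.{v, u}, Nonempty (Association C A) ∧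
      Nonempty (TwoCat.OneIso (toMulticat.obj C) A) := by
  obtain ⟨U⟩ := hA.nonempty_univData
  exact ⟨U.skewMonCat, ⟨U.association⟩, ⟨U.association.oneIso hA⟩⟩

open TwoCat Bicategory

theorem isTwoEquivalence_toMulticat (h : ∀ C, (toMulticat.obj C).IsLeftRepresentable) :
    IsTwoEquivalence (corestrict toMulticat.{v, u} IsLeftRepresentable h) :=
  isTwoEquivalence_corestrict _ _ _ toMulticat_map_bijective toMulticat_map₂_bijective
    fun _ hA => hA.exists_oneIso.imp fun _ h => h.2

/-- The full sub-2-category has the same 1-cells and 2-cells up to wrapping, so only objects need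
attention: the associated category of a closed `A` is closed by `Association.isClosed_iff`. -/
theorem isTwoEquivalence_incl_comp_toMulticat
    (h : ∀ C : FullSub SkewMonCat.{v, u} SkewMonCat.IsClosed,
      (((incl SkewMonCat.IsClosed).comp toMulticat).obj C).IsLeftRepresentable ∧
        (((incl SkewMonCat.IsClosed).comp toMulticat).obj C).IsClosed) :
    IsTwoEquivalence (corestrict ((incl SkewMonCat.IsClosed).comp toMulticat)
      (fun A : SkewMulticat.{v, u} => A.IsLeftRepresentable ∧ A.IsClosed) h) := by
  refine isTwoEquivalence_corestrict _ _ _ (fun X Y => ?_) (fun X Y f g => ?_) fun A hA => ?_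
  · have h := toMulticat_map_bijective X.1 Y.1
    refine ⟨fun f g e => InducedBicategory.hom_ext (h.1 e), fun f => ?_⟩
    obtain ⟨F, hF⟩ := h.2 f
    exact ⟨InducedBicategory.mkHom F, hF⟩
  · have h := toMulticat_map₂_bijective X.1 Y.1 f.hom g.hom
    refine ⟨fun φ ψ e => InducedBicategory.hom₂_ext (h.1 e), fun φ => ?_⟩
    obtain ⟨F, hF⟩ := h.2 φ
    exact ⟨⟨F⟩, hF⟩
  · obtain ⟨C, ⟨κ⟩, h⟩ := hA.1.exists_oneIso
    exact ⟨⟨C, (κ.isClosed_iff hA.1).1 hA.2⟩, h⟩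

end SkewMonCat

theorem mainTheorem5 :
    (∃ Φ : StrictPseudofunctor SkewMonCat.{v, u} SkewMulticat.{v, u}, IsCanonical Φ ∧
      ∃ hrep : ∀ C : SkewMonCat.{v, u}, (Φ.obj C).IsLeftRepresentable,
        TwoCat.IsTwoEquivalence
          (TwoCat.corestrict Φ SkewMulticat.IsLeftRepresentable hrep) ∧
        (∀ C : SkewMonCat.{v, u}, C.IsClosed ↔ (Φ.obj C).IsClosed) ∧
        ∃ hcl : ∀ C : TwoCat.FullSub SkewMonCat.{v, u} SkewMonCat.IsClosed,
            (((TwoCat.incl SkewMonCat.IsClosed).comp Φ).obj C).IsLeftRepresentable ∧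
              (((TwoCat.incl SkewMonCat.IsClosed).comp Φ).obj C).IsClosed,
          TwoCat.IsTwoEquivalence
            (TwoCat.corestrict ((TwoCat.incl SkewMonCat.IsClosed).comp Φ)
              (fun A : SkewMulticat.{v, u} => A.IsLeftRepresentable ∧ A.IsClosed) hcl)) ∧
    (∀ A : SkewMulticat.{v, u}, A.IsLeftRepresentable →
      (∃ C : SkewMonCat.{v, u}, Nonempty (Association C A)) ∧
      ∀ (C : SkewMonCat.{v, u}) (_ : Association C A), A.IsClosed ↔ C.IsClosed) := by
  exact ⟨⟨SkewMonCat.toMulticat, SkewMonCat.toMulticat_isCanonical,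
    SkewMonCat.multicat_isLeftRepresentable, SkewMonCat.isTwoEquivalence_toMulticat _,
    SkewMonCat.toMulticat_obj_isClosed_iff,
    fun C => ⟨SkewMonCat.multicat_isLeftRepresentable C.1,
      (SkewMonCat.toMulticat_obj_isClosed_iff C.1).1 C.2⟩,
    SkewMonCat.isTwoEquivalence_incl_comp_toMulticat _⟩,
    fun A hA => ⟨hA.exists_oneIso.imp fun _ h => h.1, fun C κ => κ.isClosed_iff hA⟩⟩
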